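/- Let $K,c_v>0$ and $\gamma>1$. Consider the full compressible Euler equations in Lagrangian coordinates for an ideal polytropic gas, $$\tau_t-u_x=0,\qquad u_t+p_x=0,\qquad \big(\tfrac12u^2+e\big)_t+(up)_x=0,\qquad p=K e^{S/c_v}\tau^{-\gamma},\quad e=\frac{p\tau}{\gamma-1},$$ where $u$ is the velocity, $\tau=1/\rho>0$ the specific volume, $\rho$ the density and $S$ the entropy (for $C^1$ solutions the system implies $S_t=0$, so $S=S(x)$). Put $m=e^{S/(2c_v)}$, $\eta=\frac{2\sqrt{K\gamma}}{\gamma-1}\tau^{-(\gamma-1)/2}$, and $$\alpha=u_x+m\eta_x+\tfrac{\gamma-1}{\gamma}m_x\eta,\qquad \beta=u_x-m\eta_x-\tfrac{\gamma-1}{\gamma}m_x\eta .$$ Let initial data $u(\cdot,0)$, $\tau(\cdot,0)>0$, $S(\cdot,0)=S(\cdot)$ on $\mathbb R$ be given such that $u(x,0)$, $\tau(x,0)$, $\rho(x,0)=1/\tau(x,0)$, $S(x)$, $S'(x)$, $\alpha(x,0)$ and $\beta(x,0)$ are all uniformly bounded and the total variation of $S$ over $\mathbb R$ is finite. Let $0<\varepsilon<\frac14$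 and $\delta=\frac{\varepsilon}{1-\varepsilon}>0$. Then there exist a constant $N_0$ and positive constants $N_1,N_2$, depending on $K,c_v,\gamma,\varepsilon$ and the initial data but not on $T$, such that for every $T\in(0,\infty]$ and every $C^1$ solution $(u,\tau,S)$ of the system on $\mathbb R\times[0,T)$, with $\tau>0$ and with these initial data, one has for all $(x,t)\in\mathbb R\times[0,T)$ $$\rho^\varepsilon\tau_t=\rho^\varepsilon u_x<N_0\qquad\text{and}\qquad \rho(x,t)\ \ge\ \Big(\frac{N_1}{N_2+t}\Big)^{1+\delta}.$$ -/

import Mathlib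

noncomputable section

namespace FullEuler

/-- The times `t ≥ 0` with `t < T`, where `T` may be a real number or infinity. -/
def times (T : EReal) : Set ℝ := {t : ℝ | 0 ≤ t ∧ (t : EReal) < T}

/-- The partial derivative in `x` of a function of `(x, t)`. -/
def partialX (f : ℝ → ℝ → ℝ) (x t : ℝ) : ℝ := deriv (fun y => f y t) x

/-- The partial derivative in `t` of a function of `(x, t)` on `ℝ × [0, T)`
(one-sided at `t = 0`). -/
def partialT (T : EReal) (f : ℝ → ℝ → ℝ) (x t : ℝ) : ℝ :=
  derivWithin (fun s => f x s) (times T) t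

/-- Pressure `p = K e^{S / c_v} τ^{-γ}` of an ideal polytropic gas. -/
def pressure (K cv γ τ S : ℝ) : ℝ := K * Real.exp (S / cv) * τ ^ (-γ)

/-- Specific internal energy `e = p τ / (γ - 1)`. -/
def internalEnergy (K cv γ τ S : ℝ) : ℝ := pressure K cv γ τ S * τ / (γ - 1)

/-- `(u, τ, S)` is a `C¹` solution (`C¹` up to the initial line) on `ℝ × [0, T)` of the full
compressible Euler equations in Lagrangian coordinates for an ideal polytropic gas. -/
structure IsC1Solution (K cv γ : ℝ) (T : EReal) (u τ S : ℝ → ℝ → ℝ) : Prop where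
  contDiff_u : ContDiffOn ℝ 1 (Function.uncurry u) (Set.univ ×ˢ times T)
  contDiff_τ : ContDiffOn ℝ 1 (Function.uncurry τ) (Set.univ ×ˢ times T)
  contDiff_S : ContDiffOn ℝ 1 (Function.uncurry S) (Set.univ ×ˢ times T)
  τ_pos : ∀ x, ∀ t ∈ times T, 0 < τ x t
  mass : ∀ x, ∀ t ∈ times T, partialT T τ x t - partialX u x t = 0
  momentum : ∀ x, ∀ t ∈ times T,
    partialT T u x t + partialX (fun y s => pressure K cv γ (τ y s) (S y s)) x t = 0
  energy : ∀ x, ∀ t ∈ times T,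
    partialT T (fun y s => 1 / 2 * u y s ^ 2 + internalEnergy K cv γ (τ y s) (S y s)) x t
      + partialX (fun y s => u y s * pressure K cv γ (τ y s) (S y s)) x t = 0

/-- `m = e^{S / (2 c_v)}`. -/
def mVar (cv S : ℝ) : ℝ := Real.exp (S / (2 * cv))

/-- `η = (2 √(K γ) / (γ - 1)) τ^{-(γ - 1) / 2}`. -/
def etaVar (K γ τ : ℝ) : ℝ := 2 * Real.sqrt (K * γ) / (γ - 1) * τ ^ (-((γ - 1) / 2))

/-- `α = u_x + m η_x + ((γ - 1) / γ) m_x η` for the profiles `u, τ, S` at one instant. -/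
def alphaVar (K cv γ : ℝ) (u τ S : ℝ → ℝ) (x : ℝ) : ℝ :=
  deriv u x + mVar cv (S x) * deriv (fun y => etaVar K γ (τ y)) x
    + (γ - 1) / γ * deriv (fun y => mVar cv (S y)) x * etaVar K γ (τ x)

/-- `β = u_x - m η_x - ((γ - 1) / γ) m_x η` for the profiles `u, τ, S` at one instant. -/
def betaVar (K cv γ : ℝ) (u τ S : ℝ → ℝ) (x : ℝ) : ℝ :=
  deriv u x - mVar cv (S x) * deriv (fun y => etaVar K γ (τ y)) x
    - (γ - 1) / γ * deriv (fun y => mVar cv (S y)) x * etaVar K γ (τ x)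

/-- A real function on the line is uniformly bounded. -/
def UniformlyBounded (f : ℝ → ℝ) : Prop := ∃ C : ℝ, ∀ x, |f x| ≤ C

/-- The assumptions on the initial data `(u₀, τ₀, S₀)`. -/
structure AdmissibleData (K cv γ : ℝ) (u₀ τ₀ S₀ : ℝ → ℝ) : Prop where
  τ_pos : ∀ x, 0 < τ₀ x
  u_bdd : UniformlyBounded u₀
  τ_bdd : UniformlyBounded τ₀
  ρ_bdd : UniformlyBounded (fun x => 1 / τ₀ x)
  S_bdd : UniformlyBounded S₀
  S_deriv_bdd : UniformlyBounded (deriv S₀)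
  α_bdd : UniformlyBounded (alphaVar K cv γ u₀ τ₀ S₀)
  β_bdd : UniformlyBounded (betaVar K cv γ u₀ τ₀ S₀)
  S_variation : eVariationOn S₀ Set.univ ≠ ⊤

end FullEuler

end

/-! Since the entropy does not move, the system becomes a flow `(u, η)` in a stationary medium
`m(x)`, with sound speed `c = k m η ^ ν`, `ν = (γ + 1) / (γ - 1)`. The Riemann variables `u ± m η`
change along their characteristics at the rate `c m' η / γ`. The proof has two halves: a bound for
`η` (that is, for the density) independent of the lifespan, and an upper bound for the weighted
gradients `η ^ q α`, `η ^ q β` with `q = 2 ε / (γ - 1)`, for which `η ^ q` is a constant times `ρ ^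
ε`.

Bound for `η`. Energy leaves the region between two characteristics that meet fast enough to pay for
the source terms on them; this yields Riemann variables growing at most linearly in time
(`exists_cone_estimate`, `exists_apriori_bound`). If `η` were too large at `(x, t₀)`, the
characteristic of speed `-c` through that point would overtake the one issuing from `(x, 0)`, and at
the crossing the Riemann variable would have two incompatible values. So a solution that lasts up to
`B (1 + t₀)` satisfies an improved bound at `t₀` (`exists_improvement`). Measured with the weight
`exp (Λ V)`, where `V' = |m'| / γ` and `V` is bounded by finite variation, the improvement is a
contraction and can be iterated (`exists_iterated_bound`). Finally, either all lifespans for the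
given data are bounded and linear growth suffices, or arbitrarily long solutions exist, every
solution agrees with them by uniqueness, and infinitely many iterations remove the dependence on
time (`exists_uniform_bound`).

Gradient bound. Along characteristics `η ^ q α` and `η ^ q β` obey Riccati equations. Because `q < ν
/ 2`, the larger of the two decreases once it exceeds a threshold given by the bounds on `η` and
`m'` (`riccati_neg`). The gradients of a `C¹` solution are merely continuous, so the maximum
principle is applied through time difference quotients (`max_principle`, `exists_gradient_bound`).
As `u_x` is the mean of `α` and `β`, `ρ ^ ε u_x` is bounded above; integrating `τ ^ (-ε) τ_t ≤ N`
makes `τ ^ (1 - ε)` grow at most linearly, which is the lower bound for the density. -/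

open Set Filter Topology Function

namespace GasDynamics

/-! ### Functions with continuous partial derivatives on a slab -/

/-- The closed slab `ℝ × [0, t₁]`. -/
def slab (t₁ : ℝ) : Set (ℝ × ℝ) := univ ×ˢ Icc 0 t₁

theorem mem_slab {t₁ x t : ℝ} : (x, t) ∈ slab t₁ ↔ t ∈ Icc 0 t₁ := by simp [slab]

/-- The linear form `(y, s) ↦ a y + b s`. -/
def linForm (a b : ℝ) : ℝ × ℝ →L[ℝ] ℝ :=
  a • ContinuousLinearMap.fst ℝ ℝ ℝ + b • ContinuousLinearMap.snd ℝ ℝ ℝ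

@[simp] theorem linForm_apply (a b : ℝ) (p : ℝ × ℝ) : linForm a b p = a * p.1 + b * p.2 := by
  simp [linForm]

/-- `f` is continuously differentiable on the slab `ℝ × [0, t₁]`, with partial derivatives
`fx` and `ft`. -/
structure HasPartials (t₁ : ℝ) (f fx ft : ℝ → ℝ → ℝ) : Prop where
  cont_x : ContinuousOn (uncurry fx) (slab t₁)
  cont_t : ContinuousOn (uncurry ft) (slab t₁)
  hasFDeriv : ∀ x, ∀ t ∈ Icc 0 t₁,
    HasFDerivWithinAt (uncurry f) (linForm (fx x t) (ft x t)) (slab t₁) (x, t)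

namespace HasPartials

variable {t₁ : ℝ} {f fx ft g gx gt : ℝ → ℝ → ℝ}

theorem cont (hf : HasPartials t₁ f fx ft) : ContinuousOn (uncurry f) (slab t₁) := by
  rintro ⟨x, t⟩ h
  exact (hf.hasFDeriv x t (mem_slab.1 h)).continuousWithinAt

theorem congr {fx' ft' : ℝ → ℝ → ℝ} (hf : HasPartials t₁ f fx ft)
    (hx : ∀ x, ∀ t ∈ Icc 0 t₁, fx' x t = fx x t) (ht : ∀ x, ∀ t ∈ Icc 0 t₁, ft' x t = ft x t) :
    HasPartials t₁ f fx' ft' where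
  cont_x := hf.cont_x.congr (by rintro ⟨x, t⟩ h; exact hx x t (mem_slab.1 h))
  cont_t := hf.cont_t.congr (by rintro ⟨x, t⟩ h; exact ht x t (mem_slab.1 h))
  hasFDeriv x t h := by rw [hx x t h, ht x t h]; exact hf.hasFDeriv x t h

theorem mono {t₂ : ℝ} (hf : HasPartials t₁ f fx ft) (h : t₂ ≤ t₁) : HasPartials t₂ f fx ft := by
  have hs : slab t₂ ⊆ slab t₁ := prod_mono Subset.rfl (Icc_subset_Icc le_rfl h)
  exact ⟨hf.cont_x.mono hs, hf.cont_t.mono hs, fun x t ht =>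
    (hf.hasFDeriv x t ⟨ht.1, ht.2.trans h⟩).mono hs⟩

theorem add (hf : HasPartials t₁ f fx ft) (hg : HasPartials t₁ g gx gt) :
    HasPartials t₁ (fun x t => f x t + g x t) (fun x t => fx x t + gx x t)
      (fun x t => ft x t + gt x t) where
  cont_x := hf.cont_x.add hg.cont_x
  cont_t := hf.cont_t.add hg.cont_t
  hasFDeriv x t h := by
    refine ((hf.hasFDeriv x t h).add (hg.hasFDeriv x t h)).congr_fderiv ?_
    ext <;> simp

theorem mul (hf : HasPartials t₁ f fx ft) (hg : HasPartials t₁ g gx gt) :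
    HasPartials t₁ (fun x t => f x t * g x t) (fun x t => fx x t * g x t + f x t * gx x t)
      (fun x t => ft x t * g x t + f x t * gt x t) where
  cont_x := (hf.cont_x.mul hg.cont).add (hf.cont.mul hg.cont_x)
  cont_t := (hf.cont_t.mul hg.cont).add (hf.cont.mul hg.cont_t)
  hasFDeriv x t h := by
    refine ((hf.hasFDeriv x t h).mul (hg.hasFDeriv x t h)).congr_fderiv ?_
    ext <;> simp [uncurry] <;> ring

/-- A function of `x` alone. -/
theorem of_x (t₁ : ℝ) {m m' : ℝ → ℝ} (hm : ∀ x, HasDerivAt m (m' x) x) (hc : Continuous m') :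
    HasPartials t₁ (fun x _ => m x) (fun x _ => m' x) (fun _ _ => 0) where
  cont_x := (hc.comp continuous_fst).continuousOn
  cont_t := continuousOn_const
  hasFDeriv x t h := by
    have := (HasFDerivAt.comp (g := m) (f := Prod.fst) ((x, t) : ℝ × ℝ) (hm x).hasFDerivAt
      hasFDerivAt_fst).hasFDerivWithinAt (s := slab t₁)
    refine this.congr_fderiv ?_
    ext <;> simp

theorem const (t₁ k : ℝ) : HasPartials t₁ (fun _ _ => k) (fun _ _ => 0) (fun _ _ => 0) :=
  of_x t₁ (fun _ => hasDerivAt_const _ _) continuous_const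

theorem const_mul (k : ℝ) (hf : HasPartials t₁ f fx ft) :
    HasPartials t₁ (fun x t => k * f x t) (fun x t => k * fx x t) (fun x t => k * ft x t) :=
  ((const t₁ k).mul hf).congr (by simp) (by simp)

theorem sub (hf : HasPartials t₁ f fx ft) (hg : HasPartials t₁ g gx gt) :
    HasPartials t₁ (fun x t => f x t - g x t) (fun x t => fx x t - gx x t)
      (fun x t => ft x t - gt x t) := by
  simpa [sub_eq_add_neg] using hf.add (hg.const_mul (-1))

/-- Composition with a function of one variable that is `C¹` on a set containing the values. -/
theorem comp {φ φ' : ℝ → ℝ} {s : Set ℝ} (hf : HasPartials t₁ f fx ft)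
    (hs : ∀ x, ∀ t ∈ Icc 0 t₁, f x t ∈ s) (hφ : ∀ y ∈ s, HasDerivAt φ (φ' y) y)
    (hc : ContinuousOn φ' s) :
    HasPartials t₁ (fun x t => φ (f x t)) (fun x t => φ' (f x t) * fx x t)
      (fun x t => φ' (f x t) * ft x t) where
  cont_x := (hc.comp hf.cont (by rintro ⟨x, t⟩ h; exact hs x t (mem_slab.1 h))).mul hf.cont_x
  cont_t := (hc.comp hf.cont (by rintro ⟨x, t⟩ h; exact hs x t (mem_slab.1 h))).mul hf.cont_t
  hasFDeriv x t h := by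
    have h1 : HasFDerivAt φ _ (uncurry f (x, t)) := (hφ _ (hs x t h)).hasFDerivAt
    refine (h1.comp_hasFDerivWithinAt (x, t) (hf.hasFDeriv x t h)).congr_fderiv ?_
    ext <;> simp <;> ring

theorem rpow (p : ℝ) (hf : HasPartials t₁ f fx ft) (hpos : ∀ x, ∀ t ∈ Icc 0 t₁, 0 < f x t) :
    HasPartials t₁ (fun x t => f x t ^ p) (fun x t => p * f x t ^ (p - 1) * fx x t)
      (fun x t => p * f x t ^ (p - 1) * ft x t) :=
  hf.comp (φ := fun y => y ^ p) (φ' := fun y => p * y ^ (p - 1)) (s := Ioi 0) hpos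
    (fun _ hy => Real.hasDerivAt_rpow_const (Or.inl (ne_of_gt hy)))
    (continuousOn_const.mul (fun _ hy =>
      (Real.continuousAt_rpow_const _ _ (Or.inl (ne_of_gt hy))).continuousWithinAt))

/-- Derivative along a curve. -/
theorem along (hf : HasPartials t₁ f fx ft) {X θ : ℝ → ℝ} {v w t : ℝ} {s : Set ℝ}
    (hX : HasDerivWithinAt X v s t) (hθ : HasDerivWithinAt θ w s t)
    (hs : ∀ r ∈ s, θ r ∈ Icc 0 t₁) (ht : t ∈ s) :
    HasDerivWithinAt (fun r => f (X r) (θ r)) (fx (X t) (θ t) * v + ft (X t) (θ t) * w) s t := by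
  have h := (hf.hasFDeriv (X t) (θ t) (hs t ht)).comp_hasDerivWithinAt (f := fun r => (X r, θ r)) t
    (hX.prodMk hθ) (fun r hr => mem_slab.2 (hs r hr))
  simpa [comp_def] using h

theorem deriv_x (hf : HasPartials t₁ f fx ft) {x t : ℝ} (ht : t ∈ Icc 0 t₁) :
    HasDerivAt (fun y => f y t) (fx x t) x := by
  have h := hf.along (X := fun y => y) (θ := fun _ => t) (s := univ) (t := x)
    (hasDerivWithinAt_id x univ) (hasDerivWithinAt_const x univ t) (fun _ _ => ht) (mem_univ x)
  simpa [hasDerivWithinAt_univ] using h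

theorem deriv_t (hf : HasPartials t₁ f fx ft) {x t : ℝ} (ht : t ∈ Icc 0 t₁) :
    HasDerivWithinAt (fun s => f x s) (ft x t) (Icc 0 t₁) t := by
  have h := hf.along (X := fun _ => x) (θ := fun s => s) (s := Icc 0 t₁) (t := t)
    (hasDerivWithinAt_const _ _ _) (hasDerivWithinAt_id _ _) (fun _ h => h) ht
  simpa using h

/-- Derivative along a curve parametrised by time. -/
theorem along_time (hf : HasPartials t₁ f fx ft) {X : ℝ → ℝ} {v t : ℝ} {s : Set ℝ}
    (hX : HasDerivWithinAt X v s t) (hs : s ⊆ Icc 0 t₁) (ht : t ∈ s) :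
    HasDerivWithinAt (fun r => f (X r) r) (fx (X t) t * v + ft (X t) t) s t := by
  simpa using hf.along hX (hasDerivWithinAt_id t s) (fun r hr => hs hr) ht

end HasPartials

/-- Two continuous partial derivatives make a function `C¹` on the slab. -/
theorem hasPartials_of_deriv {t₁ : ℝ} {f fx ft : ℝ → ℝ → ℝ}
    (hx : ∀ x, ∀ t ∈ Icc 0 t₁, HasDerivAt (fun y => f y t) (fx x t) x)
    (ht : ∀ x, ∀ t ∈ Icc 0 t₁, HasDerivWithinAt (fun s => f x s) (ft x t) (Icc 0 t₁) t)
    (cx : ContinuousOn (uncurry fx) (slab t₁)) (ct : ContinuousOn (uncurry ft) (slab t₁)) :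
    HasPartials t₁ f fx ft := by
  refine ⟨cx, ct, fun x t h => ?_⟩
  rw [hasFDerivWithinAt_iff_isLittleO, Asymptotics.isLittleO_iff]
  intro ε hε
  have e1 := Metric.continuousOn_iff.1 cx (x, t) (mem_slab.2 h) (ε / 2) (by positivity)
  obtain ⟨δ, hδ, H1⟩ := e1
  have e2 := (ht x t h).isLittleO
  rw [Asymptotics.isLittleO_iff] at e2
  have e2' := e2 (show 0 < ε / 2 by positivity)
  obtain ⟨δ', hδ', H2⟩ := Metric.mem_nhdsWithin_iff.1 e2'
  refine Metric.mem_nhdsWithin_iff.2 ⟨min δ δ', lt_min hδ hδ', ?_⟩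
  rintro ⟨y, s⟩ ⟨hys, hs⟩
  replace hs := mem_slab.1 hs
  rw [Metric.mem_ball, Prod.dist_eq, max_lt_iff, Real.dist_eq, Real.dist_eq] at hys
  have hy : |y - x| < δ := hys.1.trans_le (min_le_left _ _)
  have hsδ : |s - t| < δ := hys.2.trans_le (min_le_left _ _)
  have hsδ' : |s - t| < δ' := hys.2.trans_le (min_le_right _ _)
  have a2 := H2 (show s ∈ Metric.ball t δ' ∩ Icc 0 t₁ from ⟨by simpa [Real.dist_eq] using hsδ', hs⟩)
  -- Mean value inequality in `x` at the new time `s`; the time increment is taken at the fixed `x`,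
  -- where the plain derivative suffices.
  have a1 : |f y s - f x s - fx x t * (y - x)| ≤ ε / 2 * |y - x| := by
    have := Convex.norm_image_sub_le_of_norm_hasDerivWithin_le (𝕜 := ℝ)
      (f := fun z => f z s - fx x t * z) (f' := fun z => fx z s - fx x t) (s := uIcc x y)
      (C := ε / 2) (x := x) (y := y) (fun z _ => by
        have := ((hx z s hs).sub ((hasDerivAt_id' z).const_mul (fx x t))).hasDerivWithinAt
          (s := uIcc x y)
        rw [mul_one] at this
        exact this)
      (fun z hz => by
        have hzx : |z - x| ≤ |y - x| := by
          have := abs_sub_left_of_mem_uIcc hz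
          simpa using this
        refine (H1 (z, s) (mem_slab.2 hs) ?_).le
        rw [Prod.dist_eq, max_lt_iff, Real.dist_eq, Real.dist_eq]
        exact ⟨hzx.trans_lt hy, hsδ⟩) (convex_uIcc x y) left_mem_uIcc right_mem_uIcc
    simp only [Real.norm_eq_abs] at this
    convert this using 2
    ring
  simp only [Real.norm_eq_abs, mem_ofPred_eq, smul_eq_mul] at a2
  simp only [uncurry, linForm_apply, Prod.fst_sub, Prod.snd_sub, Real.norm_eq_abs, mem_ofPred_eq]
  have n1 : |y - x| ≤ ‖((y, s) : ℝ × ℝ) - (x, t)‖ := by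
    exact norm_fst_le (((y, s) : ℝ × ℝ) - (x, t))
  have n2 : |s - t| ≤ ‖((y, s) : ℝ × ℝ) - (x, t)‖ := by
    exact norm_snd_le (((y, s) : ℝ × ℝ) - (x, t))
  calc |f y s - f x t - (fx x t * (y - x) + ft x t * (s - t))|
      = |(f y s - f x s - fx x t * (y - x)) + (f x s - f x t - (s - t) * ft x t)| := by
        congr 1; ring
    _ ≤ ε / 2 * |y - x| + ε / 2 * |s - t| := (abs_add_le _ _).trans (add_le_add a1 a2)
    _ ≤ ε * ‖((y, s) : ℝ × ℝ) - (x, t)‖ := by nlinarith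

/-- A conservation law `E_t + P_x = 0` has a potential `Φ` with `Φ_x = E` and `Φ_t = -P`. -/
theorem exists_potential {t₁ : ℝ} {E Ex Et P Px Pt : ℝ → ℝ → ℝ}
    (hE : HasPartials t₁ E Ex Et) (hP : HasPartials t₁ P Px Pt)
    (h : ∀ x, ∀ t ∈ Icc 0 t₁, Et x t = -Px x t) :
    ∃ Φ : ℝ → ℝ → ℝ, HasPartials t₁ Φ E (fun x t => -P x t) := by
  have Ec : ∀ t ∈ Icc 0 t₁, Continuous (fun y => E y t) := fun t ht =>
    continuous_iff_continuousAt.2 fun y => (hE.deriv_x ht).continuousAt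
  have Pc : ∀ x, ContinuousOn (fun s => P x s) (Icc 0 t₁) := fun x t ht =>
    (hP.deriv_t ht).continuousWithinAt
  -- Divergence theorem: the two paths from the origin to `(x, t)` give the same potential. One form
  -- is differentiated in `x`, the other in `t`.
  have div : ∀ x, ∀ t ∈ Icc 0 t₁, (∫ y in (0 : ℝ)..x, E y t) - (∫ s in (0 : ℝ)..t, P 0 s)
      = (∫ y in (0 : ℝ)..x, E y 0) - ∫ s in (0 : ℝ)..t, P x s := by
    intro x t ht
    have hsub : (uIcc 0 x ×ˢ uIcc 0 t : Set (ℝ × ℝ)) ⊆ slab t₁ := by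
      rw [uIcc_of_le ht.1]
      exact prod_mono (subset_univ _) (Icc_subset_Icc le_rfl ht.2)
    have nb : ∀ p ∈ Ioo (min 0 x) (max 0 x) ×ˢ Ioo (min 0 t) (max 0 t), slab t₁ ∈ 𝓝 p := by
      rintro ⟨y, s⟩ ⟨-, hs⟩
      rw [min_eq_left ht.1, max_eq_right ht.1] at hs
      exact prod_mem_nhds univ_mem (Icc_mem_nhds hs.1 (hs.2.trans_le ht.2))
    have mem : ∀ p ∈ Ioo (min 0 x) (max 0 x) ×ˢ Ioo (min 0 t) (max 0 t), p.2 ∈ Icc 0 t₁ :=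
      fun p hp => by have := mem_of_mem_nhds (nb p hp); exact mem_slab.1 this
    have key := MeasureTheory.integral2_divergence_prod_of_hasFDerivAt (uncurry P) (uncurry E)
      (fun p => linForm (Px p.1 p.2) (Pt p.1 p.2)) (fun p => linForm (Ex p.1 p.2) (Et p.1 p.2))
      0 0 x t (hP.cont.mono hsub) (hE.cont.mono hsub)
      (fun p hp => (hP.hasFDeriv p.1 p.2 (mem p hp)).hasFDerivAt (nb p hp))
      (fun p hp => (hE.hasFDeriv p.1 p.2 (mem p hp)).hasFDerivAt (nb p hp))
      (by
        refine (MeasureTheory.integrableOn_zero).congr_fun (f := fun _ => (0 : ℝ)) ?_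
          (measurableSet_uIcc.prod measurableSet_uIcc)
        rintro ⟨y, s⟩ hp
        have := h y s (mem_slab.1 (hsub hp))
        simp [this])
    have z : (∫ y in (0 : ℝ)..x, ∫ s in (0 : ℝ)..t,
        (linForm (Px y s) (Pt y s) (1, 0) + linForm (Ex y s) (Et y s) (0, 1))) = 0 := by
      rw [intervalIntegral.integral_congr (g := fun _ => (0 : ℝ))]
      · simp
      intro y hy
      simp only
      rw [intervalIntegral.integral_congr (g := fun _ => (0 : ℝ))]
      · simp
      intro s hs
      have := h y s (mem_slab.1 (hsub (show (y, s) ∈ _ from ⟨hy, hs⟩)))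
      simp [this]
    rw [z] at key
    simp only [uncurry] at key
    linarith
  refine ⟨fun x t => (∫ y in (0 : ℝ)..x, E y t) - ∫ s in (0 : ℝ)..t, P 0 s,
    hasPartials_of_deriv ?_ ?_ hE.cont hP.cont.neg⟩
  · intro x t ht
    exact ((Ec t ht).integral_hasStrictDerivAt 0 x).hasDerivAt.sub_const _
  · intro x t ht
    have e : HasDerivWithinAt (fun s => ∫ r in (0 : ℝ)..s, P x r) (P x t) (Icc 0 t₁) t := by
      rcases eq_or_lt_of_le (ht.1.trans ht.2) with h0 | h0
      · subst h0
        have : t = 0 := le_antisymm ht.2 ht.1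
        subst this
        simp only [Icc_self]
        exact hasDerivWithinAt_iff_hasFDerivWithinAt.2 HasFDerivWithinAt.singleton
      have : Fact (t ∈ Icc 0 t₁) := ⟨ht⟩
      refine intervalIntegral.integral_hasDerivWithinAt_right
        (((Pc x).mono (by rw [uIcc_of_le ht.1]; exact Icc_subset_Icc le_rfl ht.2)).intervalIntegrable)
        ?_ (Pc x t ht)
      exact ((Pc x).stronglyMeasurableAtFilter_nhdsWithin measurableSet_Icc t)
    have := (e.const_sub (∫ y in (0 : ℝ)..x, E y 0))
    exact this.congr (fun s hs => div x s hs) (div x t ht)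

/-! ### Backward triangles, a maximum principle, and characteristics -/

/-- The backward triangle with apex `(x₀, t₀)` and speed `L`. -/
def triangle (L x₀ t₀ : ℝ) : Set (ℝ × ℝ) :=
  {p | 0 ≤ p.2 ∧ p.2 ≤ t₀ ∧ |p.1 - x₀| ≤ L * (t₀ - p.2)}

theorem isCompact_triangle {L x₀ t₀ : ℝ} (hL : 0 ≤ L) : IsCompact (triangle L x₀ t₀) := by
  refine IsCompact.of_isClosed_subset
    (isCompact_Icc (a := ((x₀ - L * t₀, 0) : ℝ × ℝ)) (b := (x₀ + L * t₀, t₀))) ?_ ?_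
  · have h1 : IsClosed {p : ℝ × ℝ | 0 ≤ p.2} := isClosed_le continuous_const continuous_snd
    have h2 : IsClosed {p : ℝ × ℝ | p.2 ≤ t₀} := isClosed_le continuous_snd continuous_const
    have h3 : IsClosed {p : ℝ × ℝ | |p.1 - x₀| ≤ L * (t₀ - p.2)} :=
      isClosed_le (by fun_prop) (by fun_prop)
    exact h1.inter (h2.inter h3)
  · rintro ⟨x, t⟩ ⟨h1, h2, h3⟩
    simp only at h1 h2 h3
    have := abs_le.1 h3
    have h4 : L * (t₀ - t) ≤ L * t₀ := by nlinarith
    exact ⟨⟨by simp only; linarith, h1⟩, ⟨by simp only; linarith, h2⟩⟩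

theorem triangle_subset_slab {L x₀ t₀ t₁ : ℝ} (h : t₀ ≤ t₁) : triangle L x₀ t₀ ⊆ slab t₁ := by
  rintro ⟨x, t⟩ ⟨h1, h2, -⟩
  exact mem_slab.2 ⟨h1, h2.trans h⟩

theorem apex_mem_triangle {L x₀ t₀ : ℝ} (ht : 0 ≤ t₀) : (x₀, t₀) ∈ triangle L x₀ t₀ := by
  simp [triangle, ht]

theorem triangle_subset_triangle {L x₀ t₀ x t : ℝ} (h : (x, t) ∈ triangle L x₀ t₀) :
    triangle L x t ⊆ triangle L x₀ t₀ := by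
  rintro ⟨y, s⟩ ⟨h1, h2, h3⟩
  obtain ⟨h4, h5, h6⟩ := h
  simp only at *
  refine ⟨h1, h2.trans h5, ?_⟩
  simp only
  calc |y - x₀| ≤ |y - x| + |x - x₀| := abs_sub_le _ _ _
    _ ≤ L * (t - s) + L * (t₀ - t) := add_le_add h3 h6
    _ = L * (t₀ - s) := by ring

theorem line_mem_triangle {L x₀ t₀ v e : ℝ} {p : ℝ × ℝ} (hp : p ∈ triangle L x₀ t₀)
    (hv : |v| ≤ L) (he : 0 ≤ e) (he' : e ≤ p.2) : (p.1 - v * e, p.2 - e) ∈ triangle L x₀ t₀ := by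
  refine triangle_subset_triangle (x := p.1) (t := p.2) hp ⟨by simpa using he', by simpa using he, ?_⟩
  simp only [sub_sub_cancel_left, abs_neg, abs_mul, abs_of_nonneg he]
  nlinarith

/-- Maximum principle for finitely many functions, each decreasing along its own direction field
wherever it is the largest one and exceeds `M`. The functions `F i` are limits of functions
`f n i` that are differentiable in these directions, in the sense of continuous convergence. -/
theorem max_principle {ι : Type*} [Finite ι] {L x₀ t₀ M : ℝ} (hL : 0 ≤ L)
    {f R : ℕ → ι → ℝ × ℝ → ℝ} {F G v : ι → ℝ × ℝ → ℝ}
    (hv : ∀ i, ∀ p ∈ triangle L x₀ t₀, |v i p| ≤ L)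
    (hcont : ∀ n i, ContinuousOn (f n i) (triangle L x₀ t₀))
    (hder : ∀ n i, ∀ p ∈ triangle L x₀ t₀, 0 < p.2 →
      HasDerivWithinAt (fun e => f n i (p.1 - v i p * e, p.2 - e)) (-R n i p) (Icc 0 p.2) 0)
    (hf : ∀ i, ∀ p ∈ triangle L x₀ t₀,
      Tendsto (fun q : ℕ × (ℝ × ℝ) => f q.1 i q.2) (atTop ×ˢ 𝓝[triangle L x₀ t₀] p) (𝓝 (F i p)))
    (hR : ∀ i, ∀ p ∈ triangle L x₀ t₀,
      Tendsto (fun q : ℕ × (ℝ × ℝ) => R q.1 i q.2) (atTop ×ˢ 𝓝[triangle L x₀ t₀] p) (𝓝 (G i p)))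
    (hneg : ∀ i, ∀ p ∈ triangle L x₀ t₀, 0 < p.2 → M < F i p → (∀ j, F j p ≤ F i p) → G i p < 0)
    (h0 : ∀ i, ∀ p ∈ triangle L x₀ t₀, p.2 = 0 → F i p ≤ M) :
    ∀ i, ∀ p ∈ triangle L x₀ t₀, F i p ≤ M := by
  intro i₀ p₀ hp₀
  by_contra! hM
  have hK := isCompact_triangle (x₀ := x₀) (t₀ := t₀) hL
  have hmax : ∀ n, ∃ i, ∃ p ∈ triangle L x₀ t₀, ∀ j, ∀ q ∈ triangle L x₀ t₀,
      f n j q ≤ f n i p := by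
    intro n
    choose P hP hPm using fun i => hK.exists_isMaxOn ⟨p₀, hp₀⟩ (hcont n i)
    have : Nonempty ι := ⟨i₀⟩
    obtain ⟨i, hi⟩ := Finite.exists_max fun i => f n i (P i)
    exact ⟨i, P i, hP i, fun j q hq => (hPm j hq).trans (hi j)⟩
  choose I P hP hmax using hmax
  -- Along an ultrafilter the index of the maximiser is eventually constant and the maximisers
  -- converge in the compact triangle; no subsequences are needed.
  let U : Ultrafilter ℕ := hyperfilter ℕ
  have hU : (U : Filter ℕ) ≤ atTop := by
    rw [← Nat.cofinite_eq_atTop]; exact hyperfilter_le_cofinite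
  obtain ⟨i, hi⟩ : ∃ i, ∀ᶠ n in (U : Filter ℕ), I n = i := by
    have : (⋃ i ∈ (univ : Set ι), {n | I n = i}) ∈ U := by
      have h : (⋃ i ∈ (univ : Set ι), {n | I n = i}) = univ := by ext; simp
      rw [h]; exact univ_mem
    obtain ⟨i, -, hi⟩ := (Ultrafilter.finite_biUnion_mem_iff finite_univ).1 this
    exact ⟨i, hi⟩
  obtain ⟨p, hp, hlim⟩ := hK.ultrafilter_le_nhds (U.map P) (by
    rw [le_principal_iff, Ultrafilter.mem_coe, Ultrafilter.mem_map]
    exact Filter.Eventually.of_forall hP)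
  have hlim' : Tendsto P U (𝓝[triangle L x₀ t₀] p) :=
    tendsto_nhdsWithin_iff.2 ⟨hlim, Filter.Eventually.of_forall hP⟩
  have limF : Tendsto (fun n => f n i (P n)) U (𝓝 (F i p)) :=
    (hf i p hp).comp ((tendsto_id'.2 hU).prodMk hlim')
  have top : ∀ j, ∀ q ∈ triangle L x₀ t₀, F j q ≤ F i p := by
    intro j q hq
    have h1 : Tendsto (fun n => f n j q) U (𝓝 (F j q)) := by
      refine (hf j q hq).comp ((tendsto_id'.2 hU).prodMk ?_)
      exact tendsto_const_pure.mono_right (pure_le_nhdsWithin hq)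
    refine le_of_tendsto_of_tendsto h1 limF ?_
    filter_upwards [hi] with n hn
    have := hmax n j q hq
    rwa [hn] at this
  have hbig : M < F i p := hM.trans_le (top i₀ p₀ hp₀)
  have hpos : 0 < p.2 := by
    rcases hp.1.eq_or_lt with h | h
    · exact absurd (h0 i p hp h.symm) (not_le.2 hbig)
    · exact h
  have hG := hneg i p hp hpos hbig (fun j => top j p hp)
  have limR : Tendsto (fun n => R n i (P n)) U (𝓝 (G i p)) :=
    (hR i p hp).comp ((tendsto_id'.2 hU).prodMk hlim')
  have hev : ∀ᶠ n in (U : Filter ℕ), 0 < (P n).2 :=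
    (continuous_snd.tendsto p).comp hlim (lt_mem_nhds hpos)
  refine absurd (ge_of_tendsto (b := 0) limR ?_) (not_le.2 hG)
  filter_upwards [hi, hev] with n hn hpn
  have hd := hder n i (P n) (hP n) hpn
  -- As `|v| ≤ L`, the segment going back in time from the maximiser stays in the triangle, so `f n
  -- i` cannot increase along it.
  have hle : -R n i (P n) ≤ 0 := by
    by_contra! hcon
    have hlim2 := (hasDerivWithinAt_iff_tendsto_slope.1 hd).eventually (lt_mem_nhds hcon)
    have : (Icc 0 (P n).2 \ {0}) ∈ 𝓝[>] (0 : ℝ) := by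
      filter_upwards [Ioc_mem_nhdsGT hpn] with e he
      exact ⟨⟨he.1.le, he.2⟩, he.1.ne'⟩
    have h3 : ∀ᶠ e in 𝓝[>] (0 : ℝ), _ := nhdsWithin_le_of_mem this hlim2
    obtain ⟨e, he1, he2⟩ := (h3.and (Ioc_mem_nhdsGT hpn)).exists
    have hm := hmax n i _ (line_mem_triangle (hP n) (hv i _ (hP n)) he2.1.le he2.2)
    rw [hn] at hm
    simp only [slope, mul_zero, sub_zero, vsub_eq_sub, smul_eq_mul] at he1
    have := (mul_pos_iff_of_pos_left (inv_pos.2 he2.1)).1 he1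
    linarith
  linarith

/-- The point of `[lo, hi]` closest to `x`. -/
def clamp (lo hi x : ℝ) : ℝ := max lo (min hi x)

theorem clamp_mem {lo hi x : ℝ} (h : lo ≤ hi) : clamp lo hi x ∈ Icc lo hi :=
  ⟨le_max_left _ _, max_le h (min_le_left _ _)⟩

theorem clamp_of_mem {lo hi x : ℝ} (h : x ∈ Icc lo hi) : clamp lo hi x = x := by
  rw [clamp, min_eq_right h.2, max_eq_right h.1]

theorem abs_clamp_sub_le (lo hi x y : ℝ) : |clamp lo hi x - clamp lo hi y| ≤ |x - y| :=
  (abs_max_sub_max_le_max _ _ _ _).trans (by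
    simpa using abs_min_sub_min_le_max hi x hi y)

/-- Existence of characteristics of a `C¹` speed `c` through `(x, t)`, on `[0, t₁]`, when the
speed is bounded by `L` on the double cone with apex `(x, t)`. -/
theorem exists_characteristic {t₁ L x t : ℝ} {c cx ct : ℝ → ℝ → ℝ} (hc : HasPartials t₁ c cx ct)
    (ht : t ∈ Icc 0 t₁) (hL : 0 ≤ L)
    (hb : ∀ y, ∀ s ∈ Icc 0 t₁, |y - x| ≤ L * |t - s| → |c y s| ≤ L) :
    ∃ X : ℝ → ℝ, X t = x ∧
      (∀ s ∈ Icc 0 t₁, HasDerivWithinAt X (c (X s) s) (Icc 0 t₁) s) ∧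
      ∀ s ∈ Icc 0 t₁, |X s - x| ≤ L * |t - s| := by
  have lohi : ∀ s, x - L * |t - s| ≤ x + L * |t - s| := fun s => by
    have := mul_nonneg hL (abs_nonneg (t - s)); linarith
  -- Clamping the position to the double cone makes the field globally Lipschitz and bounded by `L`.
  -- The solution then never leaves the cone, so the clamp is inactive on it.
  let w : ℝ → ℝ → ℝ := fun s y => clamp (x - L * |t - s|) (x + L * |t - s|) y
  have hw : ∀ s y, |w s y - x| ≤ L * |t - s| := fun s y => by
    have := clamp_mem (x := y) (lohi s)
    exact abs_le.2 ⟨by linarith [this.1], by linarith [this.2]⟩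
  obtain ⟨K, hK⟩ : ∃ K, ∀ p ∈ (Icc (x - L * t₁) (x + L * t₁) ×ˢ Icc 0 t₁ : Set (ℝ × ℝ)),
      ‖uncurry cx p‖ ≤ K :=
    (isCompact_Icc.prod isCompact_Icc).exists_bound_of_continuousOn
      (hc.cont_x.mono (prod_mono (subset_univ _) le_rfl))
  have hts : ∀ s ∈ Icc 0 t₁, |t - s| ≤ t₁ := fun s hs =>
    abs_le.2 ⟨by linarith [hs.2, ht.1], by linarith [hs.1, ht.2]⟩
  have hK0 : 0 ≤ K := (norm_nonneg _).trans (hK (x, t) ⟨⟨by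
    nlinarith [ht.1, ht.2], by nlinarith [ht.1, ht.2]⟩, ht⟩)
  have hlip : ∀ s ∈ Icc 0 t₁, ∀ y z, |c (w s y) s - c (w s z) s| ≤ K * |y - z| := by
    intro s hs y z
    have hbox : ∀ q, w s q ∈ Icc (x - L * t₁) (x + L * t₁) := fun q => by
      have h2 := abs_le.1 ((hw s q).trans (mul_le_mul_of_nonneg_left (hts s hs) hL))
      exact ⟨by linarith [h2.1], by linarith [h2.2]⟩
    have h1 := Convex.norm_image_sub_le_of_norm_hasDerivWithin_le (𝕜 := ℝ)
      (f := fun z => c z s) (f' := fun z => cx z s) (s := Icc (x - L * t₁) (x + L * t₁))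
      (C := K) (x := w s z) (y := w s y) (fun q _ => (hc.deriv_x hs).hasDerivWithinAt)
      (fun q hq => hK (q, s) ⟨hq, hs⟩) (convex_Icc _ _) ?_ ?_
    · exact h1.trans (mul_le_mul_of_nonneg_left (abs_clamp_sub_le _ _ _ _) hK0)
    all_goals exact hbox _
  have hPL : IsPicardLindelof (fun s y => c (w s y) s) (⟨t, ht⟩ : Icc 0 t₁) x
      (⟨L * t₁, mul_nonneg hL (ht.1.trans ht.2)⟩) 0 ⟨L, hL⟩ ⟨K, hK0⟩ := by
    refine ⟨fun s hs => ?_, fun y _ => ?_, fun s hs y _ => ?_, ?_⟩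
    · refine LipschitzOnWith.of_dist_le_mul fun y _ z _ => ?_
      rw [Real.dist_eq, Real.dist_eq]
      exact hlip s hs y z
    · refine hc.cont.comp (f := fun s => (w s y, s)) (Continuous.continuousOn ?_)
        (fun s hs => mem_slab.2 hs)
      simp only [w, clamp]
      fun_prop
    · exact hb _ s hs (hw s y)
    · simp only [NNReal.coe_zero, sub_zero]
      exact mul_le_mul_of_nonneg_left (max_le (by linarith [ht.1]) (by linarith [ht.2])) hL
  obtain ⟨X, hX0, hX⟩ := hPL.exists_eq_forall_mem_Icc_hasDerivWithinAt₀
  have hdist : ∀ s ∈ Icc 0 t₁, |X s - x| ≤ L * |t - s| := by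
    intro s hs
    have := Convex.norm_image_sub_le_of_norm_hasDerivWithin_le (𝕜 := ℝ) (f := X)
      (f' := fun s => c (w s (X s)) s) (s := Icc 0 t₁) (C := L) (x := t) (y := s)
      hX (fun r hr => hb _ r hr (hw r _)) (convex_Icc _ _) ht hs
    simp only at hX0
    rw [hX0, Real.norm_eq_abs, Real.norm_eq_abs, abs_sub_comm s t] at this
    exact this
  refine ⟨X, hX0, fun s hs => ?_, hdist⟩
  have hw' : w s (X s) = X s := by
    have := abs_le.1 (hdist s hs)
    exact clamp_of_mem ⟨by linarith [this.1], by linarith [this.2]⟩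
  have := hX s hs
  rwa [hw'] at this

/-! ### The gas equations for `(u, η)` in a stationary entropy field -/

/-- The exponent `ν = (γ + 1) / (γ - 1)` in the sound speed. -/
noncomputable def speedExp (γ : ℝ) : ℝ := (γ + 1) / (γ - 1)

/-- The Lagrangian sound speed `c = k m η ^ ν`. -/
noncomputable def soundSpeed (γ k m η : ℝ) : ℝ := k * m * η ^ speedExp γ

/-- A stationary entropy field, described by `m`, with bounds. -/
structure Medium (γ k lo hi D : ℝ) (m m' : ℝ → ℝ) : Prop where
  one_lt : 1 < γ
  k_pos : 0 < k
  lo_pos : 0 < lo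
  lo_le : ∀ x, lo ≤ m x
  le_hi : ∀ x, m x ≤ hi
  hasDeriv : ∀ x, HasDerivAt m (m' x) x
  cont : Continuous m'
  deriv_le : ∀ x, |m' x| ≤ D

/-- A `C¹` solution `(u, η)` of the gas equations on the slab `ℝ × [0, t₁]`. -/
structure IsFlow (γ k : ℝ) (m m' : ℝ → ℝ) (t₁ : ℝ) (u ux ut η ηx ηt : ℝ → ℝ → ℝ) : Prop where
  u_partials : HasPartials t₁ u ux ut
  η_partials : HasPartials t₁ η ηx ηt
  pos : ∀ x, ∀ t ∈ Icc 0 t₁, 0 < η x t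
  mass : ∀ x, ∀ t ∈ Icc 0 t₁, ηt x t = -(k * η x t ^ speedExp γ) * ux x t
  momentum : ∀ x, ∀ t ∈ Icc 0 t₁, ut x t =
    -soundSpeed γ k (m x) (η x t) * (m x * ηx x t + (γ - 1) / γ * m' x * η x t)

section

variable {γ k lo hi D : ℝ} {m m' : ℝ → ℝ}

namespace Medium

theorem pos (hm : Medium γ k lo hi D m m') (x : ℝ) : 0 < m x := hm.lo_pos.trans_le (hm.lo_le x)

theorem hi_pos (hm : Medium γ k lo hi D m m') : 0 < hi :=
  (hm.pos 0).trans_le (hm.le_hi 0)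

theorem D_nonneg (hm : Medium γ k lo hi D m m') : 0 ≤ D := (abs_nonneg _).trans (hm.deriv_le 0)

theorem γ_pos (hm : Medium γ k lo hi D m m') : 0 < γ := zero_lt_one.trans hm.one_lt

theorem one_lt_speedExp (hm : Medium γ k lo hi D m m') : 1 < speedExp γ := by
  have := hm.one_lt
  rw [speedExp, lt_div_iff₀ (by linarith)]
  linarith

theorem soundSpeed_pos (hm : Medium γ k lo hi D m m') (x : ℝ) {η : ℝ} (hη : 0 < η) :
    0 < soundSpeed γ k (m x) η :=
  mul_pos (mul_pos hm.k_pos (hm.pos x)) (Real.rpow_pos_of_pos hη _)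

theorem soundSpeed_le (hm : Medium γ k lo hi D m m') (x : ℝ) {η H : ℝ} (hη : 0 ≤ η) (h : η ≤ H) :
    soundSpeed γ k (m x) η ≤ k * hi * H ^ speedExp γ := by
  have h1 := hm.k_pos
  have h2 := hm.pos x
  have h3 := hm.le_hi x
  have := hm.one_lt_speedExp
  have h4 : η ^ speedExp γ ≤ H ^ speedExp γ := Real.rpow_le_rpow hη h (by linarith)
  exact mul_le_mul (by gcongr) h4 (Real.rpow_nonneg hη _) (by nlinarith)

end Medium

/-- The Riemann variable `u + σ m η`, `σ = ± 1`. -/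
def riemann (σ : ℝ) (m : ℝ → ℝ) (u η : ℝ → ℝ → ℝ) (x t : ℝ) : ℝ := u x t + σ * (m x * η x t)

namespace IsFlow

variable {t₁ : ℝ} {u ux ut η ηx ηt : ℝ → ℝ → ℝ}

theorem mono {t₂ : ℝ} (hf : IsFlow γ k m m' t₁ u ux ut η ηx ηt) (h : t₂ ≤ t₁) :
    IsFlow γ k m m' t₂ u ux ut η ηx ηt :=
  ⟨hf.u_partials.mono h, hf.η_partials.mono h, fun x t ht => hf.pos x t ⟨ht.1, ht.2.trans h⟩,
    fun x t ht => hf.mass x t ⟨ht.1, ht.2.trans h⟩,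
    fun x t ht => hf.momentum x t ⟨ht.1, ht.2.trans h⟩⟩

theorem speed_partials (hm : Medium γ k lo hi D m m') (hf : IsFlow γ k m m' t₁ u ux ut η ηx ηt) :
    HasPartials t₁ (fun x t => soundSpeed γ k (m x) (η x t))
      (fun x t => k * m' x * η x t ^ speedExp γ +
        k * m x * (speedExp γ * η x t ^ (speedExp γ - 1) * ηx x t))
      (fun x t => k * m x * (speedExp γ * η x t ^ (speedExp γ - 1) * ηt x t)) :=
  (((HasPartials.of_x t₁ hm.hasDeriv hm.cont).const_mul k).mul
    (hf.η_partials.rpow (speedExp γ) hf.pos)).congr (by intros; ring) (by intros; ring)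

theorem riemann_partials (hm : Medium γ k lo hi D m m') (hf : IsFlow γ k m m' t₁ u ux ut η ηx ηt)
    (σ : ℝ) :
    HasPartials t₁ (riemann σ m u η) (fun x t => ux x t + σ * (m' x * η x t + m x * ηx x t))
      (fun x t => ut x t + σ * (m x * ηt x t)) :=
  (hf.u_partials.add
    (((HasPartials.of_x t₁ hm.hasDeriv hm.cont).mul hf.η_partials).const_mul σ)).congr
    (by intros; ring) (by intros; ring)

/-- All derivatives of `u` and `η` cancel because `σ ^ 2 = 1`. What survives is the mismatch between
`m' η`, from differentiating `m η`, and `(γ - 1) / γ m' η` in the momentum equation, so the source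
contains no derivative of the flow. -/
theorem riemann_transport (hm : Medium γ k lo hi D m m')
    (hf : IsFlow γ k m m' t₁ u ux ut η ηx ηt) {σ : ℝ} (hσ : σ ^ 2 = 1) {x t : ℝ}
    (ht : t ∈ Icc 0 t₁) :
    (ut x t + σ * (m x * ηt x t)) + σ * soundSpeed γ k (m x) (η x t) *
      (ux x t + σ * (m' x * η x t + m x * ηx x t)) =
    soundSpeed γ k (m x) (η x t) * m' x * η x t / γ := by
  rw [hf.mass x t ht, hf.momentum x t ht, soundSpeed]
  have := hm.γ_pos.ne'
  field_simp
  linear_combination (k * m x * η x t ^ speedExp γ * γ * (m' x * η x t + m x * ηx x t)) * hσ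

/-- Derivative of a Riemann variable along a characteristic of its family. -/
theorem hasDeriv_riemann (hm : Medium γ k lo hi D m m')
    (hf : IsFlow γ k m m' t₁ u ux ut η ηx ηt) {σ : ℝ} (hσ : σ ^ 2 = 1) {X : ℝ → ℝ} {s : Set ℝ}
    {t : ℝ} (hs : s ⊆ Icc 0 t₁) (ht : t ∈ s)
    (hX : HasDerivWithinAt X (σ * soundSpeed γ k (m (X t)) (η (X t) t)) s t) :
    HasDerivWithinAt (fun t => riemann σ m u η (X t) t)
      (soundSpeed γ k (m (X t)) (η (X t) t) * m' (X t) * η (X t) t / γ) s t := by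
  refine ((hf.riemann_partials hm σ).along_time hX hs ht).congr_deriv ?_
  rw [← hf.riemann_transport hm hσ (hs ht)]
  ring

/-! ### Energy and its loss through characteristics -/

/-- The energy density. -/
noncomputable def energy (γ : ℝ) (m : ℝ → ℝ) (u η : ℝ → ℝ → ℝ) (x t : ℝ) : ℝ :=
  u x t * u x t / 2 + (γ - 1) / (4 * γ) * (m x * η x t) ^ 2

/-- The energy flux. -/
noncomputable def flux (γ k : ℝ) (m : ℝ → ℝ) (u η : ℝ → ℝ → ℝ) (x t : ℝ) : ℝ :=
  (γ - 1) / (2 * γ) * (soundSpeed γ k (m x) (η x t) * (m x * η x t) * u x t)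

/-- The energy has a potential. -/
theorem exists_energy_potential (hm : Medium γ k lo hi D m m')
    (hf : IsFlow γ k m m' t₁ u ux ut η ηx ηt) :
    ∃ Φ : ℝ → ℝ → ℝ, HasPartials t₁ Φ (energy γ m u η) (fun x t => -flux γ k m u η x t) := by
  have hmη := (HasPartials.of_x t₁ hm.hasDeriv hm.cont).mul hf.η_partials
  have hE := ((hf.u_partials.mul hf.u_partials).const_mul (1 / 2)).add
    ((hmη.mul hmη).const_mul ((γ - 1) / (4 * γ)))
  have hP := ((((hf.speed_partials hm).mul hmη).mul hf.u_partials).const_mul ((γ - 1) / (2 * γ)))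
  obtain ⟨Φ, hΦ⟩ := exists_potential hE hP (by
    intro x t ht
    have hη := hf.pos x t ht
    have e : η x t ^ speedExp γ = η x t ^ (speedExp γ - 1) * η x t := by
      rw [Real.rpow_sub_one hη.ne']
      field_simp
    simp only [hf.mass x t ht, hf.momentum x t ht, soundSpeed]
    rw [e]
    have h1 := hm.γ_pos.ne'
    have h2 : γ - 1 ≠ 0 := by linarith [hm.one_lt]
    rw [speedExp]
    field_simp
    ring)
  refine ⟨Φ, hΦ.congr (fun x t _ => ?_) (fun x t _ => ?_)⟩
  · simp only [energy]; ring
  · simp only [flux]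

end IsFlow

/-- The energy flux across characteristics dominates their speed times `η`, up to constants. -/
theorem exists_energy_dominates (γ k lo hi D M : ℝ) (hγ : 1 < γ) (hk : 0 < k) (hlo : 0 < lo)
    (hD : 0 ≤ D) (hM : 0 ≤ M) :
    ∃ κ C : ℝ, 0 ≤ κ ∧ 0 ≤ C ∧ ∀ m u η : ℝ, lo ≤ m → m ≤ hi → 0 < η →
      soundSpeed γ k m η * (D * η / γ + 1) ≤
        κ * (soundSpeed γ k m η * (u * u / 2 + (γ - 1) / (4 * γ) * (m * η) ^ 2 - M)
          - |(γ - 1) / (2 * γ) * (soundSpeed γ k m η * (m * η) * u)|) + C := by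
  obtain ⟨b, hb⟩ : ∃ b, b = (γ - 1) / (2 * γ) := ⟨_, rfl⟩
  have hb0 : 0 < b := by rw [hb]; apply div_pos <;> linarith
  have hb1 : b < 1 / 2 := by rw [hb, div_lt_iff₀ (by linarith)]; linarith
  obtain ⟨θ, hθ⟩ : ∃ θ, θ = b * (1 - b) / 2 * lo ^ 2 := ⟨_, rfl⟩
  have hθ0 : 0 < θ := by rw [hθ]; have : 0 < 1 - b := by linarith
                         positivity
  obtain ⟨Q, hQ⟩ : ∃ Q, Q = D / γ + 1 := ⟨_, rfl⟩
  have hQ1 : 1 ≤ Q := by rw [hQ]; have : 0 ≤ D / γ := by positivity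
                         linarith
  obtain ⟨η₁, hη₁⟩ : ∃ η₁, η₁ = 1 + 2 * M / θ := ⟨_, rfl⟩
  have hη₁1 : 1 ≤ η₁ := by rw [hη₁]; have : 0 ≤ 2 * M / θ := by positivity
                           linarith
  have hMη : 2 * M ≤ θ * η₁ := by
    rw [hη₁, mul_add, mul_div_cancel₀ _ hθ0.ne']; linarith
  have hκ0 : 0 ≤ 2 * Q / θ := by positivity
  have hC0 : 0 ≤ (2 * Q / θ) * M + Q * η₁ := by positivity
  have hsp : 0 ≤ speedExp γ := by
    rw [speedExp]; apply div_nonneg <;> linarith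
  have hhi : 0 ≤ |hi| := abs_nonneg _
  refine ⟨2 * Q / θ, k * |hi| * η₁ ^ speedExp γ * ((2 * Q / θ) * M + Q * η₁), hκ0, by positivity,
    fun m u η hm hm' hη => ?_⟩
  have hm0 : 0 < m := hlo.trans_le hm
  obtain ⟨c, hc⟩ : ∃ c, c = soundSpeed γ k m η := ⟨_, rfl⟩
  have hc0 : 0 ≤ c := by
    rw [hc, soundSpeed]; positivity
  rw [← hc, ← hb]
  have e4 : (γ - 1) / (4 * γ) = b / 2 := by rw [hb]; field_simp; norm_num
  rw [e4]
  have habs : |b * (c * (m * η) * u)| = c * (b * (m * η) * |u|) := by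
    rw [abs_mul, abs_mul, abs_mul, abs_of_pos hb0, abs_of_nonneg hc0, abs_of_pos (mul_pos hm0 hη)]
    ring
  rw [habs]
  -- Completing the square in `|u|` leaves `b (1 - b) / 2 (m η) ^ 2`: energy minus flux is positive
  -- definite since `b < 1 / 2`.
  have hpos : θ * η ^ 2 ≤ u * u / 2 + b / 2 * (m * η) ^ 2 - b * (m * η) * |u| := by
    have h1 : lo ^ 2 ≤ m ^ 2 := by gcongr
    have h2 : θ * η ^ 2 ≤ b * (1 - b) / 2 * (m * η) ^ 2 := by
      rw [hθ, mul_pow]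
      have : 0 ≤ b * (1 - b) / 2 * η ^ 2 := by
        have : 0 < 1 - b := by linarith
        positivity
      nlinarith
    have h3 : u * u = |u| ^ 2 := by rw [sq_abs]; ring
    nlinarith [sq_nonneg (|u| - b * (m * η))]
  have step : c * (2 * Q / θ * (θ * η ^ 2 - M)) ≤
      2 * Q / θ * (c * (u * u / 2 + b / 2 * (m * η) ^ 2 - M) - c * (b * (m * η) * |u|)) := by
    have := mul_le_mul_of_nonneg_left hpos (mul_nonneg hκ0 hc0)
    linarith
  have hrate : D * η / γ + 1 ≤ Q * max η 1 := by
    have hγ0 : 0 ≤ D / γ := by positivity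
    have h1 := le_max_left η 1
    have h2 := le_max_right η 1
    rw [hQ, mul_div_right_comm]
    nlinarith
  -- For `η ≥ η₁` the quadratic gain absorbs both `M` and the rate, linear in `η`; for `η ≤ η₁` the
  -- speed itself is bounded and the additive constant takes over.
  rcases le_total η₁ η with h | h
  · have h1 : θ * η / 2 ≤ θ * η ^ 2 - M := by
      have : θ * η * 1 ≤ θ * η * η := mul_le_mul_of_nonneg_left (hη₁1.trans h) (by positivity)
      have : θ * η₁ ≤ θ * η := by gcongr
      linarith
    have h2 : 2 * Q / θ * (θ * η / 2) ≤ 2 * Q / θ * (θ * η ^ 2 - M) :=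
      mul_le_mul_of_nonneg_left h1 hκ0
    have h3 : 2 * Q / θ * (θ * η / 2) = Q * η := by field_simp
    rw [max_eq_left (hη₁1.trans h)] at hrate
    have h4 := mul_le_mul_of_nonneg_left (hrate.trans (h3 ▸ h2)) hc0
    have : 0 ≤ k * |hi| * η₁ ^ speedExp γ * ((2 * Q / θ) * M + Q * η₁) := by positivity
    linarith
  · have hcle : c ≤ k * |hi| * η₁ ^ speedExp γ := by
      rw [hc, soundSpeed]
      have h1 : η ^ speedExp γ ≤ η₁ ^ speedExp γ := Real.rpow_le_rpow hη.le h hsp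
      have h2 : m ≤ |hi| := hm'.trans (le_abs_self _)
      gcongr
    have h1 : D * η / γ + 1 - 2 * Q / θ * (θ * η ^ 2 - M) ≤ 2 * Q / θ * M + Q * η₁ := by
      have : Q * max η 1 ≤ Q * η₁ := by
        have := max_le h hη₁1
        gcongr
      have : 0 ≤ 2 * Q / θ * (θ * η ^ 2) := by positivity
      linarith
    have h2 := mul_le_mul_of_nonneg_left h1 hc0
    have h3 := mul_le_mul_of_nonneg_right hcle hC0
    linarith

end

/-- Energy estimate on the region between two characteristics that meet at time `t₀`: it bounds
the growth of every function whose rate is controlled by the speed times `η` on them. -/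
theorem exists_cone_estimate (γ k lo hi D M : ℝ) (hγ : 1 < γ) (hk : 0 < k) (hlo : 0 < lo)
    (hD : 0 ≤ D) (hM : 0 ≤ M) :
    ∃ C : ℝ, 0 ≤ C ∧ ∀ {m m' : ℝ → ℝ} {t₀ : ℝ} {u ux ut η ηx ηt : ℝ → ℝ → ℝ},
      Medium γ k lo hi D m m' → IsFlow γ k m m' t₀ u ux ut η ηx ηt →
      (∀ x, IsFlow.energy γ m u η x 0 ≤ M) → 0 ≤ t₀ → ∀ {a b g g' : ℝ → ℝ},
      (∀ t ∈ Icc 0 t₀, HasDerivWithinAt a (soundSpeed γ k (m (a t)) (η (a t) t)) (Icc 0 t₀) t) →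
      (∀ t ∈ Icc 0 t₀, HasDerivWithinAt b (-soundSpeed γ k (m (b t)) (η (b t) t)) (Icc 0 t₀) t) →
      a t₀ = b t₀ → (∀ t ∈ Icc 0 t₀, HasDerivWithinAt g (g' t) (Icc 0 t₀) t) →
      (∀ t ∈ Icc 0 t₀, g' t ≤
        soundSpeed γ k (m (a t)) (η (a t) t) * (D * η (a t) t / γ + 1) +
        soundSpeed γ k (m (b t)) (η (b t) t) * (D * η (b t) t / γ + 1)) →
      g t₀ - g 0 ≤ C * t₀ := by
  obtain ⟨κ, C, hκ, hC, H⟩ := exists_energy_dominates γ k lo hi D M hγ hk hlo hD hM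
  refine ⟨2 * C, by positivity, ?_⟩
  intro m m' t₀ u ux ut η ηx ηt hm hf hE ht₀ a b g g' ha hb hab hg hg'
  obtain ⟨Φ, hΦ⟩ := hf.exists_energy_potential hm
  -- `Φ (b t) t - Φ (a t) t` is the energy between the characteristics. Subtracting `M (b - a)`
  -- gives an excess that is nonpositive at time `0` and zero at `t₀`, so the length of the initial
  -- interval plays no role. The loss of excess through both sides pays for the growth of `g`, up to
  -- the linear term.
  have hder : ∀ t ∈ Icc 0 t₀, HasDerivWithinAt
      (fun t => g t + (κ * (Φ (b t) t - Φ (a t) t - M * (b t - a t)) - 2 * C * t)) _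
      (Icc 0 t₀) t := fun t ht =>
    (hg t ht).add ((((((hΦ.along_time (hb t ht) Subset.rfl ht).sub
      (hΦ.along_time (ha t ht) Subset.rfl ht)).sub
      (((hb t ht).sub (ha t ht)).const_mul M)).const_mul κ).sub
      ((hasDerivWithinAt_id t _).const_mul (2 * C))))
  have anti : AntitoneOn
      (fun t => g t + (κ * (Φ (b t) t - Φ (a t) t - M * (b t - a t)) - 2 * C * t)) (Icc 0 t₀) := by
    refine antitoneOn_of_hasDerivWithinAt_nonpos (convex_Icc _ _)
      (fun t ht => (hder t ht).continuousWithinAt)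
      (fun t ht => (hder t (interior_subset ht)).mono interior_subset) ?_
    intro t ht
    replace ht := interior_subset ht
    have h1 := hg' t ht
    have h2 := H (m (a t)) (u (a t) t) (η (a t) t) (hm.lo_le _) (hm.le_hi _) (hf.pos _ _ ht)
    have h3 := H (m (b t)) (u (b t) t) (η (b t) t) (hm.lo_le _) (hm.le_hi _) (hf.pos _ _ ht)
    have h4 := mul_le_mul_of_nonneg_left (le_abs_self (IsFlow.flux γ k m u η (a t) t)) hκ
    have h5 := mul_le_mul_of_nonneg_left (neg_abs_le (IsFlow.flux γ k m u η (b t) t)) hκ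
    simp only [IsFlow.flux, IsFlow.energy] at *
    nlinarith
  have hΦ0 : Φ (b 0) 0 - Φ (a 0) 0 ≤ M * (b 0 - a 0) := by
    have hle : a 0 ≤ b 0 := by
      have : MonotoneOn (fun t => a t - b t) (Icc 0 t₀) := by
        have hd : ∀ t ∈ Icc 0 t₀, HasDerivWithinAt (fun t => a t - b t) _ (Icc 0 t₀) t :=
          fun t ht => (ha t ht).sub (hb t ht)
        refine monotoneOn_of_hasDerivWithinAt_nonneg (convex_Icc _ _)
          (fun t ht => (hd t ht).continuousWithinAt)
          (fun t ht => (hd t (interior_subset ht)).mono interior_subset) ?_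
        intro t ht
        replace ht := interior_subset ht
        have h1 := hm.soundSpeed_pos (a t) (hf.pos (a t) t ht)
        have h2 := hm.soundSpeed_pos (b t) (hf.pos (b t) t ht)
        linarith
      have := this (left_mem_Icc.2 ht₀) (right_mem_Icc.2 ht₀) ht₀
      simp only [hab, sub_self] at this
      linarith
    have hz : (0 : ℝ) ∈ Icc 0 t₀ := left_mem_Icc.2 ht₀
    have hd : ∀ x ∈ (univ : Set ℝ), HasDerivWithinAt (fun x => Φ x 0 - M * x) _ univ x :=
      fun x _ => (((hΦ.deriv_x hz).sub ((hasDerivAt_id' x).const_mul M))).hasDerivWithinAt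
    have : AntitoneOn (fun x => Φ x 0 - M * x) univ := by
      refine antitoneOn_of_hasDerivWithinAt_nonpos convex_univ
        (fun t ht => (hd t ht).continuousWithinAt)
        (fun t ht => (hd t (mem_univ t)).mono interior_subset) ?_
      intro x _
      have := hE x
      linarith
    have := this (mem_univ _) (mem_univ _) hle
    simp only at this
    linarith
  have := anti (left_mem_Icc.2 ht₀) (right_mem_Icc.2 ht₀) ht₀
  simp only [hab, sub_self, mul_zero, zero_sub] at this
  nlinarith

/-! ### Linear growth of the Riemann variables -/

variable {γ k lo hi D : ℝ} {m m' : ℝ → ℝ} {t₁ : ℝ} {u ux ut η ηx ηt : ℝ → ℝ → ℝ}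

theorem riemann_sub (m : ℝ → ℝ) (u η : ℝ → ℝ → ℝ) (x t : ℝ) :
    riemann 1 m u η x t - riemann (-1) m u η x t = 2 * (m x * η x t) := by
  simp only [riemann]; ring

namespace IsFlow

theorem η_le (hm : Medium γ k lo hi D m m') (hf : IsFlow γ k m m' t₁ u ux ut η ηx ηt) {Y x t : ℝ}
    (ht : t ∈ Icc 0 t₁) (h₁ : |riemann 1 m u η x t| ≤ Y) (h₂ : |riemann (-1) m u η x t| ≤ Y) :
    η x t ≤ Y / lo := by
  rw [le_div_iff₀ hm.lo_pos]
  have h := riemann_sub m u η x t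
  have h3 := (abs_le.1 h₁).2
  have h4 := (abs_le.1 h₂).1
  have := mul_le_mul_of_nonneg_right (hm.lo_le x) (hf.pos x t ht).le
  linarith

theorem abs_riemann_le (hm : Medium γ k lo hi D m m') {σ M x t : ℝ} (hσ : |σ| ≤ 1)
    (hu : |u x t| ≤ M) (hη0 : 0 ≤ η x t) (hη : η x t ≤ M) :
    |riemann σ m u η x t| ≤ M + hi * M := by
  have h1 : |σ * (m x * η x t)| ≤ hi * M := by
    rw [abs_mul, abs_of_nonneg (mul_nonneg (hm.pos x).le hη0)]
    have h2 : m x * η x t ≤ hi * M := mul_le_mul (hm.le_hi x) hη hη0 hm.hi_pos.le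
    have h3 : 0 ≤ m x * η x t := mul_nonneg (hm.pos x).le hη0
    nlinarith [abs_nonneg σ]
  exact (abs_add_le _ _).trans (add_le_add hu h1)

theorem energy_le (hm : Medium γ k lo hi D m m') {M x t : ℝ}
    (hu : |u x t| ≤ M) (hη0 : 0 ≤ η x t) (hη : η x t ≤ M) :
    energy γ m u η x t ≤ M ^ 2 + (hi * M) ^ 2 := by
  have h1 : u x t * u x t ≤ M ^ 2 := by
    rw [← abs_mul_abs_self]; nlinarith [abs_nonneg (u x t)]
  have h2 : (m x * η x t) ^ 2 ≤ (hi * M) ^ 2 := by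
    have h2 : m x * η x t ≤ hi * M := mul_le_mul (hm.le_hi x) hη hη0 hm.hi_pos.le
    have h3 : 0 ≤ m x * η x t := mul_nonneg (hm.pos x).le hη0
    gcongr
  have h3 : (γ - 1) / (4 * γ) ≤ 1 := by
    rw [div_le_one (by linarith [hm.one_lt])]; linarith [hm.one_lt]
  have h4 : (γ - 1) / (4 * γ) * (m x * η x t) ^ 2 ≤ 1 * (m x * η x t) ^ 2 := by gcongr
  rw [energy]
  nlinarith [sq_nonneg M]

end IsFlow

/-- The rate `c (D η / γ + 1)` covers the source of the Riemann transport and, through the summand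
`1`, the speed itself. Thus one cone estimate controls both Riemann variables and displacements. -/
theorem rate_nonneg (hm : Medium γ k lo hi D m m') (x : ℝ) {η : ℝ} (hη : 0 < η) :
    0 ≤ soundSpeed γ k (m x) η * (D * η / γ + 1) := by
  have h1 := hm.soundSpeed_pos x hη
  have h2 := hm.D_nonneg
  have h3 := hm.γ_pos
  positivity

theorem transport_le_rate (hm : Medium γ k lo hi D m m') (x : ℝ) {η : ℝ} (hη : 0 < η) :
    |soundSpeed γ k (m x) η * m' x * η / γ| ≤ soundSpeed γ k (m x) η * (D * η / γ + 1) := by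
  have h1 := hm.soundSpeed_pos x hη
  have h2 := hm.deriv_le x
  have h3 := hm.γ_pos
  rw [abs_div, abs_mul, abs_mul, abs_of_pos h1, abs_of_pos hη, abs_of_pos h3]
  have : soundSpeed γ k (m x) η * |m' x| * η / γ ≤ soundSpeed γ k (m x) η * D * η / γ := by gcongr
  calc _ ≤ soundSpeed γ k (m x) η * D * η / γ := this
    _ = soundSpeed γ k (m x) η * (D * η / γ) := by ring
    _ ≤ _ := by gcongr; linarith

theorem soundSpeed_le_rate (hm : Medium γ k lo hi D m m') (x : ℝ) {η : ℝ} (hη : 0 < η) :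
    soundSpeed γ k (m x) η ≤ soundSpeed γ k (m x) η * (D * η / γ + 1) := by
  have h1 := hm.soundSpeed_pos x hη
  have h2 := hm.D_nonneg
  have h3 := hm.γ_pos
  have : 0 ≤ D * η / γ := by positivity
  nlinarith

/-- Characteristics of both families with a bounded speed. -/
theorem IsFlow.exists_characteristic (hm : Medium γ k lo hi D m m')
    (hf : IsFlow γ k m m' t₁ u ux ut η ηx ηt) {σ x t L : ℝ} (hσ : |σ| = 1)
    (ht : t ∈ Icc 0 t₁) (hL : 0 ≤ L)
    (hb : ∀ y, ∀ s ∈ Icc 0 t₁, |y - x| ≤ L * |t - s| → soundSpeed γ k (m y) (η y s) ≤ L) :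
    ∃ X : ℝ → ℝ, X t = x ∧ ∀ s ∈ Icc 0 t₁,
      HasDerivWithinAt X (σ * soundSpeed γ k (m (X s)) (η (X s) s)) (Icc 0 t₁) s := by
  obtain ⟨X, h1, h2, -⟩ := GasDynamics.exists_characteristic ((hf.speed_partials hm).const_mul σ)
    ht hL (fun y s hs hy => by
      rw [abs_mul, hσ, one_mul, abs_of_pos (hm.soundSpeed_pos y (hf.pos y s hs))]
      exact hb y s hs hy)
  exact ⟨X, h1, h2⟩

/-- A priori bound for the Riemann variables growing linearly in time, and a bound for the
displacement of backward characteristics. -/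
theorem exists_apriori_bound (γ k lo hi D M : ℝ) (hγ : 1 < γ) (hk : 0 < k) (hlo : 0 < lo)
    (hD : 0 ≤ D) (hM : 0 ≤ M) :
    ∃ C : ℝ, 0 ≤ C ∧ ∀ {m m' : ℝ → ℝ} {t₁ : ℝ} {u ux ut η ηx ηt : ℝ → ℝ → ℝ},
      Medium γ k lo hi D m m' → IsFlow γ k m m' t₁ u ux ut η ηx ηt →
      (∀ x, |u x 0| ≤ M) → (∀ x, η x 0 ≤ M) →
      (∀ x, ∀ t ∈ Icc 0 t₁, ∀ σ : ℝ, |σ| = 1 → |riemann σ m u η x t| ≤ M + hi * M + C * t) ∧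
      ∀ t₀ ∈ Icc 0 t₁, ∀ X : ℝ → ℝ, (∀ t ∈ Icc 0 t₀, HasDerivWithinAt X
        (-soundSpeed γ k (m (X t)) (η (X t) t)) (Icc 0 t₀) t) → X 0 - X t₀ ≤ C * t₀ := by
  obtain ⟨C, hC, H⟩ := exists_cone_estimate γ k lo hi D (M ^ 2 + (hi * M) ^ 2) hγ hk hlo hD
    (by positivity)
  refine ⟨C, hC, ?_⟩
  intro m m' t₁ u ux ut η ηx ηt hm hf hu hη
  rcases lt_or_ge t₁ 0 with hneg | ht₁
  · exact ⟨fun x t ht => absurd (ht.1.trans ht.2) (not_le.2 hneg),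
      fun t ht => absurd (ht.1.trans ht.2) (not_le.2 hneg)⟩
  have hz : (0 : ℝ) ∈ Icc 0 t₁ := left_mem_Icc.2 ht₁
  have hE : ∀ x, IsFlow.energy γ m u η x 0 ≤ M ^ 2 + (hi * M) ^ 2 := fun x =>
    IsFlow.energy_le hm (hu x) (hf.pos x 0 hz).le (hη x)
  have hinit : ∀ x σ, |σ| = 1 → |riemann σ m u η x 0| ≤ M + hi * M := fun x σ hσ =>
    IsFlow.abs_riemann_le hm hσ.le (hu x) (hf.pos x 0 hz).le (hη x)
  -- the bound at the apex of a triangle on which the speed is bounded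
  have apex : ∀ x, ∀ t ∈ Icc 0 t₁, ∀ L, 0 ≤ L →
      (∀ p ∈ triangle L x t, soundSpeed γ k (m p.1) (η p.1 p.2) ≤ L) →
      ∀ σ : ℝ, |σ| = 1 → |riemann σ m u η x t| ≤ M + hi * M + C * t := by
    intro x t ht L hL hb σ hσ
    have hf' := hf.mono ht.2
    have htt : t ∈ Icc 0 t := right_mem_Icc.2 ht.1
    have ex : ∀ ς : ℝ, |ς| = 1 → ∃ X : ℝ → ℝ, X t = x ∧ ∀ s ∈ Icc 0 t,
      HasDerivWithinAt X (ς * soundSpeed γ k (m (X s)) (η (X s) s)) (Icc 0 t) s := fun ς hς =>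
      hf'.exists_characteristic hm hς htt hL (fun y s hs hy => hb (y, s) ⟨hs.1, hs.2, by
        rwa [abs_of_nonneg (sub_nonneg.2 hs.2)] at hy⟩)
    obtain ⟨a, ha0, ha⟩ := ex 1 (by simp)
    obtain ⟨b, hb0, hb'⟩ := ex (-1) (by simp)
    obtain ⟨X, hX0, hX, hXab⟩ : ∃ X : ℝ → ℝ, X t = x ∧ (∀ s ∈ Icc 0 t,
        HasDerivWithinAt X (σ * soundSpeed γ k (m (X s)) (η (X s) s)) (Icc 0 t) s) ∧
        (X = a ∨ X = b) := by
      rcases eq_or_eq_neg_of_abs_eq hσ with h | h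
      · exact ⟨a, ha0, by rwa [h], Or.inl rfl⟩
      · exact ⟨b, hb0, by rwa [h], Or.inr rfl⟩
    have hσ2 : σ ^ 2 = 1 := by rw [← sq_abs, hσ, one_pow]
    have main : ∀ ς : ℝ, |ς| = 1 →
        ς * riemann σ m u η (X t) t - ς * riemann σ m u η (X 0) 0 ≤ C * t := by
      intro ς hς
      refine H hm hf' hE ht.1 (a := a) (b := b) (by simpa using ha) (by simpa using hb')
        (ha0.trans hb0.symm)
        (fun s hs => (hf'.hasDeriv_riemann hm hσ2 Subset.rfl hs (hX s hs)).const_mul ς) ?_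
      intro s hs
      have h1 := rate_nonneg hm (a s) (hf'.pos (a s) s hs)
      have h2 := rate_nonneg hm (b s) (hf'.pos (b s) s hs)
      have h3 := transport_le_rate hm (X s) (hf'.pos (X s) s hs)
      have h4 := le_abs_self (ς * (soundSpeed γ k (m (X s)) (η (X s) s) * m' (X s) *
        η (X s) s / γ))
      rw [abs_mul, hς, one_mul] at h4
      rcases hXab with h | h <;> rw [h] at h3 h4 ⊢ <;> linarith
    have e1 := main 1 (by simp)
    have e2 := main (-1) (by simp)
    have e3 := abs_le.1 (hinit (X 0) σ hσ)
    rw [hX0] at e1 e2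
    exact abs_le.2 ⟨by linarith [e3.1], by linarith [e3.2]⟩
  have bound : ∀ x, ∀ t ∈ Icc 0 t₁, ∀ σ : ℝ, |σ| = 1 →
      |riemann σ m u η x t| ≤ M + hi * M + C * t := by
    intro x₀ t₀ ht₀
    -- Bootstrap: `Y` exceeds the bound to be proved by `1`, and `L` bounds the speed as long as the
    -- Riemann variables do not exceed `Y`.
    obtain ⟨Y, hY⟩ : ∃ Y, Y = M + hi * M + C * t₁ + 1 := ⟨_, rfl⟩
    have hhi := hm.hi_pos
    have hY0 : 0 < Y := by rw [hY]; positivity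
    obtain ⟨L, hLdef⟩ : ∃ L, L = k * hi * (Y / lo) ^ speedExp γ := ⟨_, rfl⟩
    have hL : 0 ≤ L := by rw [hLdef]; positivity
    have hsub := triangle_subset_slab (L := L) (x₀ := x₀) ht₀.2
    have hcont : ∀ σ, ContinuousOn (fun p : ℝ × ℝ => |riemann σ m u η p.1 p.2|) (slab t₁) :=
      fun σ => (hf.riemann_partials hm σ).cont.abs
    have small : ∀ x, ∀ t ∈ Icc 0 t₁, |riemann 1 m u η x t| ≤ Y →
        |riemann (-1) m u η x t| ≤ Y → soundSpeed γ k (m x) (η x t) ≤ L := by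
      intro x t ht h1 h2
      rw [hLdef]
      exact hm.soundSpeed_le x (hf.pos x t ht).le (hf.η_le hm ht h1 h2)
    have hbad : ∀ p ∈ triangle L x₀ t₀,
        max |riemann 1 m u η p.1 p.2| |riemann (-1) m u η p.1 p.2| < Y := by
      by_contra! hcon
      obtain ⟨q, hq, hqY⟩ := hcon
      have hcontm : ContinuousOn (fun p : ℝ × ℝ =>
          max |riemann 1 m u η p.1 p.2| |riemann (-1) m u η p.1 p.2|) (triangle L x₀ t₀) :=
        ((hcont 1).mono hsub).sup ((hcont (-1)).mono hsub)
      have hKc : IsCompact (triangle L x₀ t₀ ∩ (fun p : ℝ × ℝ =>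
          max |riemann 1 m u η p.1 p.2| |riemann (-1) m u η p.1 p.2|) ⁻¹' Ici Y) :=
        (isCompact_triangle hL).of_isClosed_subset
          (hcontm.preimage_isClosed_of_isClosed (isCompact_triangle hL).isClosed isClosed_Ici)
          inter_subset_left
      -- An earliest point of the compact triangle where `Y` is reached. Below it the speed is at
      -- most `L`, so the estimate at the apex applies there and contradicts the margin `1`.
      obtain ⟨p, ⟨hp, hpY⟩, hpmin⟩ := hKc.exists_isMinOn ⟨q, hq, hqY⟩
        (continuous_snd.continuousOn)
      have hpt : p.2 ∈ Icc 0 t₁ := mem_slab.1 (hsub hp)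
      have early : ∀ r ∈ triangle L x₀ t₀, r.2 < p.2 →
          max |riemann 1 m u η r.1 r.2| |riemann (-1) m u η r.1 r.2| < Y := by
        intro r hr hrp
        by_contra! hrY
        exact absurd (hpmin (show r ∈ _ from ⟨hr, hrY⟩)) (not_le.2 hrp)
      have hsubp : triangle L p.1 p.2 ⊆ triangle L x₀ t₀ := triangle_subset_triangle hp
      have hp0 : 0 < p.2 := by
        rcases hpt.1.eq_or_lt with h | h
        · have h1 := hinit p.1 1 (by simp)
          have h2 := hinit p.1 (-1) (by simp)
          have h3 : Y ≤ max |riemann 1 m u η p.1 p.2| |riemann (-1) m u η p.1 p.2| := hpY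
          rw [← h] at h3
          have := mul_nonneg hC ht₁
          have := max_le h1 h2
          linarith
        · exact h
      have hlim : max |riemann 1 m u η p.1 p.2| |riemann (-1) m u η p.1 p.2| ≤ Y := by
        have hc1 : ContinuousWithinAt (fun t => max |riemann 1 m u η p.1 t|
            |riemann (-1) m u η p.1 t|) (Ico 0 p.2) p.2 := by
          refine (hcontm p hp).comp (f := fun t => (p.1, t)) (by fun_prop) ?_
          intro t ht
          exact hsubp ⟨ht.1, ht.2.le, by
            simpa using mul_nonneg hL (sub_nonneg.2 ht.2.le)⟩
        have : (𝓝[Ico 0 p.2] p.2).NeBot := by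
          rw [nhdsWithin_Ico_eq_nhdsLT hp0]; infer_instance
        refine le_of_tendsto hc1 ?_
        filter_upwards [self_mem_nhdsWithin] with t ht
        exact (early (p.1, t) (hsubp ⟨ht.1, ht.2.le, by
            simpa using mul_nonneg hL (sub_nonneg.2 ht.2.le)⟩) ht.2).le
      have hspeed : ∀ r ∈ triangle L p.1 p.2, soundSpeed γ k (m r.1) (η r.1 r.2) ≤ L := by
        intro r hr
        have hrt : r.2 ∈ Icc 0 t₁ := mem_slab.1 (hsub (hsubp hr))
        have : max |riemann 1 m u η r.1 r.2| |riemann (-1) m u η r.1 r.2| ≤ Y := by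
          rcases hr.2.1.lt_or_eq with h | h
          · exact (early r (hsubp hr) h).le
          · have h1 := hr.2.2
            rw [h, sub_self, mul_zero] at h1
            have h2 : r.1 = p.1 := by
              have := abs_eq_zero.1 (le_antisymm h1 (abs_nonneg _)); linarith
            rw [h, h2]; exact hlim
        exact small r.1 r.2 hrt ((le_max_left _ _).trans this) ((le_max_right _ _).trans this)
      have b1 := apex p.1 p.2 hpt L hL hspeed 1 (by simp)
      have b2 := apex p.1 p.2 hpt L hL hspeed (-1) (by simp)
      have h3 : Y ≤ max |riemann 1 m u η p.1 p.2| |riemann (-1) m u η p.1 p.2| := hpY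
      have := max_le b1 b2
      have := mul_le_mul_of_nonneg_left hpt.2 hC
      linarith
    refine apex x₀ t₀ ht₀ L hL (fun p hp => ?_)
    have := (hbad p hp).le
    exact small p.1 p.2 (mem_slab.1 (hsub hp)) ((le_max_left _ _).trans this)
      ((le_max_right _ _).trans this)
  refine ⟨bound, ?_⟩
  intro t₀ ht₀ X hX
  have hf' := hf.mono ht₀.2
  have htt : t₀ ∈ Icc 0 t₀ := right_mem_Icc.2 ht₀.1
  have hhi := hm.hi_pos
  have ηb : ∀ x, ∀ t ∈ Icc 0 t₁, η x t ≤ (M + hi * M + C * t₁) / lo := fun x t ht => by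
    have := mul_le_mul_of_nonneg_left ht.2 hC
    exact hf.η_le hm ht ((bound x t ht 1 (by simp)).trans (by linarith))
      ((bound x t ht (-1) (by simp)).trans (by linarith))
  obtain ⟨a, ha0, ha⟩ := hf'.exists_characteristic hm (σ := 1) (x := X t₀)
    (L := k * hi * ((M + hi * M + C * t₁) / lo) ^ speedExp γ) (by simp) htt (by positivity)
    (fun y s hs _ => hm.soundSpeed_le y (hf'.pos y s hs).le (ηb y s ⟨hs.1, hs.2.trans ht₀.2⟩))
  -- The cone is closed by an auxiliary characteristic of the other family ending at `X t₀`; the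
  -- controlled function is `-X`, whose rate is the speed.
  have key := H hm hf' hE ht₀.1 (a := a) (b := X) (by simpa using ha) hX ha0
    (g := fun s => -X s) (fun s hs => (hX s hs).neg) (fun s hs => by
      have h1 := rate_nonneg hm (a s) (hf'.pos (a s) s hs)
      have h2 := soundSpeed_le_rate hm (X s) (hf'.pos (X s) s hs)
      linarith)
  linarith

/-! ### Crossing characteristics and the iterated bound for the density -/

variable {γ k lo hi D : ℝ} {m m' : ℝ → ℝ} {t₁ : ℝ} {u ux ut η ηx ηt : ℝ → ℝ → ℝ}

/-- Change of a Riemann variable along a characteristic when `η` has a bound `G exp (Λ V)`. -/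
theorem IsFlow.abs_riemann_sub_le (hm : Medium γ k lo hi D m m')
    (hf : IsFlow γ k m m' t₁ u ux ut η ηx ηt) {V : ℝ → ℝ}
    (hV : ∀ x, HasDerivAt V (|m' x| / γ) x) {Λ G : ℝ} (hΛ : 0 < Λ)
    (hG : ∀ y, ∀ t ∈ Icc 0 t₁, η y t ≤ G * Real.exp (Λ * V y)) {σ : ℝ} (hσ : σ ^ 2 = 1)
    {X : ℝ → ℝ} (hX : ∀ s ∈ Icc 0 t₁,
      HasDerivWithinAt X (σ * soundSpeed γ k (m (X s)) (η (X s) s)) (Icc 0 t₁) s) {a b : ℝ}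
    (ha : 0 ≤ a) (hab : a ≤ b) (hb : b ≤ t₁) :
    |riemann σ m u η (X b) b - riemann σ m u η (X a) a| ≤
      σ * (G / Λ) * Real.exp (Λ * V (X b)) - σ * (G / Λ) * Real.exp (Λ * V (X a)) := by
  have hsub : Icc a b ⊆ Icc 0 t₁ := Icc_subset_Icc ha hb
  have main : ∀ ς : ℝ, |ς| = 1 → ς * riemann σ m u η (X b) b - ς * riemann σ m u η (X a) a ≤
      σ * (G / Λ) * Real.exp (Λ * V (X b)) - σ * (G / Λ) * Real.exp (Λ * V (X a)) := by
    intro ς hς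
    have hd : ∀ t ∈ Icc a b, HasDerivWithinAt (fun t => σ * (G / Λ) * Real.exp (Λ * V (X t)) -
        ς * riemann σ m u η (X t) t) _ (Icc a b) t := fun t ht =>
      ((((hV (X t)).comp_hasDerivWithinAt t ((hX t (hsub ht)).mono hsub)).const_mul Λ).exp.const_mul
        (σ * (G / Λ))).sub ((hf.hasDeriv_riemann hm hσ hsub ht
          ((hX t (hsub ht)).mono hsub)).const_mul ς)
    have mono : MonotoneOn (fun t => σ * (G / Λ) * Real.exp (Λ * V (X t)) -
        ς * riemann σ m u η (X t) t) (Icc a b) := by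
      refine monotoneOn_of_hasDerivWithinAt_nonneg (convex_Icc _ _)
        (fun t ht => (hd t ht).continuousWithinAt)
        (fun t ht => (hd t (interior_subset ht)).mono interior_subset) ?_
      intro t ht
      replace ht := hsub (interior_subset ht)
      have hη := hf.pos (X t) t ht
      obtain ⟨c, hc⟩ : ∃ c, c = soundSpeed γ k (m (X t)) (η (X t) t) := ⟨_, rfl⟩
      have hc0 : 0 < c := hc ▸ hm.soundSpeed_pos (X t) hη
      have hγ := hm.γ_pos
      have h1 : ς * (c * m' (X t) * η (X t) t / γ) ≤ c * |m' (X t)| * η (X t) t / γ := by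
        refine (le_abs_self _).trans ?_
        rw [abs_mul, hς, one_mul, abs_div, abs_mul, abs_mul, abs_of_pos hc0, abs_of_pos hη,
          abs_of_pos hγ]
      have h2 : c * |m' (X t)| * η (X t) t / γ ≤
          c * |m' (X t)| * (G * Real.exp (Λ * V (X t))) / γ := by
        have := hG (X t) t ht
        gcongr
      -- Since `X' = σ c`, the bound for the source is exactly the time derivative of `σ (G / Λ) exp
      -- (Λ V (X t))`. Integration therefore gains the factor `1 / Λ`, and only endpoint values of
      -- `V` remain.
      have h3 : σ * (G / Λ) * (Real.exp (Λ * V (X t)) * (Λ * (|m' (X t)| / γ * (σ * c)))) =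
          c * |m' (X t)| * (G * Real.exp (Λ * V (X t))) / γ := by
        have e : G / Λ * Λ = G := div_mul_cancel₀ _ hΛ.ne'
        linear_combination (σ ^ 2 * Real.exp (Λ * V (X t)) * |m' (X t)| * c / γ) * e +
          (G * Real.exp (Λ * V (X t)) * |m' (X t)| * c / γ) * hσ
      rw [← hc]
      simp only [comp_apply]
      linarith
    have := mono (left_mem_Icc.2 hab) (right_mem_Icc.2 hab) hab
    simp only at this
    linarith
  have e1 := main 1 (by simp)
  have e2 := main (-1) (by simp)
  exact abs_le.2 ⟨by linarith, by linarith⟩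

theorem monotone_of_variation (hm : Medium γ k lo hi D m m') {V : ℝ → ℝ}
    (hV : ∀ x, HasDerivAt V (|m' x| / γ) x) : Monotone V :=
  monotone_of_hasDerivAt_nonneg hV fun _ => div_nonneg (abs_nonneg _) hm.γ_pos.le

/-- If the solution exists up to a multiple of `1 + t₀`, then a bound for `η` propagates to an
improved bound at time `t₀`: otherwise two backward characteristics would cross. -/
theorem exists_improvement (γ k lo hi D M : ℝ) (hγ : 1 < γ) (hk : 0 < k) (hlo : 0 < lo)
    (hhi : lo ≤ hi) (hD : 0 ≤ D) (hM : 1 ≤ M) :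
    ∃ B C₁ C₂ : ℝ, 1 ≤ B ∧ 0 < C₁ ∧ 0 < C₂ ∧
      ∀ {m m' V : ℝ → ℝ} {t₁ : ℝ} {u ux ut η ηx ηt : ℝ → ℝ → ℝ},
      Medium γ k lo hi D m m' → IsFlow γ k m m' t₁ u ux ut η ηx ηt →
      (∀ x, HasDerivAt V (|m' x| / γ) x) →
      (∀ x, |u x 0| ≤ M) → (∀ x, η x 0 ≤ M) → ∀ Λ G : ℝ, 0 < Λ → 0 ≤ G →
      (∀ y, ∀ t ∈ Icc 0 t₁, η y t ≤ G * Real.exp (Λ * V y)) →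
      ∀ t₀, 0 ≤ t₀ → B * (1 + t₀) ≤ t₁ → ∀ x, η x t₀ ≤ C₁ + C₂ * (G / Λ * Real.exp (Λ * V x)) := by
  obtain ⟨C, hC, H⟩ := exists_apriori_bound γ k lo hi D M hγ hk hlo hD (by linarith)
  have hhi0 : 0 < hi := hlo.trans_le hhi
  have hM0 : 0 < M := by linarith
  obtain ⟨M₁, hM₁⟩ : ∃ M₁, M₁ = M + hi * M := ⟨_, rfl⟩
  have hM₁0 : 0 < M₁ := by rw [hM₁]; positivity
  -- As `ν > 1` and `q ≥ 1`, `η ≥ q h` forces a speed of at least `k lo q h ^ ν = 2 k hi h ^ ν`,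
  -- twice the largest possible speed where `η ≤ h`. Below, `c₀` is the resulting lower bound for
  -- the difference of speeds.
  obtain ⟨q, hq⟩ : ∃ q, q = 2 * hi / lo := ⟨_, rfl⟩
  have hq2 : 2 ≤ q := by rw [hq, le_div_iff₀ hlo]; linarith
  obtain ⟨c₀, hc₀⟩ : ∃ c₀, c₀ = k * hi * (M₁ / lo) ^ speedExp γ := ⟨_, rfl⟩
  have hc₀0 : 0 < c₀ := by rw [hc₀]; positivity
  have hq0 : 0 < q := by linarith
  -- The extra time `C t₀ / c₀` lets a relative speed `c₀` close a gap of size `C t₀`. The constants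
  -- `C₁`, `C₂` are read off from `e4` at the end.
  refine ⟨1 + C / c₀, (2 * M₁ + 2 * hi * q * M₁ / lo) / (2 * lo), (3 + 2 * hi * q / lo) / (2 * lo),
    by have := div_nonneg hC hc₀0.le; linarith, by positivity, by positivity, ?_⟩
  intro m m' V t₁ u ux ut η ηx ηt hm hf hV hu hη Λ G hΛ hG0 hG t₀ ht₀ hB x
  obtain ⟨hbd, hdisp⟩ := H hm hf hu hη
  rw [← hM₁] at hbd
  have hCc : 0 ≤ C / c₀ := div_nonneg hC hc₀0.le
  have ht₀₁ : t₀ ≤ t₁ := by nlinarith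
  have ht₁ : 0 ≤ t₁ := ht₀.trans ht₀₁
  have hz : (0 : ℝ) ∈ Icc 0 t₁ := left_mem_Icc.2 ht₁
  have hνp := hm.one_lt_speedExp
  have hVm := monotone_of_variation hm hV
  obtain ⟨Z, hZ⟩ : ∃ Z, Z = G / Λ * Real.exp (Λ * V x) := ⟨_, rfl⟩
  have hZ0 : 0 ≤ Z := by rw [hZ]; positivity
  rw [← hZ]
  have hexp : ∀ y, y ≤ x → G / Λ * Real.exp (Λ * V y) ≤ Z := by
    intro y hy
    rw [hZ]
    have := hVm hy
    gcongr
  have hexp0 : ∀ y, 0 ≤ G / Λ * Real.exp (Λ * V y) := fun y => by positivity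
  have hinit : ∀ y, ∀ σ : ℝ, |σ| = 1 → |riemann σ m u η y 0| ≤ M₁ := fun y σ hσ => by
    simpa using hbd y 0 hz σ hσ
  have ηb : ∀ y, ∀ t ∈ Icc 0 t₁, η y t ≤ (M₁ + C * t₁) / lo := fun y t ht => by
    have := mul_le_mul_of_nonneg_left ht.2 hC
    exact hf.η_le hm ht ((hbd y t ht 1 (by simp)).trans (by linarith))
      ((hbd y t ht (-1) (by simp)).trans (by linarith))
  have ex : ∀ (σ : ℝ), |σ| = 1 → ∀ y, ∀ t ∈ Icc 0 t₁, ∃ X : ℝ → ℝ, X t = y ∧ ∀ s ∈ Icc 0 t₁,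
      HasDerivWithinAt X (σ * soundSpeed γ k (m (X s)) (η (X s) s)) (Icc 0 t₁) s :=
    fun σ hσ y t ht => hf.exists_characteristic hm hσ
      (L := k * hi * ((M₁ + C * t₁) / lo) ^ speedExp γ) ht (by positivity)
      (fun z s hs _ => hm.soundSpeed_le z (hf.pos z s hs).le (ηb z s hs))
  have anti : ∀ X : ℝ → ℝ, (∀ s ∈ Icc 0 t₁,
      HasDerivWithinAt X (-1 * soundSpeed γ k (m (X s)) (η (X s) s)) (Icc 0 t₁) s) →
      AntitoneOn X (Icc 0 t₁) := fun X hX => by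
    refine antitoneOn_of_hasDerivWithinAt_nonpos (convex_Icc _ _)
      (fun t ht => (hX t ht).continuousWithinAt)
      (fun t ht => (hX t (interior_subset ht)).mono interior_subset) ?_
    intro t ht
    have := hm.soundSpeed_pos (X t) (hf.pos (X t) t (interior_subset ht))
    linarith
  -- Characteristics of speed `c` reach `y ≤ x` from the left, where the monotone `V` is smaller, so
  -- the source contributes at most `Z`.
  have hs : ∀ y ≤ x, ∀ t ∈ Icc 0 t₁, |riemann 1 m u η y t| ≤ M₁ + Z := by
    intro y hy t ht
    obtain ⟨Y, hY0, hY⟩ := ex 1 (by simp) y t ht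
    have h1 := hf.abs_riemann_sub_le hm hV hΛ hG (by norm_num) hY le_rfl ht.1 ht.2
    rw [hY0, one_mul] at h1
    have h2 := abs_sub_abs_le_abs_sub (riemann 1 m u η y t) (riemann 1 m u η (Y 0) 0)
    have h3 := hinit (Y 0) 1 (by simp)
    have h4 := hexp y hy
    have h5 := hexp0 (Y 0)
    linarith
  -- Both curves have speed `-c`: `X₁` leaves `x` at time `0`, `X₂` passes `x` at time `t₀` and so
  -- starts to the right of `X₁`. Both stay left of `x` from then on.
  obtain ⟨X₁, hX₁0, hX₁⟩ := ex (-1) (by simp) x 0 hz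
  obtain ⟨X₂, hX₂0, hX₂⟩ := ex (-1) (by simp) x t₀ ⟨ht₀, ht₀₁⟩
  have le₁ : ∀ t ∈ Icc 0 t₁, X₁ t ≤ x := fun t ht => hX₁0 ▸ anti X₁ hX₁ hz ht ht.1
  have le₂ : ∀ t ∈ Icc t₀ t₁, X₂ t ≤ x := fun t ht =>
    hX₂0 ▸ anti X₂ hX₂ ⟨ht₀, ht₀₁⟩ ⟨ht₀.trans ht.1, ht.2⟩ ht.1
  have r₁ : ∀ t ∈ Icc 0 t₁, |riemann (-1) m u η (X₁ t) t| ≤ M₁ + Z := by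
    intro t ht
    have h1 := hf.abs_riemann_sub_le hm hV hΛ hG (by norm_num) hX₁ le_rfl ht.1 ht.2
    have h2 := abs_sub_abs_le_abs_sub (riemann (-1) m u η (X₁ t) t) (riemann (-1) m u η (X₁ 0) 0)
    have h3 := hinit (X₁ 0) (-1) (by simp)
    have h4 := hexp (X₁ 0) hX₁0.le
    have h5 := hexp0 (X₁ t)
    linarith
  have r₂ : ∀ t ∈ Icc t₀ t₁, riemann (-1) m u η (X₂ t) t ≤ riemann (-1) m u η x t₀ + Z := by
    intro t ht
    have h1 := hf.abs_riemann_sub_le hm hV hΛ hG (by norm_num) hX₂ ht₀ ht.1 ht.2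
    rw [hX₂0] at h1
    have h2 := (abs_le.1 h1).2
    have h4 := hexp x le_rfl
    have h5 := hexp0 (X₂ t)
    linarith
  obtain ⟨h, hh⟩ : ∃ h, h = (M₁ + Z) / lo := ⟨_, rfl⟩
  have hh0 : 0 < h := by rw [hh]; positivity
  -- Otherwise `r = u - m η` stays very negative along `X₂`, which keeps `η ≥ q h` there while `η ≤
  -- h` along `X₁`. Then `X₂` catches up with `X₁` by time `t₁`, where `r` would lie both below and
  -- above `-(M₁ + Z)`.
  have hR : -riemann (-1) m u η x t₀ ≤ M₁ + 2 * Z + 2 * hi * (q * h) := by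
    by_contra! hcon
    have faster : ∀ t ∈ Icc t₀ t₁, c₀ ≤ soundSpeed γ k (m (X₂ t)) (η (X₂ t) t) -
        soundSpeed γ k (m (X₁ t)) (η (X₁ t) t) := by
      intro t ht
      have ht' : t ∈ Icc 0 t₁ := ⟨ht₀.trans ht.1, ht.2⟩
      have b1 : η (X₁ t) t ≤ h := by
        rw [hh]; exact hf.η_le hm ht' (hs _ (le₁ t ht') t ht') (r₁ t ht')
      have b2 : q * h ≤ η (X₂ t) t := by
        have e1 := riemann_sub m u η (X₂ t) t
        have e2 := (abs_le.1 (hs _ (le₂ t ht) t ht')).1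
        have e3 := r₂ t ht
        have e4 := mul_le_mul_of_nonneg_right (hm.le_hi (X₂ t)) (hf.pos (X₂ t) t ht').le
        have e5 : 2 * hi * (q * h) ≤ 2 * hi * η (X₂ t) t := by linarith
        exact le_of_mul_le_mul_left e5 (by positivity)
      have s1 := hm.soundSpeed_le (X₁ t) (hf.pos _ t ht').le b1
      have s2 : 2 * (k * hi * h ^ speedExp γ) ≤ soundSpeed γ k (m (X₂ t)) (η (X₂ t) t) := by
        have e1 : q * h ^ speedExp γ ≤ η (X₂ t) t ^ speedExp γ := by
          calc q * h ^ speedExp γ = q ^ (1 : ℝ) * h ^ speedExp γ := by rw [Real.rpow_one]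
            _ ≤ q ^ speedExp γ * h ^ speedExp γ := by
              have : q ^ (1 : ℝ) ≤ q ^ speedExp γ :=
                Real.rpow_le_rpow_of_exponent_le (by linarith) hνp.le
              gcongr
            _ = (q * h) ^ speedExp γ := (Real.mul_rpow hq0.le hh0.le).symm
            _ ≤ _ := Real.rpow_le_rpow (by positivity) b2 (by linarith)
        have e2 := hm.lo_le (X₂ t)
        calc 2 * (k * hi * h ^ speedExp γ) = k * lo * (q * h ^ speedExp γ) := by
              rw [hq]; field_simp
          _ ≤ k * m (X₂ t) * η (X₂ t) t ^ speedExp γ := by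
              have := hm.pos (X₂ t)
              gcongr
      have s3 : c₀ ≤ k * hi * h ^ speedExp γ := by
        rw [hc₀, hh]
        have : M₁ / lo ≤ (M₁ + Z) / lo := by gcongr; linarith
        gcongr
      linarith
    have hd : ∀ t ∈ Icc t₀ t₁, HasDerivWithinAt (fun t => X₂ t - X₁ t + c₀ * t) _ (Icc t₀ t₁) t :=
      fun t ht => (((hX₂ t ⟨ht₀.trans ht.1, ht.2⟩).sub (hX₁ t ⟨ht₀.trans ht.1, ht.2⟩)).mono
        (Icc_subset_Icc ht₀ le_rfl)).add ((hasDerivWithinAt_id t _).const_mul c₀)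
    have hanti : AntitoneOn (fun t => X₂ t - X₁ t + c₀ * t) (Icc t₀ t₁) := by
      refine antitoneOn_of_hasDerivWithinAt_nonpos (convex_Icc _ _)
        (fun t ht => (hd t ht).continuousWithinAt)
        (fun t ht => (hd t (interior_subset ht)).mono interior_subset) ?_
      intro t ht
      have := faster t (interior_subset ht)
      linarith
    have e1 := hanti (left_mem_Icc.2 ht₀₁) (right_mem_Icc.2 ht₀₁) ht₀₁
    have e2 := hdisp t₀ ⟨ht₀, ht₀₁⟩ X₁ (fun t ht => by
      have := (hX₁ t ⟨ht.1, ht.2.trans ht₀₁⟩).mono (Icc_subset_Icc le_rfl ht₀₁)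
      simpa using this)
    simp only at e1
    have e3 : C * t₀ ≤ c₀ * (t₁ - t₀) := by
      have : c₀ * ((1 + C / c₀) * (1 + t₀)) ≤ c₀ * t₁ := by gcongr
      have h2 : c₀ * ((1 + C / c₀) * (1 + t₀)) = (c₀ + C) * (1 + t₀) := by field_simp
      nlinarith
    have hcontX : ContinuousOn (fun t => X₂ t - X₁ t) (Icc t₀ t₁) := fun t ht =>
      ((hX₂ t ⟨ht₀.trans ht.1, ht.2⟩).sub (hX₁ t ⟨ht₀.trans ht.1, ht.2⟩)).continuousWithinAt.mono
        (Icc_subset_Icc ht₀ le_rfl)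
    have hmem : (0 : ℝ) ∈ Icc (X₂ t₁ - X₁ t₁) (X₂ t₀ - X₁ t₀) := by
      refine ⟨?_, ?_⟩
      · rw [hX₁0, ← hX₂0] at e2
        linarith
      · have := le₁ t₀ ⟨ht₀, ht₀₁⟩
        rw [hX₂0]; linarith
    obtain ⟨t, ht, hcross⟩ := intermediate_value_Icc' ht₀₁ hcontX hmem
    have hcross' : X₂ t = X₁ t := sub_eq_zero.1 hcross
    have f1 := r₂ t ht
    have f2 := (abs_le.1 (r₁ t ⟨ht₀.trans ht.1, ht.2⟩)).1
    rw [hcross'] at f1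
    have : 0 < 2 * hi * (q * h) := by positivity
    linarith
  have e1 := riemann_sub m u η x t₀
  have e2 := (abs_le.1 (hs x le_rfl t₀ ⟨ht₀, ht₀₁⟩)).2
  have e3 := mul_le_mul_of_nonneg_right (hm.lo_le x) (hf.pos x t₀ ⟨ht₀, ht₀₁⟩).le
  have e4 : η x t₀ ≤ (2 * M₁ + 3 * Z + 2 * hi * (q * h)) / (2 * lo) := by
    rw [le_div_iff₀ (by positivity)]; linarith
  refine e4.trans (le_of_eq ?_)
  rw [hh]
  field_simp
  ring

/-- Iteration of the improvement: long existence gives a bound whose dependence on time decays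
with the number of iterations. -/
theorem exists_iterated_bound (γ k lo hi D M Vmax : ℝ) (hγ : 1 < γ) (hk : 0 < k) (hlo : 0 < lo)
    (hhi : lo ≤ hi) (hD : 0 ≤ D) (hM : 1 ≤ M) :
    ∃ B H A : ℝ, 1 ≤ B ∧ 0 ≤ H ∧ 0 ≤ A ∧
      ∀ {m m' V : ℝ → ℝ} {t₁ : ℝ} {u ux ut η ηx ηt : ℝ → ℝ → ℝ},
      Medium γ k lo hi D m m' → IsFlow γ k m m' t₁ u ux ut η ηx ηt →
      (∀ x, HasDerivAt V (|m' x| / γ) x) → (∀ x, 0 ≤ V x) → (∀ x, V x ≤ Vmax) →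
      (∀ x, |u x 0| ≤ M) → (∀ x, η x 0 ≤ M) →
      (∀ t ∈ Icc 0 t₁, ∀ x, η x t ≤ A * (1 + t)) ∧
      ∀ (n : ℕ) (t₀ : ℝ), 0 ≤ t₀ → B ^ n * (1 + t₀) ≤ t₁ → ∀ x,
        η x t₀ ≤ H + (1 / 2) ^ n * (A * (1 + t₀)) := by
  obtain ⟨C, hC, hap⟩ := exists_apriori_bound γ k lo hi D M hγ hk hlo hD (by linarith)
  obtain ⟨B, C₁, C₂, hB, hC₁, hC₂, himp⟩ := exists_improvement γ k lo hi D M hγ hk hlo hhi hD hM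
  have hhi0 : 0 < hi := hlo.trans_le hhi
  -- With this `Λ` the improvement multiplies `G` by `1 / (8 B)`. One step enlarges the time horizon
  -- by `1 + B (1 + t₀) ≤ 2 B (1 + t₀)`, so the time-dependent part is still at least halved.
  obtain ⟨Λ, hΛ⟩ : ∃ Λ, Λ = 8 * B * C₂ := ⟨_, rfl⟩
  have hB0 : 0 < B := by linarith
  have hΛ0 : 0 < Λ := by rw [hΛ]; positivity
  obtain ⟨A, hA⟩ : ∃ A, A = (M + hi * M + C) / lo := ⟨_, rfl⟩
  have hA0 : 0 ≤ A := by rw [hA]; have : 0 ≤ M := by linarith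
                         positivity
  refine ⟨2 * B, 2 * C₁ * Real.exp (Λ * Vmax), A * Real.exp (Λ * Vmax), by linarith,
    by positivity, by positivity, ?_⟩
  intro m m' V t₁ u ux ut η ηx ηt hm hf hV hV0 hVm hu hη
  have hlin : ∀ t ∈ Icc 0 t₁, ∀ x, η x t ≤ A * (1 + t) := by
    intro t ht x
    have hbd := (hap hm hf hu hη).1 x t ht
    refine (hf.η_le hm ht (hbd 1 (by simp)) (hbd (-1) (by simp))).trans ?_
    rw [hA, div_mul_eq_mul_div]
    have : 0 ≤ (M + hi * M) * t := mul_nonneg (by have : 0 ≤ M := by linarith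
                                                  positivity) ht.1
    gcongr
    nlinarith
  have hexp1 : ∀ x, 1 ≤ Real.exp (Λ * V x) := fun x =>
    Real.one_le_exp (mul_nonneg hΛ0.le (hV0 x))
  have key : ∀ (n : ℕ) (t₀ : ℝ), 0 ≤ t₀ → (2 * B) ^ n * (1 + t₀) ≤ 1 + t₁ → t₀ ≤ t₁ → ∀ x,
      η x t₀ ≤ (2 * C₁ + (1 / 2) ^ n * (A * (1 + t₀))) * Real.exp (Λ * V x) := by
    intro n
    induction n with
    | zero =>
      intro t₀ ht₀ h _ x
      have h1 := hlin t₀ ⟨ht₀, by simp at h; linarith⟩ x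
      have h2 : 0 ≤ A * (1 + t₀) := by positivity
      have h3 := hexp1 x
      simp only [pow_zero, one_mul]
      nlinarith
    | succ n ih =>
      intro t₀ ht₀ h h' x
      have hp1 : 1 ≤ (2 * B) ^ n := one_le_pow₀ (by linarith)
      have hp2 : 1 + B * (1 + t₀) ≤ 2 * B * (1 + t₀) := by nlinarith
      have hT : (2 * B) ^ n * (1 + B * (1 + t₀)) ≤ 1 + t₁ := by
        refine le_trans ?_ h
        rw [pow_succ, mul_assoc]
        gcongr
      have hTt : B * (1 + t₀) ≤ t₁ := by nlinarith
      have hB1 : 0 ≤ B * (1 + t₀) := by positivity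
      obtain ⟨G, hG⟩ : ∃ G, G = 2 * C₁ + (1 / 2) ^ n * (A * (1 + B * (1 + t₀))) := ⟨_, rfl⟩
      have hG0 : 0 ≤ G := by rw [hG]; positivity
      have := himp hm (hf.mono hTt) hV hu hη Λ G hΛ0 hG0 (fun y t ht => by
        have ht' : 1 + t ≤ 1 + B * (1 + t₀) := by linarith [ht.2]
        refine (ih t ht.1 (le_trans ?_ hT) (ht.2.trans hTt) y).trans ?_
        · gcongr
        · rw [hG]; gcongr) t₀ ht₀ le_rfl x
      refine this.trans ?_
      have h3 := hexp1 x
      have h4 : C₂ * (G / Λ * Real.exp (Λ * V x)) = G / (8 * B) * Real.exp (Λ * V x) := by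
        rw [hΛ]; field_simp
      have h5 : G / (8 * B) ≤ C₁ + (1 / 2) ^ (n + 1) * (A * (1 + t₀)) := by
        rw [div_le_iff₀ (by positivity), hG, pow_succ]
        have : (1 / 2 : ℝ) ^ n * (A * (1 + B * (1 + t₀))) ≤
            (1 / 2) ^ n * (A * (2 * B * (1 + t₀))) := by gcongr
        have e : 0 ≤ (1 / 2 : ℝ) ^ n * (A * (1 + t₀)) * B := by positivity
        nlinarith
      rw [h4]
      nlinarith
  refine ⟨fun t ht x => (hlin t ht x).trans ?_, fun n t₀ ht₀ h x => ?_⟩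
  · have : 1 ≤ Real.exp (Λ * Vmax) := (hexp1 0).trans (by
      have := hVm 0
      gcongr)
    have h2 : 0 ≤ 1 + t := by linarith [ht.1]
    nlinarith [mul_nonneg hA0 h2]
  · have hp1 : 1 ≤ (2 * B) ^ n := one_le_pow₀ (by linarith)
    refine (key n t₀ ht₀ (by linarith) (by nlinarith) x).trans ?_
    have h1 : Real.exp (Λ * V x) ≤ Real.exp (Λ * Vmax) := by
      have := hVm x
      gcongr
    have h2 : 0 ≤ 2 * C₁ + (1 / 2 : ℝ) ^ n * (A * (1 + t₀)) := by positivity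
    calc _ ≤ (2 * C₁ + (1 / 2 : ℝ) ^ n * (A * (1 + t₀))) * Real.exp (Λ * Vmax) := by gcongr
      _ = _ := by ring

/-! ### Uniqueness by the maximum principle -/

variable {γ k lo hi D : ℝ} {m m' : ℝ → ℝ} {t₁ : ℝ} {u ux ut η ηx ηt : ℝ → ℝ → ℝ}

/-- Derivative along a straight line backward in time. -/
theorem HasPartials.backward {f fx ft : ℝ → ℝ → ℝ} (hf : HasPartials t₁ f fx ft) {x t v : ℝ}
    (ht : t ∈ Icc 0 t₁) :
    HasDerivWithinAt (fun e => f (x - v * e) (t - e)) (-(ft x t + v * fx x t)) (Icc 0 t) 0 := by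
  have hX : HasDerivWithinAt (fun e : ℝ => x - v * e) (-v) (Icc 0 t) 0 := by
    simpa using (((hasDerivAt_id (0 : ℝ)).const_mul v).const_sub x).hasDerivWithinAt
  have hθ : HasDerivWithinAt (fun e : ℝ => t - e) (-1) (Icc 0 t) 0 := by
    simpa using ((hasDerivAt_id (0 : ℝ)).const_sub t).hasDerivWithinAt
  have := hf.along hX hθ (fun r hr => ⟨by linarith [hr.2], by linarith [hr.1, ht.2]⟩)
    (left_mem_Icc.2 ht.1)
  refine this.congr_deriv ?_
  simp only [mul_zero, sub_zero]
  ring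

/-- The sign `1` or `-1` attached to a Boolean. -/
def sgn (b : Bool) : ℝ := if b then 1 else -1

@[simp] theorem sgn_true : sgn true = 1 := rfl

@[simp] theorem sgn_false : sgn false = -1 := rfl

@[simp] theorem abs_sgn (b : Bool) : |sgn b| = 1 := by cases b <;> simp

@[simp] theorem sgn_sq (b : Bool) : sgn b ^ 2 = 1 := by cases b <;> simp

theorem abs_rpow_sub_rpow_le {p H x y : ℝ} (hp : 1 ≤ p) (hx : x ∈ Icc 0 H) (hy : y ∈ Icc 0 H) :
    |x ^ p - y ^ p| ≤ p * H ^ (p - 1) * |x - y| := by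
  have := Convex.norm_image_sub_le_of_norm_hasDerivWithin_le (𝕜 := ℝ) (f := fun z : ℝ => z ^ p)
    (f' := fun z => p * z ^ (p - 1)) (s := Icc 0 H) (C := p * H ^ (p - 1)) (x := y) (y := x)
    (fun z _ => (Real.hasDerivAt_rpow_const (Or.inr hp)).hasDerivWithinAt)
    (fun z hz => by
      rw [Real.norm_of_nonneg (mul_nonneg (by linarith) (Real.rpow_nonneg hz.1 _))]
      have : z ^ (p - 1) ≤ H ^ (p - 1) := Real.rpow_le_rpow hz.1 hz.2 (by linarith)
      gcongr) (convex_Icc _ _) hy hx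
  simpa using this

/-- Uniqueness of solutions of the initial value problem, when one of them has bounded speed. -/
theorem IsFlow.unique (hm : Medium γ k lo hi D m m') (hf : IsFlow γ k m m' t₁ u ux ut η ηx ηt)
    {w wx wt θ θx θt : ℝ → ℝ → ℝ} (hg : IsFlow γ k m m' t₁ w wx wt θ θx θt)
    (hu : ∀ x, u x 0 = w x 0) (hη : ∀ x, η x 0 = θ x 0) {L : ℝ} (hL : 0 ≤ L)
    (hspeed : ∀ x, ∀ t ∈ Icc 0 t₁, soundSpeed γ k (m x) (η x t) ≤ L) :
    ∀ x, ∀ t ∈ Icc 0 t₁, u x t = w x t ∧ η x t = θ x t := by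
  intro x₀ t₀ ht₀
  have hsub := triangle_subset_slab (L := L) (x₀ := x₀) ht₀.2
  have hK := isCompact_triangle (x₀ := x₀) (t₀ := t₀) hL
  have hmem : ∀ p ∈ triangle L x₀ t₀, p.2 ∈ Icc 0 t₁ := fun p hp => mem_slab.1 (hsub hp)
  have hν := hm.one_lt_speedExp
  have hk := hm.k_pos
  have hγ := hm.γ_pos
  have hhi := hm.hi_pos
  have hD := hm.D_nonneg
  obtain ⟨H₁, hH₁⟩ := hK.exists_bound_of_continuousOn (hf.η_partials.cont.mono hsub)
  obtain ⟨H₂, hH₂⟩ := hK.exists_bound_of_continuousOn (hg.η_partials.cont.mono hsub)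
  obtain ⟨H, hH⟩ : ∃ H, H = max H₁ H₂ := ⟨_, rfl⟩
  have hη1 : ∀ p ∈ triangle L x₀ t₀, η p.1 p.2 ∈ Icc 0 H := fun p hp =>
    ⟨(hf.pos _ _ (hmem p hp)).le, (le_abs_self _).trans ((hH₁ p hp).trans (hH ▸ le_max_left _ _))⟩
  have hη2 : ∀ p ∈ triangle L x₀ t₀, θ p.1 p.2 ∈ Icc 0 H := fun p hp =>
    ⟨(hg.pos _ _ (hmem p hp)).le, (le_abs_self _).trans ((hH₂ p hp).trans (hH ▸ le_max_right _ _))⟩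
  have hH0 : 0 ≤ H := by
    have := hη1 _ (apex_mem_triangle (L := L) ht₀.1); exact this.1.trans this.2
  have hS : ∀ b : Bool, ∃ S, ∀ p ∈ triangle L x₀ t₀,
      |wx p.1 p.2 + sgn b * (m' p.1 * θ p.1 p.2 + m p.1 * θx p.1 p.2)| ≤ S := fun b =>
    hK.exists_bound_of_continuousOn ((hg.riemann_partials hm (sgn b)).cont_x.mono hsub)
  choose S hS using hS
  obtain ⟨K₁, hK₁⟩ : ∃ K₁, K₁ = k * hi * (speedExp γ * H ^ (speedExp γ - 1)) := ⟨_, rfl⟩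
  have hK₁0 : 0 ≤ K₁ := by rw [hK₁]; positivity
  have hc : ∀ p ∈ triangle L x₀ t₀, |soundSpeed γ k (m p.1) (η p.1 p.2) -
      soundSpeed γ k (m p.1) (θ p.1 p.2)| ≤ K₁ * |η p.1 p.2 - θ p.1 p.2| := by
    intro p hp
    have h1 := abs_rpow_sub_rpow_le hν.le (hη1 p hp) (hη2 p hp)
    have h2 := hm.pos p.1
    have h3 := hm.le_hi p.1
    rw [soundSpeed, soundSpeed, ← mul_sub, abs_mul, abs_of_pos (by positivity), hK₁]
    calc _ ≤ k * hi * (speedExp γ * H ^ (speedExp γ - 1) * |η p.1 p.2 - θ p.1 p.2|) := by gcongr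
      _ = _ := by ring
  obtain ⟨K₀, hK₀⟩ : ∃ K₀, K₀ = (D / γ * (L + H * K₁) + K₁ * (|S true| + |S false|)) / lo :=
    ⟨_, rfl⟩
  have hlo := hm.lo_pos
  have hK₀0 : 0 ≤ K₀ := by rw [hK₀]; positivity
  let d : Bool → ℝ → ℝ → ℝ := fun b x t =>
    riemann (sgn b) m u η x t - riemann (sgn b) m w θ x t
  -- The first Boolean selects the Riemann family, the second a sign, so the maximum of the four
  -- functions controls both absolute differences. The damping rate `K₀ + 1` beats the Lipschitz
  -- constant `K₀` of the coupling terms.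
  let F : Bool × Bool → ℝ × ℝ → ℝ := fun i p =>
    sgn i.2 * (Real.exp (-(K₀ + 1) * p.2) * d i.1 p.1 p.2)
  let v : Bool × Bool → ℝ × ℝ → ℝ := fun i p => sgn i.1 * soundSpeed γ k (m p.1) (η p.1 p.2)
  let δ : Bool → ℝ × ℝ → ℝ := fun b p =>
    m' p.1 / γ * (soundSpeed γ k (m p.1) (η p.1 p.2) * η p.1 p.2 -
      soundSpeed γ k (m p.1) (θ p.1 p.2) * θ p.1 p.2) -
    sgn b * (soundSpeed γ k (m p.1) (η p.1 p.2) - soundSpeed γ k (m p.1) (θ p.1 p.2)) *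
      (wx p.1 p.2 + sgn b * (m' p.1 * θ p.1 p.2 + m p.1 * θx p.1 p.2))
  let G : Bool × Bool → ℝ × ℝ → ℝ := fun i p =>
    sgn i.2 * (Real.exp (-(K₀ + 1) * p.2) * (-(K₀ + 1) * d i.1 p.1 p.2 + δ i.1 p))
  have hdp := fun b => (hf.riemann_partials hm (sgn b)).sub (hg.riemann_partials hm (sgn b))
  have hFc : ∀ i, ContinuousOn (F i) (triangle L x₀ t₀) := fun i =>
    continuousOn_const.mul ((by fun_prop : Continuous fun p : ℝ × ℝ =>
      Real.exp (-(K₀ + 1) * p.2)).continuousOn.mul ((hdp i.1).cont.mono hsub))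
  have hGc : ∀ i, ContinuousOn (G i) (triangle L x₀ t₀) := by
    intro i
    have c1 := (hf.speed_partials hm).cont.mono hsub
    have c2 := (hg.speed_partials hm).cont.mono hsub
    have c3 := hf.η_partials.cont.mono hsub
    have c4 := hg.η_partials.cont.mono hsub
    have c5 := (hg.riemann_partials hm (sgn i.1)).cont_x.mono hsub
    have c6 : ContinuousOn (fun p : ℝ × ℝ => m' p.1 / γ) (triangle L x₀ t₀) :=
      ((hm.cont.comp continuous_fst).div_const γ).continuousOn
    have cδ : ContinuousOn (δ i.1) (triangle L x₀ t₀) :=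
      (c6.mul ((c1.mul c3).sub (c2.mul c4))).sub ((continuousOn_const.mul (c1.sub c2)).mul c5)
    exact continuousOn_const.mul ((by fun_prop : Continuous fun p : ℝ × ℝ =>
      Real.exp (-(K₀ + 1) * p.2)).continuousOn.mul
        ((continuousOn_const.mul ((hdp i.1).cont.mono hsub)).add cδ))
  have main := max_principle (ι := Bool × Bool) (M := 0) hL (f := fun _ => F) (R := fun _ => G)
    (F := F) (G := G) (v := v) (x₀ := x₀) (t₀ := t₀) ?_ (fun _ => hFc) ?_
    (fun i p hp => (hFc i p hp).tendsto.comp tendsto_snd)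
    (fun i p hp => (hGc i p hp).tendsto.comp tendsto_snd) ?_ ?_
  · have hz : ∀ b, d b x₀ t₀ = 0 := by
      intro b
      have hp := apex_mem_triangle (L := L) (x₀ := x₀) ht₀.1
      have e1 := main (b, true) _ hp
      have e2 := main (b, false) _ hp
      simp only [F, sgn_true, sgn_false] at e1 e2
      have h0 := Real.exp_pos (-(K₀ + 1) * t₀)
      have : Real.exp (-(K₀ + 1) * t₀) * d b x₀ t₀ = 0 := by linarith
      exact (mul_eq_zero.1 this).resolve_left h0.ne'
    have e1 := hz true
    have e2 := hz false
    simp only [d, riemann, sgn_true, sgn_false] at e1 e2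
    refine ⟨by linarith, ?_⟩
    have : m x₀ * η x₀ t₀ = m x₀ * θ x₀ t₀ := by linarith
    exact mul_left_cancel₀ (hm.pos x₀).ne' this
  · intro i p hp
    simp only [v]
    rw [abs_mul, abs_sgn, one_mul, abs_of_pos (hm.soundSpeed_pos _ (hf.pos _ _ (hmem p hp)))]
    exact hspeed p.1 p.2 (hmem p hp)
  · intro _ i p hp _
    have h1 := (hdp i.1).backward (x := p.1) (v := v i p) (hmem p hp)
    have h2 : HasDerivWithinAt (fun e : ℝ => Real.exp (-(K₀ + 1) * (p.2 - e)))
        (Real.exp (-(K₀ + 1) * p.2) * (K₀ + 1)) (Icc 0 p.2) 0 := by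
      have := ((((hasDerivAt_id (0 : ℝ)).const_sub p.2).const_mul (-(K₀ + 1))).exp).hasDerivWithinAt
        (s := Icc 0 p.2)
      simpa using this
    refine ((h2.mul h1).const_mul (sgn i.2)).congr_deriv ?_
    have t1 := hf.riemann_transport hm (sgn_sq i.1) (x := p.1) (hmem p hp)
    have t2 := hg.riemann_transport hm (sgn_sq i.1) (x := p.1) (hmem p hp)
    simp only [sub_zero, mul_zero, v, G, δ, d]
    linear_combination (sgn i.2 * Real.exp (-(K₀ + 1) * p.2)) * (t2 - t1)
  · intro i p hp _ hpos hmax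
    have h0 := Real.exp_pos (-(K₀ + 1) * p.2)
    obtain ⟨X, hX⟩ : ∃ X, X = sgn i.2 * d i.1 p.1 p.2 := ⟨_, rfl⟩
    have hFX : F i p = Real.exp (-(K₀ + 1) * p.2) * X := by rw [hX]; simp only [F]; ring
    have hX0 : 0 < X := by
      rw [hFX] at hpos
      exact (mul_pos_iff_of_pos_left h0).1 hpos
    have hdX : ∀ b, |d b p.1 p.2| ≤ X := by
      intro b
      have e1 := hmax (b, true)
      have e2 := hmax (b, false)
      rw [hFX] at e1 e2
      simp only [F, sgn_true, sgn_false] at e1 e2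
      refine abs_le.2 ⟨?_, ?_⟩
      · have : Real.exp (-(K₀ + 1) * p.2) * (-d b p.1 p.2) ≤ Real.exp (-(K₀ + 1) * p.2) * X := by
          linarith
        have := le_of_mul_le_mul_left this h0
        linarith
      · have : Real.exp (-(K₀ + 1) * p.2) * (d b p.1 p.2) ≤ Real.exp (-(K₀ + 1) * p.2) * X := by
          linarith
        exact le_of_mul_le_mul_left this h0
    have hΔ : |η p.1 p.2 - θ p.1 p.2| ≤ X / lo := by
      rw [le_div_iff₀ hlo]
      have e : d true p.1 p.2 - d false p.1 p.2 = 2 * (m p.1 * (η p.1 p.2 - θ p.1 p.2)) := by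
        simp only [d, riemann, sgn_true, sgn_false]; ring
      have h1 : |d true p.1 p.2 - d false p.1 p.2| ≤ X + X :=
        (abs_sub _ _).trans (add_le_add (hdX true) (hdX false))
      rw [e, abs_mul, abs_mul, abs_of_pos (hm.pos p.1), abs_two] at h1
      have := mul_le_mul_of_nonneg_right (hm.lo_le p.1) (abs_nonneg (η p.1 p.2 - θ p.1 p.2))
      linarith
    have hδ : |δ i.1 p| ≤ K₀ * X := by
      obtain ⟨Δ, hΔd⟩ : ∃ Δ, Δ = |η p.1 p.2 - θ p.1 p.2| := ⟨_, rfl⟩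
      have a1 := hc p hp
      have a2 : |soundSpeed γ k (m p.1) (η p.1 p.2) * η p.1 p.2 -
          soundSpeed γ k (m p.1) (θ p.1 p.2) * θ p.1 p.2| ≤ (L + H * K₁) * Δ := by
        have e : soundSpeed γ k (m p.1) (η p.1 p.2) * η p.1 p.2 -
          soundSpeed γ k (m p.1) (θ p.1 p.2) * θ p.1 p.2 =
          soundSpeed γ k (m p.1) (η p.1 p.2) * (η p.1 p.2 - θ p.1 p.2) +
          θ p.1 p.2 * (soundSpeed γ k (m p.1) (η p.1 p.2) - soundSpeed γ k (m p.1) (θ p.1 p.2)) := by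
          ring
        rw [e]
        refine (abs_add_le _ _).trans ?_
        rw [abs_mul, abs_mul, abs_of_nonneg (hη2 p hp).1,
          abs_of_pos (hm.soundSpeed_pos _ (hf.pos _ _ (hmem p hp))), ← hΔd]
        rw [← hΔd] at a1
        have b1 := hspeed p.1 p.2 (hmem p hp)
        have b2 := (hη2 p hp).2
        have b3 : 0 ≤ Δ := hΔd ▸ abs_nonneg _
        calc _ ≤ L * Δ + H * (K₁ * Δ) := by gcongr
          _ = _ := by ring
      have a3 := hm.deriv_le p.1
      have a4 : |wx p.1 p.2 + sgn i.1 * (m' p.1 * θ p.1 p.2 + m p.1 * θx p.1 p.2)| ≤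
          |S true| + |S false| := by
        refine (hS i.1 p hp).trans ((le_abs_self _).trans ?_)
        have := abs_nonneg (S true)
        have := abs_nonneg (S false)
        cases i.1 <;> linarith
      rw [← hΔd] at a1 hΔ
      have b3 : 0 ≤ Δ := hΔd ▸ abs_nonneg _
      simp only [δ]
      refine (abs_sub _ _).trans ?_
      rw [abs_mul, abs_mul, abs_mul, abs_sgn, one_mul, abs_div, abs_of_pos hγ]
      calc _ ≤ D / γ * ((L + H * K₁) * Δ) + K₁ * Δ * (|S true| + |S false|) := by gcongr
        _ = (D / γ * (L + H * K₁) + K₁ * (|S true| + |S false|)) * Δ := by ring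
        _ ≤ (D / γ * (L + H * K₁) + K₁ * (|S true| + |S false|)) * (X / lo) := by gcongr
        _ = K₀ * X := by rw [hK₀]; ring
    have hςδ : sgn i.2 * δ i.1 p ≤ K₀ * X := by
      refine (le_abs_self _).trans ?_
      rwa [abs_mul, abs_sgn, one_mul]
    have : G i p = Real.exp (-(K₀ + 1) * p.2) * (-(K₀ + 1) * X + sgn i.2 * δ i.1 p) := by
      rw [hX]; simp only [G]; ring
    rw [this]
    refine mul_neg_of_pos_of_neg h0 ?_
    linarith
  · intro i p hp h0
    have : d i.1 p.1 p.2 = 0 := by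
      simp only [d, riemann, h0, hu, hη, sub_self]
    simp only [F, this, mul_zero, le_refl]

/-! ### Difference quotients in time -/

/-- Forward difference quotient in time. -/
noncomputable def timeQuot (h : ℝ) (g : ℝ → ℝ → ℝ) (x t : ℝ) : ℝ := (g x (t + h) - g x t) / h

/-- The limit is joint in the index and the point, the form of convergence `max_principle` requires.
The evaluation time `τ` may be any choice in `[t, t + h n]`, as the mean value theorem supplies no
continuous one. -/
theorem tendsto_shift {t₀ t₁ L x₀ : ℝ} {g : ℝ × ℝ → ℝ} (hg : ContinuousOn g (slab t₁))
    {h : ℕ → ℝ} (hpos : ∀ n, 0 < h n) (hle : ∀ n, t₀ + h n ≤ t₁) (hlim : Tendsto h atTop (𝓝 0))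
    {τ : ℕ × (ℝ × ℝ) → ℝ}
    (hτ : ∀ n, ∀ p ∈ triangle L x₀ t₀, τ (n, p) ∈ Icc p.2 (p.2 + h n)) {p : ℝ × ℝ}
    (hp : p ∈ triangle L x₀ t₀) :
    Tendsto (fun q : ℕ × (ℝ × ℝ) => g (q.2.1, τ q)) (atTop ×ˢ 𝓝[triangle L x₀ t₀] p)
      (𝓝 (g p)) := by
  have ht₀ : t₀ ≤ t₁ := by have := hle 0; have := hpos 0; linarith
  have hps : p ∈ slab t₁ := triangle_subset_slab ht₀ hp
  have hev : ∀ᶠ q : ℕ × (ℝ × ℝ) in atTop ×ˢ 𝓝[triangle L x₀ t₀] p,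
      q.2 ∈ triangle L x₀ t₀ := tendsto_snd.eventually self_mem_nhdsWithin
  have h2 : Tendsto (fun q : ℕ × (ℝ × ℝ) => q.2) (atTop ×ˢ 𝓝[triangle L x₀ t₀] p) (𝓝 p) :=
    (tendsto_nhdsWithin_iff.1 tendsto_snd).1
  have h3 : Tendsto (fun q : ℕ × (ℝ × ℝ) => q.2.2) (atTop ×ˢ 𝓝[triangle L x₀ t₀] p) (𝓝 p.2) :=
    (continuous_snd.tendsto p).comp h2
  have h4 : Tendsto (fun q : ℕ × (ℝ × ℝ) => q.2.2 + h q.1) (atTop ×ˢ 𝓝[triangle L x₀ t₀] p)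
      (𝓝 p.2) := by
    simpa using h3.add (hlim.comp tendsto_fst)
  have h5 : Tendsto τ (atTop ×ˢ 𝓝[triangle L x₀ t₀] p) (𝓝 p.2) := by
    refine tendsto_of_tendsto_of_tendsto_of_le_of_le' h3 h4 ?_ ?_
    · filter_upwards [hev] with q hq using (hτ q.1 q.2 hq).1
    · filter_upwards [hev] with q hq using (hτ q.1 q.2 hq).2
  refine (hg p hps).tendsto.comp (tendsto_nhdsWithin_iff.2 ⟨?_, ?_⟩)
  · exact ((continuous_fst.tendsto p).comp h2).prodMk_nhds h5
  · filter_upwards [hev] with q hq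
    have h1 := hτ q.1 q.2 hq
    have h2 := hle q.1
    exact mem_slab.2 ⟨hq.1.trans h1.1, by linarith [h1.2, hq.2.1]⟩

/-- Continuous convergence of the time difference quotients to the time derivative. -/
theorem HasPartials.tendsto_timeQuot {t₀ t₁ L x₀ : ℝ} {g gx gt : ℝ → ℝ → ℝ}
    (hg : HasPartials t₁ g gx gt)
    {h : ℕ → ℝ} (hpos : ∀ n, 0 < h n) (hle : ∀ n, t₀ + h n ≤ t₁) (hlim : Tendsto h atTop (𝓝 0))
    {p : ℝ × ℝ} (hp : p ∈ triangle L x₀ t₀) :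
    Tendsto (fun q : ℕ × (ℝ × ℝ) => timeQuot (h q.1) g q.2.1 q.2.2)
      (atTop ×ˢ 𝓝[triangle L x₀ t₀] p) (𝓝 (gt p.1 p.2)) := by
  have mvt : ∀ q : ℕ × (ℝ × ℝ), ∃ τ, q.2 ∈ triangle L x₀ t₀ →
      τ ∈ Icc q.2.2 (q.2.2 + h q.1) ∧ gt q.2.1 τ = timeQuot (h q.1) g q.2.1 q.2.2 := by
    rintro ⟨n, x, t⟩
    by_cases hq : (x, t) ∈ triangle L x₀ t₀
    · have hlt : t < t + h n := by have := hpos n; linarith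
      have h0 : 0 ≤ t := hq.1
      have h1 : t + h n ≤ t₁ := by have : t ≤ t₀ := hq.2.1
                                   have := hle n
                                   linarith
      have hsub : Icc t (t + h n) ⊆ Icc 0 t₁ := Icc_subset_Icc h0 h1
      obtain ⟨τ, hτ, e⟩ := exists_hasDerivAt_eq_slope (fun s => g x s) (fun s => gt x s) hlt
        (fun s hs => ((hg.deriv_t (x := x) (hsub hs)).mono hsub).continuousWithinAt)
        (fun s hs => (hg.deriv_t (x := x) (hsub (Ioo_subset_Icc_self hs))).hasDerivAt
          (Icc_mem_nhds (h0.trans_lt hs.1) (hs.2.trans_le h1)))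
      refine ⟨τ, fun _ => ⟨Ioo_subset_Icc_self hτ, ?_⟩⟩
      rw [e, timeQuot, add_sub_cancel_left]
    · exact ⟨0, fun h => absurd h hq⟩
  choose τ hτ using mvt
  refine (tendsto_shift (g := uncurry gt) (τ := τ) hg.cont_t hpos hle hlim
    (fun n p hp => (hτ (n, p) hp).1) hp).congr' ?_
  have hev : ∀ᶠ q : ℕ × (ℝ × ℝ) in atTop ×ˢ 𝓝[triangle L x₀ t₀] p,
      q.2 ∈ triangle L x₀ t₀ := tendsto_snd.eventually self_mem_nhdsWithin
  filter_upwards [hev] with q hq using (hτ q hq).2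

/-! ### Riccati equations for the weighted gradients -/

variable {γ k lo hi D : ℝ} {m m' : ℝ → ℝ} {t₁ : ℝ} {u ux ut η ηx ηt : ℝ → ℝ → ℝ}

/-- The gradient variable `u_x + σ (m η_x + (γ - 1) / γ m' η)`. -/
noncomputable def gradVar (γ σ : ℝ) (m m' : ℝ → ℝ) (ux η ηx : ℝ → ℝ → ℝ) (x t : ℝ) : ℝ :=
  ux x t + σ * (m x * ηx x t + (γ - 1) / γ * m' x * η x t)

/-- The weight `η ^ (q - ν) / (k m)`. -/
noncomputable def weight (γ k q : ℝ) (m : ℝ → ℝ) (η : ℝ → ℝ → ℝ) (x t : ℝ) : ℝ :=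
  (k * m x)⁻¹ * η x t ^ (q - speedExp γ)

/-- Turns the limit of the difference quotient equations into the Riccati form. `W` and `N` stand
for `η ^ q` and `η ^ ν`, so `W / N / η` is `η ^ (q - ν - 1)` and, for each sign `σ`, only a rational
identity is left. -/
theorem riccati_identity {σ γ k q m m' N W η ux y ηx : ℝ} (hσ : |σ| = 1) (hγ : 1 < γ) (hk : k ≠ 0)
    (hm : m ≠ 0) (hN : N ≠ 0) (hη : η ≠ 0) (hy : y = m * ηx + (γ - 1) / γ * m' * η) :
    -σ * (((k * m)⁻¹ * ((q - speedExp γ) * (W / N / η) * (-(k * N) * ux)) +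
      σ * (k * m * N) * (-(k * m') / (k * m) ^ 2 * (W / N) +
        (k * m)⁻¹ * ((q - speedExp γ) * (W / N / η) * ηx))) * (-σ * (k * m * N) * (ux + σ * y)) +
      (k * m)⁻¹ * (W / N) * (k * m * N) * (m' * (-(k * N) * ux) / γ -
        (-σ * (k * m * N) * (ux + σ * y)) *
          (-((k * m * N) ^ 2)⁻¹ * (k * m * (speedExp γ * (N / η) * (-(k * N) * ux)))))) =
    W * (k * N / η) * (-(speedExp γ / 2) * (ux + σ * y) ^ 2 +
      (speedExp γ / 2 - q) * (ux + σ * y) * (ux + -σ * y) +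
      σ * (m' * η) * ((3 / (2 * γ) - q * ((γ - 1) / γ)) * (ux + σ * y) +
        (ux + -σ * y) / (2 * γ))) := by
  have h1 : γ - 1 ≠ 0 := by linarith
  have h2 : γ ≠ 0 := by linarith
  rw [hy, speedExp]
  rcases eq_or_eq_neg_of_abs_eq hσ with h | h <;> rw [h] <;> field_simp <;> ring

theorem IsFlow.weight_partials (hm : Medium γ k lo hi D m m')
    (hf : IsFlow γ k m m' t₁ u ux ut η ηx ηt) (q : ℝ) :
    HasPartials t₁ (weight γ k q m η)
      (fun x t => -(k * m' x) / (k * m x) ^ 2 * η x t ^ (q - speedExp γ) +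
        (k * m x)⁻¹ * ((q - speedExp γ) * η x t ^ (q - speedExp γ - 1) * ηx x t))
      (fun x t => (k * m x)⁻¹ * ((q - speedExp γ) * η x t ^ (q - speedExp γ - 1) * ηt x t)) := by
  have hne : ∀ x, k * m x ≠ 0 := fun x => (mul_pos hm.k_pos (hm.pos x)).ne'
  have hmc : Continuous m := continuous_iff_continuousAt.2 fun x => (hm.hasDeriv x).continuousAt
  have h1 : HasPartials t₁ (fun x _ => (k * m x)⁻¹) (fun x _ => -(k * m' x) / (k * m x) ^ 2)
      (fun _ _ => 0) :=
    HasPartials.of_x t₁ (fun x => ((hm.hasDeriv x).const_mul k).inv (hne x))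
      ((continuous_const.mul hm.cont).neg.div ((continuous_const.mul hmc).pow 2)
        fun x => pow_ne_zero 2 (hne x))
  exact (h1.mul (hf.η_partials.rpow (q - speedExp γ) hf.pos)).congr (fun _ _ _ => rfl)
    (fun _ _ _ => by ring)

/-- Dividing the transport equation by `c` gives `s_x` a constant coefficient, so differencing it in
time produces a quotient of `1 / c`. -/
theorem IsFlow.slowness_partials (hm : Medium γ k lo hi D m m')
    (hf : IsFlow γ k m m' t₁ u ux ut η ηx ηt) :
    HasPartials t₁ (fun x t => (soundSpeed γ k (m x) (η x t))⁻¹)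
      (fun x t => -(soundSpeed γ k (m x) (η x t) ^ 2)⁻¹ * (k * m' x * η x t ^ speedExp γ +
        k * m x * (speedExp γ * η x t ^ (speedExp γ - 1) * ηx x t)))
      (fun x t => -(soundSpeed γ k (m x) (η x t) ^ 2)⁻¹ *
        (k * m x * (speedExp γ * η x t ^ (speedExp γ - 1) * ηt x t))) :=
  (hf.speed_partials hm).comp (φ := fun y => y⁻¹) (φ' := fun y => -(y ^ 2)⁻¹) (s := Ioi 0)
    (fun x t ht => hm.soundSpeed_pos x (hf.pos x t ht))
    (fun _ hy => hasDerivAt_inv (ne_of_gt hy))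
    (((continuousOn_id.pow 2).inv₀ fun _ hy => pow_ne_zero 2 (ne_of_gt hy)).neg)

/-- The gradient variables are time derivatives of the Riemann variables up to the factor `-σ c`.
They can thus be approximated by differences in time, which leave the medium untouched; differences
in `x` would act on `m'`, which is only continuous. -/
theorem IsFlow.riemann_time_deriv (hf : IsFlow γ k m m' t₁ u ux ut η ηx ηt) {σ : ℝ}
    (hσ : σ ^ 2 = 1) {x t : ℝ} (ht : t ∈ Icc 0 t₁) :
    ut x t + σ * (m x * ηt x t) =
      -σ * soundSpeed γ k (m x) (η x t) * gradVar γ σ m m' ux η ηx x t := by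
  rw [hf.mass x t ht, hf.momentum x t ht, gradVar, soundSpeed]
  linear_combination (k * m x * η x t ^ speedExp γ *
    (m x * ηx x t + (γ - 1) / γ * m' x * η x t)) * hσ

/-- The quadratic form in the Riccati equations is negative when the larger variable is large. -/
theorem riccati_neg {ν q a b P K₁ K₂ : ℝ} (hqν : q < ν / 2)
    (hba : b ≤ a) (ha : 0 < a) (hP : 0 ≤ P) {S κ : ℝ} (hS : |S| ≤ P) (hκ : |κ| ≤ K₁) (hK₂ : 0 ≤ K₂)
    (h1 : P * (K₁ + K₂) < q * a) (h2 : P * K₂ ≤ (ν / 2 - q) * a) :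
    -(ν / 2) * a ^ 2 + (ν / 2 - q) * a * b + S * (κ * a + K₂ * b) < 0 := by
  have e1 : S * (κ * a) ≤ P * K₁ * a := by
    have : |S * (κ * a)| ≤ P * K₁ * a := by
      rw [abs_mul, abs_mul, abs_of_pos ha, ← mul_assoc]
      gcongr
    exact (le_abs_self _).trans this
  have e2 : S * (K₂ * b) ≤ P * K₂ * |b| := by
    have : |S * (K₂ * b)| ≤ P * K₂ * |b| := by
      rw [abs_mul, abs_mul, abs_of_nonneg hK₂, ← mul_assoc]
      gcongr
    exact (le_abs_self _).trans this
  have hK₁ : 0 ≤ K₁ := (abs_nonneg _).trans hκ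
  have h3 := mul_lt_mul_of_pos_right h1 ha
  -- For `b ≥ 0`, `a b ≤ a ^ 2` leaves `-q a ^ 2` to beat `P (K₁ + K₂) a`. For `b ≤ 0` the mixed
  -- term is itself nonpositive and absorbs `P K₂ |b|`.
  rcases le_total 0 b with hb | hb
  · rw [abs_of_nonneg hb] at e2
    have h4 : (ν / 2 - q) * a * b ≤ (ν / 2 - q) * a * a :=
      mul_le_mul_of_nonneg_left hba (mul_nonneg (by linarith) ha.le)
    have h5 : P * K₂ * b ≤ P * K₂ * a := by gcongr
    nlinarith
  · rw [abs_of_nonpos hb] at e2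
    have h4 := mul_le_mul_of_nonneg_right h2 (neg_nonneg.2 hb)
    have h5 : 0 ≤ P * K₂ * a := by positivity
    have h6 : q * a * a ≤ ν / 2 * a * a := by gcongr
    nlinarith

/-- Primes denote values at the shifted time. Both values are differentiated along the unshifted
speed `c`; the shifted transport equation, divided by `c'`, eliminates `X'`, and the discrepancy of
speeds becomes the quotient of `1 / c`. -/
theorem transport_quot {σ c c' h a a' X X' η η' m' γ ω dω q : ℝ} (hc : c ≠ 0) (hc' : c' ≠ 0)
    (t1 : a + σ * c * X = c * m' * η / γ) (t2 : a' + σ * c' * X' = c' * m' * η' / γ) :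
    -σ * (-dω * q + ω * ((-(a' + σ * c * X') - -(a + σ * c * X)) / h)) =
      - (-σ * (dω * q + ω * c * (m' * ((η' - η) / h) / γ - a' * ((c'⁻¹ - c⁻¹) / h)))) := by
  have e : a' + σ * c * X' = c * m' * η' / γ + a' * (1 - c / c') := by
    have : σ * X' = m' * η' / γ - a' / c' := by
      field_simp at t2 ⊢
      linear_combination t2
    rw [mul_right_comm, this]
    ring
  rw [e, t1]
  rcases eq_or_ne h 0 with rfl | hh
  · simp
  · field_simp
    ring

/-- Uniform upper bound for the weighted gradient variables. -/
theorem exists_gradient_bound (γ k lo hi D H q N : ℝ) (hγ : 1 < γ) (hD : 0 ≤ D)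
    (hH : 0 < H) (hq : 0 < q) (hqν : q < speedExp γ / 2) :
    ∃ N₁ : ℝ, ∀ {m m' : ℝ → ℝ} {t₁ : ℝ} {u ux ut η ηx ηt : ℝ → ℝ → ℝ},
      Medium γ k lo hi D m m' → IsFlow γ k m m' t₁ u ux ut η ηx ηt →
      (∀ x, ∀ t ∈ Icc 0 t₁, η x t ≤ H) →
      (∀ x, ∀ b : Bool, η x 0 ^ q * gradVar γ (sgn b) m m' ux η ηx x 0 ≤ N) →
      ∀ t₀, 0 ≤ t₀ → t₀ < t₁ → ∀ x, ∀ b : Bool,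
        η x t₀ ^ q * gradVar γ (sgn b) m m' ux η ηx x t₀ ≤ N₁ := by
  obtain ⟨K₁, hK₁⟩ : ∃ K₁, K₁ = 3 / (2 * γ) + q * ((γ - 1) / γ) := ⟨_, rfl⟩
  obtain ⟨K₂, hK₂⟩ : ∃ K₂, K₂ = 1 / (2 * γ) := ⟨_, rfl⟩
  have hγ0 : 0 < γ := by linarith
  have ha0 : 0 ≤ (γ - 1) / γ := div_nonneg (by linarith) hγ0.le
  have hK₁0 : 0 < K₁ := by rw [hK₁]; positivity
  have hK₂0 : 0 < K₂ := by rw [hK₂]; positivity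
  have hgap : 0 < speedExp γ / 2 - q := by linarith
  -- The sum of the two thresholds in `riccati_neg` with `P = D H`. Since `η ≤ H`, a weighted
  -- gradient above `α₀ H ^ q` forces the gradient itself above `α₀`.
  obtain ⟨α₀, hα₀⟩ : ∃ α₀, α₀ = D * H * (K₁ + K₂) / q + D * H * K₂ / (speedExp γ / 2 - q) :=
    ⟨_, rfl⟩
  have hα₀0 : 0 ≤ α₀ := by rw [hα₀]; positivity
  refine ⟨max N (α₀ * H ^ q), ?_⟩
  intro m m' t₁ u ux ut η ηx ηt hm hf hηH hinit t₀ ht₀ ht₀₁ x₀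
  have hk := hm.k_pos
  have hhi := hm.hi_pos
  have hν := hm.one_lt_speedExp
  obtain ⟨L, hLd⟩ : ∃ L, L = k * hi * H ^ speedExp γ := ⟨_, rfl⟩
  have hL : 0 ≤ L := by rw [hLd]; positivity
  have hsub := triangle_subset_slab (L := L) (x₀ := x₀) ht₀₁.le
  have hmem : ∀ p ∈ triangle L x₀ t₀, p.2 ∈ Icc 0 t₁ := fun p hp => mem_slab.1 (hsub hp)
  let h : ℕ → ℝ := fun n => (t₁ - t₀) * (1 / ((n : ℝ) + 1))
  have hpos : ∀ n, 0 < h n := fun n => mul_pos (by linarith) (by positivity)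
  have hle : ∀ n, t₀ + h n ≤ t₁ := fun n => by
    have : (1 / ((n : ℝ) + 1)) ≤ 1 := by
      rw [div_le_one (by positivity)]
      have : (0 : ℝ) ≤ n := Nat.cast_nonneg n
      linarith
    have : h n ≤ (t₁ - t₀) * 1 := mul_le_mul_of_nonneg_left this (by linarith)
    linarith
  have hlim : Tendsto h atTop (𝓝 0) := by
    have := (tendsto_one_div_add_atTop_nhds_zero_nat (𝕜 := ℝ)).const_mul (t₁ - t₀)
    rwa [mul_zero] at this
  have hmem' : ∀ n, ∀ p ∈ triangle L x₀ t₀, p.2 + h n ∈ Icc 0 t₁ := fun n p hp =>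
    ⟨add_nonneg hp.1 (hpos n).le, by have := hle n; have := hp.2.1; linarith⟩
  have hω := hf.weight_partials hm q
  have hb := hf.slowness_partials hm
  have hs := fun b => hf.riemann_partials hm (sgn b)
  let c : ℝ → ℝ → ℝ := fun x t => soundSpeed γ k (m x) (η x t)
  let sl : ℝ → ℝ → ℝ := fun x t => (soundSpeed γ k (m x) (η x t))⁻¹
  let st : Bool → ℝ → ℝ → ℝ := fun b x t => ut x t + sgn b * (m x * ηt x t)
  let ωx : ℝ → ℝ → ℝ := fun x t => -(k * m' x) / (k * m x) ^ 2 * η x t ^ (q - speedExp γ) +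
        (k * m x)⁻¹ * ((q - speedExp γ) * η x t ^ (q - speedExp γ - 1) * ηx x t)
  let ωt : ℝ → ℝ → ℝ := fun x t =>
    (k * m x)⁻¹ * ((q - speedExp γ) * η x t ^ (q - speedExp γ - 1) * ηt x t)
  let bt : ℝ → ℝ → ℝ := fun x t => -(soundSpeed γ k (m x) (η x t) ^ 2)⁻¹ *
        (k * m x * (speedExp γ * η x t ^ (speedExp γ - 1) * ηt x t))
  let ω := weight γ k q m η
  let s : Bool → ℝ → ℝ → ℝ := fun b => riemann (sgn b) m u η
  let v : Bool → ℝ × ℝ → ℝ := fun b p => sgn b * c p.1 p.2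
  let f : ℕ → Bool → ℝ × ℝ → ℝ := fun n b p =>
    -sgn b * (ω p.1 p.2 * timeQuot (h n) (s b) p.1 p.2)
  let R : ℕ → Bool → ℝ × ℝ → ℝ := fun n b p =>
    -sgn b * ((ωt p.1 p.2 + sgn b * c p.1 p.2 * ωx p.1 p.2) * timeQuot (h n) (s b) p.1 p.2 +
      ω p.1 p.2 * c p.1 p.2 * (m' p.1 * timeQuot (h n) η p.1 p.2 / γ -
        st b p.1 (p.2 + h n) * timeQuot (h n) sl p.1 p.2))
  let F : Bool → ℝ × ℝ → ℝ := fun b p => -sgn b * (ω p.1 p.2 * st b p.1 p.2)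
  let G : Bool → ℝ × ℝ → ℝ := fun b p =>
    -sgn b * ((ωt p.1 p.2 + sgn b * c p.1 p.2 * ωx p.1 p.2) * st b p.1 p.2 +
      ω p.1 p.2 * c p.1 p.2 * (m' p.1 * ηt p.1 p.2 / γ - st b p.1 p.2 * bt p.1 p.2))
  -- The weight `ω` is `η ^ q / c`, so `-σ ω` times the time derivative of the Riemann variable is
  -- `η ^ q` times the gradient.
  have hFeq : ∀ b, ∀ p ∈ triangle L x₀ t₀,
      F b p = η p.1 p.2 ^ q * gradVar γ (sgn b) m m' ux η ηx p.1 p.2 := by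
    intro b p hp
    have hη := hf.pos p.1 p.2 (hmem p hp)
    have hmp := (hm.pos p.1).ne'
    have hN := (Real.rpow_pos_of_pos hη (speedExp γ)).ne'
    simp only [F, st, ω, weight]
    rw [hf.riemann_time_deriv (sgn_sq b) (hmem p hp), Real.rpow_sub hη, soundSpeed]
    field_simp
    linear_combination (gradVar γ (sgn b) m m' ux η ηx p.1 p.2) * sgn_sq b
  have main := max_principle (ι := Bool) (M := max N (α₀ * H ^ q)) hL (f := f) (R := R)
    (F := F) (G := G) (v := v) (x₀ := x₀) (t₀ := t₀) ?_ ?_ ?_ ?_ ?_ ?_ ?_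
  · intro b
    have hp := apex_mem_triangle (L := L) (x₀ := x₀) ht₀
    rw [← hFeq b _ hp]
    exact main b _ hp
  · intro b p hp
    simp only [v, c]
    rw [abs_mul, abs_sgn, one_mul, abs_of_pos (hm.soundSpeed_pos _ (hf.pos _ _ (hmem p hp))), hLd]
    exact hm.soundSpeed_le _ (hf.pos _ _ (hmem p hp)).le (hηH _ _ (hmem p hp))
  · intro n b
    refine continuousOn_const.mul ((hω.cont.mono hsub).mul (ContinuousOn.div_const
      (ContinuousOn.sub ?_ ((hs b).cont.mono hsub)) _))
    exact (hs b).cont.comp (f := fun p : ℝ × ℝ => (p.1, p.2 + h n)) (by fun_prop)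
      (fun p hp => mem_slab.2 (hmem' n p hp))
  · intro n b p hp hp0
    have d1 := hω.backward (x := p.1) (v := v b p) (hmem p hp)
    have d2 := (hs b).backward (x := p.1) (v := v b p) (hmem p hp)
    have d3 : HasDerivWithinAt (fun e => s b (p.1 - v b p * e) (p.2 - e + h n)) _ (Icc 0 p.2) 0 :=
      (((hs b).backward (x := p.1) (v := v b p) (hmem' n p hp)).mono
        (Icc_subset_Icc le_rfl (by have := hpos n; linarith))).congr_of_eventuallyEq
        (Eventually.of_forall fun e => by simp only [s]; ring_nf) (by simp only [s]; ring_nf)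
    refine ((d1.mul ((d3.sub d2).div_const (h n))).const_mul (-sgn b)).congr_deriv ?_
    have t1 := hf.riemann_transport hm (sgn_sq b) (x := p.1) (hmem p hp)
    have t2 := hf.riemann_transport hm (sgn_sq b) (x := p.1) (hmem' n p hp)
    have hc1 := (hm.soundSpeed_pos p.1 (hf.pos p.1 _ (hmem p hp))).ne'
    have hc2 := (hm.soundSpeed_pos p.1 (hf.pos p.1 _ (hmem' n p hp))).ne'
    simp only [R, v, c, ω, st, sl, timeQuot, Pi.sub_apply, sub_zero, mul_zero, s, ωt, ωx]
    exact transport_quot hc1 hc2 t1 t2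
  · intro b p hp
    have hωc := ((hω.cont.mono hsub) p hp).tendsto.comp
      (tendsto_snd (f := (atTop : Filter ℕ)) (g := 𝓝[triangle L x₀ t₀] p))
    exact (hωc.mul ((hs b).tendsto_timeQuot hpos hle hlim hp)).const_mul (-sgn b)
  · intro b p hp
    have snd := tendsto_snd (f := (atTop : Filter ℕ)) (g := 𝓝[triangle L x₀ t₀] p)
    have c1 := ((hω.cont.mono hsub) p hp).tendsto.comp snd
    have c2 := ((hω.cont_x.mono hsub) p hp).tendsto.comp snd
    have c3 := ((hω.cont_t.mono hsub) p hp).tendsto.comp snd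
    have c4 := (((hf.speed_partials hm).cont.mono hsub) p hp).tendsto.comp snd
    have c5 := ((hm.cont.comp continuous_fst).continuousOn (s := triangle L x₀ t₀) p hp).tendsto.comp
      snd
    have c6 := tendsto_shift (hs b).cont_t hpos hle hlim (τ := fun q => q.2.2 + h q.1)
      (fun n p _ => ⟨by have := hpos n; linarith, le_rfl⟩) hp
    have c7 := (hs b).tendsto_timeQuot hpos hle hlim hp
    have c8 := hf.η_partials.tendsto_timeQuot hpos hle hlim hp
    have c9 := hb.tendsto_timeQuot hpos hle hlim hp
    exact (((c3.add ((c4.const_mul (sgn b)).mul c2)).mul c7).add ((c1.mul c4).mul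
      (((c5.mul c8).div_const γ).sub (c6.mul c9)))).const_mul (-sgn b)
  · intro b p hp _ hbig hmax
    have hη := hf.pos p.1 p.2 (hmem p hp)
    have hηle := hηH p.1 p.2 (hmem p hp)
    have hW := Real.rpow_pos_of_pos hη q
    have hN := Real.rpow_pos_of_pos hη (speedExp γ)
    obtain ⟨α, hα⟩ : ∃ α, α = gradVar γ (sgn b) m m' ux η ηx p.1 p.2 := ⟨_, rfl⟩
    obtain ⟨β, hβ⟩ : ∃ β, β = gradVar γ (sgn (!b)) m m' ux η ηx p.1 p.2 := ⟨_, rfl⟩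
    have hβα : β ≤ α := by
      have := hmax (!b)
      rw [hFeq _ p hp, hFeq _ p hp, ← hα, ← hβ] at this
      exact le_of_mul_le_mul_left this hW
    have hαbig : α₀ < α := by
      rw [hFeq _ p hp, ← hα] at hbig
      have h1 : α₀ * H ^ q < η p.1 p.2 ^ q * α := (le_max_right _ _).trans_lt hbig
      have h2 : η p.1 p.2 ^ q ≤ H ^ q := Real.rpow_le_rpow hη.le hηle hq.le
      by_contra! hcon
      have h3 : η p.1 p.2 ^ q * α ≤ η p.1 p.2 ^ q * α₀ := by gcongr
      have h4 : η p.1 p.2 ^ q * α₀ ≤ H ^ q * α₀ := by gcongr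
      linarith
    have hα0 : 0 < α := hα₀0.trans_lt hαbig
    have hGeq : G b p = η p.1 p.2 ^ q * (k * η p.1 p.2 ^ speedExp γ / η p.1 p.2) *
        (-(speedExp γ / 2) * α ^ 2 + (speedExp γ / 2 - q) * α * β + sgn b * (m' p.1 * η p.1 p.2) *
        ((3 / (2 * γ) - q * ((γ - 1) / γ)) * α + K₂ * β)) := by
      have hneg : sgn (!b) = -sgn b := by cases b <;> simp
      have := riccati_identity (σ := sgn b) (q := q) (m' := m' p.1) (W := η p.1 p.2 ^ q)
        (ux := ux p.1 p.2) (ηx := ηx p.1 p.2) (y := m p.1 * ηx p.1 p.2 + (γ - 1) / γ * m' p.1 * η p.1 p.2)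
        (abs_sgn b) hγ hk.ne' (hm.pos p.1).ne' hN.ne' hη.ne' rfl
      rw [hα, hβ, hK₂, gradVar, gradVar, hneg, one_div_mul_eq_div]
      rw [← this]
      simp only [G, ωt, ωx, c, st, bt, ω, weight]
      rw [hf.riemann_time_deriv (sgn_sq b) (hmem p hp), hf.mass _ _ (hmem p hp), gradVar, soundSpeed,
        Real.rpow_sub_one hη.ne', Real.rpow_sub_one hη.ne', Real.rpow_sub hη]
    rw [hGeq]
    refine mul_neg_of_pos_of_neg (by positivity) ?_
    have hα1 : D * H * (K₁ + K₂) / q < α := lt_of_le_of_lt (by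
      rw [hα₀]; have : 0 ≤ D * H * K₂ / (speedExp γ / 2 - q) := by positivity
      linarith) hαbig
    have hα2 : D * H * K₂ / (speedExp γ / 2 - q) ≤ α := le_trans (by
      rw [hα₀]; have : 0 ≤ D * H * (K₁ + K₂) / q := by positivity
      linarith) hαbig.le
    refine riccati_neg (P := D * H) (K₁ := K₁) hqν hβα hα0 (by positivity) ?_ ?_ hK₂0.le ?_ ?_
    · rw [abs_mul, abs_sgn, one_mul, abs_mul, abs_of_pos hη]
      have := hm.deriv_le p.1
      gcongr
    · have h1 : 0 ≤ q * ((γ - 1) / γ) := by positivity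
      have h2 : 0 < 3 / (2 * γ) := by positivity
      rw [hK₁]
      exact abs_le.2 ⟨by linarith, by linarith⟩
    · rw [div_lt_iff₀ hq] at hα1; linarith
    · rw [div_le_iff₀ hgap] at hα2; linarith
  · intro b p hp h0
    rw [hFeq b p hp, h0]
    exact (hinit p.1 b).trans (le_max_left _ _)

/-! ### Finite variation of the entropy and the uniform density bound -/

/-- The total variation of a `C¹` function controls the integral of the absolute value of its
derivative. -/
theorem integral_abs_deriv_le {S S' : ℝ → ℝ} (hS : ∀ x, HasDerivAt S (S' x) x)
    (hc : Continuous S') (hbv : BoundedVariationOn S univ) {a b : ℝ} (hab : a ≤ b) :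
    ∫ x in a..b, |S' x| ≤ 2 * (eVariationOn S univ).toReal := by
  have hloc := hbv.locallyBoundedVariationOn
  obtain ⟨W, hW⟩ : ∃ W : ℝ → ℝ, W = variationOnFromTo S univ 0 := ⟨_, rfl⟩
  have hmono : Monotone W := by
    rw [hW, ← monotoneOn_univ]
    exact variationOnFromTo.monotoneOn hloc (mem_univ _)
  have hle : ∀ x y, x ≤ y → |S y - S x| ≤ W y - W x := by
    intro x y hxy
    rw [hW]
    exact variationOnFromTo.abs_sub_le_sub_of_le hloc (mem_univ _) (mem_univ _) (mem_univ _) hxy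
  have habs : ∀ x, |W x| ≤ (eVariationOn S univ).toReal := fun x => by
    rw [hW]; exact variationOnFromTo.abs_le_eVariationOn hbv
  -- The variation function `W` is monotone, hence differentiable almost everywhere, and its slopes
  -- dominate those of `S` in absolute value. The factor `2` arises because `|W|` is bounded by the
  -- variation at each endpoint.
  have hae : ∀ᵐ x, |S' x| ≤ deriv W x := by
    filter_upwards [hmono.ae_differentiableAt] with x hx
    have h1 := (hasDerivAt_iff_tendsto_slope.1 (hS x)).abs
    have h2 := hasDerivAt_iff_tendsto_slope.1 hx.hasDerivAt
    refine le_of_tendsto_of_tendsto h1 h2 (Eventually.of_forall fun y => ?_)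
    simp only [slope_def_field]
    rcases lt_trichotomy x y with h | rfl | h
    · rw [abs_div, abs_of_pos (sub_pos.2 h)]
      exact div_le_div_of_nonneg_right (hle x y h.le) (sub_pos.2 h).le
    · simp
    · rw [abs_div, abs_of_neg (sub_neg.2 h), abs_sub_comm, ← neg_sub (W x), neg_div,
        ← div_neg]
      exact div_le_div_of_nonneg_right (hle y x h.le) (by linarith)
  have hWi := (hmono.monotoneOn (uIcc a b)).intervalIntegrable_deriv
  have h1 : ∫ x in a..b, |S' x| ≤ ∫ x in a..b, deriv W x :=
    intervalIntegral.integral_mono_ae hab (hc.abs.intervalIntegrable a b) hWi hae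
  have h2 := (hmono.monotoneOn (uIcc a b)).intervalIntegral_deriv_mem_uIcc
  rw [uIcc_of_le (sub_nonneg.2 (hmono hab))] at h2
  have h3 := abs_le.1 (habs a)
  have h4 := abs_le.1 (habs b)
  linarith [h2.2]

/-- Provides the potential `V` of the weight `exp (Λ V)`. Adding the bound `R` to the primitive
makes it nonnegative, so the weight is at least `1`. -/
theorem exists_bounded_primitive {S S' g : ℝ → ℝ} {C : ℝ} (hS : ∀ x, HasDerivAt S (S' x) x)
    (hc : Continuous S') (hbv : BoundedVariationOn S univ) (hg : Continuous g)
    (hg0 : ∀ x, 0 ≤ g x) (hgC : ∀ x, g x ≤ C * |S' x|) (hC : 0 ≤ C) :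
    ∃ (V : ℝ → ℝ) (Vmax : ℝ), (∀ x, HasDerivAt V (g x) x) ∧ (∀ x, 0 ≤ V x) ∧ ∀ x, V x ≤ Vmax := by
  obtain ⟨R, hR⟩ : ∃ R, R = C * (2 * (eVariationOn S univ).toReal) := ⟨_, rfl⟩
  have key : ∀ a b : ℝ, a ≤ b → (0 ≤ ∫ x in a..b, g x) ∧ ∫ x in a..b, g x ≤ R := by
    intro a b hab
    refine ⟨intervalIntegral.integral_nonneg hab fun x _ => hg0 x, ?_⟩
    calc ∫ x in a..b, g x ≤ ∫ x in a..b, C * |S' x| :=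
          intervalIntegral.integral_mono_on hab (hg.intervalIntegrable a b)
            ((hc.abs.intervalIntegrable a b).const_mul C) fun x _ => hgC x
      _ = C * ∫ x in a..b, |S' x| := intervalIntegral.integral_const_mul _ _
      _ ≤ R := by rw [hR]; exact mul_le_mul_of_nonneg_left (integral_abs_deriv_le hS hc hbv hab) hC
  have hR0 : 0 ≤ R := (key 0 0 le_rfl).1.trans (key 0 0 le_rfl).2
  have key' : ∀ x, -R ≤ ∫ y in (0 : ℝ)..x, g y ∧ ∫ y in (0 : ℝ)..x, g y ≤ R := by
    intro x
    rcases le_total 0 x with h | h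
    · exact ⟨by linarith [(key 0 x h).1], (key 0 x h).2⟩
    · rw [intervalIntegral.integral_symm]
      exact ⟨by linarith [(key x 0 h).2], by linarith [(key x 0 h).1]⟩
  refine ⟨fun x => (∫ y in (0 : ℝ)..x, g y) + R, 2 * R, fun x => ?_, fun x => ?_, fun x => ?_⟩
  · exact (intervalIntegral.integral_hasDerivAt_right (hg.intervalIntegrable 0 x)
      (hg.stronglyMeasurableAtFilter _ _) hg.continuousAt).add_const R
  · linarith [(key' x).1]
  · linarith [(key' x).2]

/-- All flows with given bounded initial data in a medium of finite variation share a bound for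
`η` which does not depend on the time of existence. -/
theorem exists_uniform_bound {γ k lo hi D M Vmax : ℝ} {m m' V u₀ η₀ : ℝ → ℝ}
    (hm : Medium γ k lo hi D m m') (hV : ∀ x, HasDerivAt V (|m' x| / γ) x) (hV0 : ∀ x, 0 ≤ V x)
    (hVmax : ∀ x, V x ≤ Vmax) (hM : 1 ≤ M) (hu₀ : ∀ x, |u₀ x| ≤ M) (hη₀ : ∀ x, η₀ x ≤ M) :
    ∃ H : ℝ, 0 < H ∧ ∀ {t₁ : ℝ} {u ux ut η ηx ηt : ℝ → ℝ → ℝ},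
      IsFlow γ k m m' t₁ u ux ut η ηx ηt → (∀ x, u x 0 = u₀ x) → (∀ x, η x 0 = η₀ x) →
      ∀ x, ∀ t ∈ Icc 0 t₁, η x t ≤ H := by
  obtain ⟨B, H, A, hB, hH, hA, hiter⟩ := exists_iterated_bound γ k lo hi D M Vmax hm.one_lt hm.k_pos
    hm.lo_pos ((hm.lo_le 0).trans (hm.le_hi 0)) hm.D_nonneg hM
  have hbd : ∀ {t₁ : ℝ} {u ux ut η ηx ηt : ℝ → ℝ → ℝ},
      IsFlow γ k m m' t₁ u ux ut η ηx ηt → (∀ x, u x 0 = u₀ x) → (∀ x, η x 0 = η₀ x) →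
      (∀ t ∈ Icc 0 t₁, ∀ x, η x t ≤ A * (1 + t)) ∧
      ∀ (n : ℕ) (t₀ : ℝ), 0 ≤ t₀ → B ^ n * (1 + t₀) ≤ t₁ → ∀ x,
        η x t₀ ≤ H + (1 / 2) ^ n * (A * (1 + t₀)) := fun hf hu hη =>
    hiter hm hf hV hV0 hVmax (fun x => by rw [hu]; exact hu₀ x) (fun x => by rw [hη]; exact hη₀ x)
  -- The alternative concerns all solutions with these data at once, so the resulting bound does not
  -- depend on the lifespan of any one of them.
  by_cases hT : ∃ T₁, ∀ (t₁ : ℝ) (u ux ut η ηx ηt : ℝ → ℝ → ℝ),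
      IsFlow γ k m m' t₁ u ux ut η ηx ηt → (∀ x, u x 0 = u₀ x) → (∀ x, η x 0 = η₀ x) → t₁ ≤ T₁
  · obtain ⟨T₁, hT₁⟩ := hT
    refine ⟨A * (1 + max T₁ 0) + 1, by positivity, fun {t₁ u ux ut η ηx ηt} hf hu hη x t ht => ?_⟩
    have h1 := (hbd hf hu hη).1 t ht x
    have h2 : t ≤ max T₁ 0 := (ht.2.trans (hT₁ _ _ _ _ _ _ _ hf hu hη)).trans (le_max_left _ _)
    have h3 : A * (1 + t) ≤ A * (1 + max T₁ 0) := by gcongr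
    linarith
  · push Not at hT
    refine ⟨H + 1, by linarith, fun {t₁ u ux ut η ηx ηt} hf hu hη x t ht => ?_⟩
    have main : ∀ n : ℕ, η x t ≤ H + (1 / 2) ^ n * (A * (1 + t)) := by
      intro n
      obtain ⟨t₂, w, wx, wt, θ, θx, θt, hg, hw, hθ, ht₂⟩ := hT (B ^ n * (1 + t))
      have hBn : 1 ≤ B ^ n := one_le_pow₀ hB
      have htt : t ≤ t₂ := by nlinarith [ht.1]
      -- The given flow may be short-lived; uniqueness moves the question to a flow lasting long
      -- enough for `n` iterations. The linear bound supplies the speed limit that uniqueness needs.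
      have heq := (hf.mono ht.2).unique hm (hg.mono htt) (fun x => by rw [hu, hw])
        (fun x => by rw [hη, hθ]) (L := k * hi * (A * (1 + t)) ^ speedExp γ)
        (by have := hm.k_pos; have := hm.hi_pos; have := ht.1; positivity)
        (fun y s hs => hm.soundSpeed_le y (hf.pos y s ⟨hs.1, hs.2.trans ht.2⟩).le
          (((hbd hf hu hη).1 s ⟨hs.1, hs.2.trans ht.2⟩ y).trans
            (mul_le_mul_of_nonneg_left (by linarith [hs.2]) hA))) x t ⟨ht.1, le_rfl⟩
      rw [heq.2]
      exact (hbd hg hw hθ).2 n t ht.1 ht₂.le x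
    have hlim : Tendsto (fun n : ℕ => H + (1 / 2 : ℝ) ^ n * (A * (1 + t))) atTop (𝓝 H) := by
      simpa using ((tendsto_pow_atTop_nhds_zero_of_lt_one (by norm_num : (0 : ℝ) ≤ 1 / 2)
        (by norm_num)).mul_const (A * (1 + t))).const_add H
    linarith [ge_of_tendsto' hlim main]

open FullEuler

/-! ### From the Euler equations to flows in a stationary medium -/

theorem Icc_subset_times {T : EReal} {t₁ : ℝ} (ht₁ : t₁ ∈ times T) : Icc 0 t₁ ⊆ times T :=
  fun _ ht => ⟨ht.1, (EReal.coe_le_coe_iff.2 ht.2).trans_lt ht₁.2⟩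

theorem exists_gt_mem_times {T : EReal} {t : ℝ} (ht : t ∈ times T) : ∃ t₁ ∈ times T, t < t₁ := by
  obtain ⟨r, h1, h2⟩ := EReal.lt_iff_exists_real_btwn.1 ht.2
  have h3 := EReal.coe_lt_coe_iff.1 h1
  exact ⟨r, ⟨ht.1.trans h3.le, h2⟩, h3⟩

theorem zero_mem_times {T : EReal} (hT : 0 < T) : (0 : ℝ) ∈ times T := ⟨le_rfl, hT⟩

theorem uniqueDiffOn_times {T : EReal} (hT : 0 < T) : UniqueDiffOn ℝ (times T) := by
  have hord : OrdConnected (times T) :=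
    ⟨fun a ha b hb c hc => Icc_subset_times hb ⟨ha.1.trans hc.1, hc.2⟩⟩
  obtain ⟨t₁, ht₁, hlt⟩ := exists_gt_mem_times (zero_mem_times hT)
  refine uniqueDiffOn_convex hord.convex ⟨t₁ / 2, mem_interior_iff_mem_nhds.2 ?_⟩
  exact mem_of_superset (Icc_mem_nhds (by linarith) (by linarith)) (Icc_subset_times ht₁)

theorem hasPartials_of_contDiffOn {T : EReal} (hT : 0 < T) {f : ℝ → ℝ → ℝ}
    (hf : ContDiffOn ℝ 1 (uncurry f) (univ ×ˢ times T)) {t₁ : ℝ} (ht₁ : t₁ ∈ times T) :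
    HasPartials t₁ f (partialX f) (partialT T f) := by
  have huniq : UniqueDiffOn ℝ (univ ×ˢ times T : Set (ℝ × ℝ)) :=
    uniqueDiffOn_univ.prod (uniqueDiffOn_times hT)
  obtain ⟨A, hA⟩ : ∃ A, A = fderivWithin ℝ (uncurry f) (univ ×ˢ times T) := ⟨_, rfl⟩
  have hAc : ContinuousOn A (univ ×ˢ times T) := by
    rw [hA]; exact hf.continuousOn_fderivWithin huniq le_rfl
  have hAd : ∀ x, ∀ t ∈ times T, HasFDerivWithinAt (uncurry f) (A (x, t)) (univ ×ˢ times T) (x, t) := by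
    intro x t ht
    rw [hA]
    exact (hf.differentiableOn one_ne_zero (x, t) ⟨mem_univ _, ht⟩).hasFDerivWithinAt
  have hsub : slab t₁ ⊆ univ ×ˢ times T := prod_mono Subset.rfl (Icc_subset_times ht₁)
  have hX : ∀ x, ∀ t ∈ times T, partialX f x t = A (x, t) (1, 0) := by
    intro x t ht
    have h := (hAd x t ht).comp_hasDerivWithinAt (f := fun y => (y, t)) (s := univ) x
      ((hasDerivWithinAt_id x univ).prodMk (hasDerivWithinAt_const x univ t))
      (fun y _ => ⟨mem_univ _, ht⟩)
    exact (hasDerivWithinAt_univ.1 h).deriv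
  have hTm : ∀ x, ∀ t ∈ times T, partialT T f x t = A (x, t) (0, 1) := by
    intro x t ht
    have h := (hAd x t ht).comp_hasDerivWithinAt (f := fun s => (x, s)) (s := times T) t
      ((hasDerivWithinAt_const t (times T) x).prodMk (hasDerivWithinAt_id t (times T)))
      (fun s hs => ⟨mem_univ _, hs⟩)
    exact h.derivWithin (uniqueDiffOn_times hT t ht)
  refine ⟨?_, ?_, ?_⟩
  · refine (((hAc.mono hsub).clm_apply continuousOn_const) :
      ContinuousOn (fun p => A p ((1 : ℝ), (0 : ℝ))) (slab t₁)).congr ?_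
    rintro ⟨x, t⟩ h
    exact hX x t (hsub h).2
  · refine (((hAc.mono hsub).clm_apply continuousOn_const) :
      ContinuousOn (fun p => A p ((0 : ℝ), (1 : ℝ))) (slab t₁)).congr ?_
    rintro ⟨x, t⟩ h
    exact hTm x t (hsub h).2
  · intro x t h
    have ht := Icc_subset_times ht₁ h
    refine ((hAd x t ht).mono hsub).congr_fderiv ?_
    rw [hX x t ht, hTm x t ht]
    ext <;> simp

theorem HasPartials.partialX_eq {t₁ : ℝ} {f fx ft : ℝ → ℝ → ℝ} (hf : HasPartials t₁ f fx ft)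
    {x t : ℝ} (ht : t ∈ Icc 0 t₁) : partialX f x t = fx x t :=
  (hf.deriv_x ht).deriv

/-- The strict inequality `t < t₁` makes `[0, t₁]` a neighbourhood of `t` within the full time
interval, so the two one-sided notions of derivative agree. -/
theorem HasPartials.partialT_eq {T : EReal} (hT : 0 < T) {t₁ : ℝ} {f fx ft : ℝ → ℝ → ℝ}
    (hf : HasPartials t₁ f fx ft) {x t : ℝ} (ht : t ∈ times T) (htt : t < t₁) :
    partialT T f x t = ft x t := by
  have h : HasDerivWithinAt (fun s => f x s) (ft x t) (times T) t :=
    (hf.deriv_t (x := x) ⟨ht.1, htt.le⟩).mono_of_mem_nhdsWithin (by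
      filter_upwards [self_mem_nhdsWithin, mem_nhdsWithin_of_mem_nhds (Iio_mem_nhds htt)] with s h1 h2
      exact ⟨(show s ∈ times T from h1).1, le_of_lt h2⟩)
  exact h.derivWithin (uniqueDiffOn_times hT t ht)

section

variable {K cv γ : ℝ} {T : EReal} {u τ S : ℝ → ℝ → ℝ}

theorem hasPartials_pressure (h : IsC1Solution K cv γ T u τ S) (hT : 0 < T) {t₁ : ℝ}
    (ht₁ : t₁ ∈ times T) :
    HasPartials t₁ (fun x t => pressure K cv γ (τ x t) (S x t))
      (fun x t => pressure K cv γ (τ x t) (S x t) *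
        (partialX S x t / cv - γ * (partialX τ x t / τ x t)))
      (fun x t => pressure K cv γ (τ x t) (S x t) *
        (partialT T S x t / cv - γ * (partialT T τ x t / τ x t))) := by
  have hτ := hasPartials_of_contDiffOn hT h.contDiff_τ ht₁
  have hS := hasPartials_of_contDiffOn hT h.contDiff_S ht₁
  have hpos : ∀ x, ∀ t ∈ Icc 0 t₁, 0 < τ x t := fun x t ht =>
    h.τ_pos x t (Icc_subset_times ht₁ ht)
  have hexp := hS.comp (φ := fun y => K * Real.exp (y / cv))
    (φ' := fun y => K * (Real.exp (y / cv) * (1 / cv))) (s := univ) (fun _ _ _ => mem_univ _)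
    (fun y _ => (((hasDerivAt_id y).div_const cv).exp).const_mul K) (by fun_prop)
  refine (hexp.mul (hτ.rpow (-γ) hpos)).congr (fun x t ht => ?_) (fun x t ht => ?_)
  all_goals
    have := hpos x t ht
    rw [pressure, Real.rpow_sub_one this.ne']
    field_simp
    ring

/-- Energy minus `u` times momentum plus `p` times mass leaves `p τ S_t / (c_v (γ - 1)) = 0`. -/
theorem entropy_const (hK : 0 < K) (hcv : 0 < cv) (hγ : 1 < γ) (h : IsC1Solution K cv γ T u τ S)
    (hT : 0 < T) {t : ℝ} (ht : t ∈ times T) (x : ℝ) : S x t = S x 0 := by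
  obtain ⟨t₁, ht₁, htt⟩ := exists_gt_mem_times ht
  have hτ := hasPartials_of_contDiffOn hT h.contDiff_τ ht₁
  have hS := hasPartials_of_contDiffOn hT h.contDiff_S ht₁
  have hu := hasPartials_of_contDiffOn hT h.contDiff_u ht₁
  have hp := hasPartials_pressure h hT ht₁
  have he : HasPartials t₁ (fun x t => internalEnergy K cv γ (τ x t) (S x t)) _ _ :=
    ((hp.mul hτ).const_mul (1 / (γ - 1))) |> fun h => by
      simpa only [internalEnergy, one_div, inv_mul_eq_div] using h
  have hE := ((hu.mul hu).const_mul (1 / 2)).add he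
  have hE' := hE
  simp only [← sq] at hE'
  have hup := hu.mul hp
  have hSt : ∀ s ∈ Ico 0 t₁, partialT T S x s = 0 := by
    intro s hs
    have hsI := Ico_subset_Icc_self hs
    have hsT := Icc_subset_times ht₁ hsI
    have hpos := h.τ_pos x s hsT
    have e1 := h.mass x s hsT
    have e2 := h.momentum x s hsT
    have e3 := h.energy x s hsT
    rw [hp.partialX_eq hsI] at e2
    rw [hE'.partialT_eq hT hsT hs.2, hup.partialX_eq hsI] at e3
    have hpp : 0 < pressure K cv γ (τ x s) (S x s) := by unfold pressure; positivity
    have hγ1 : γ - 1 ≠ 0 := by linarith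
    generalize pressure K cv γ (τ x s) (S x s) = P at *
    have e4 : P * τ x s * partialT T S x s = 0 := by
      linear_combination (norm := (field_simp; ring)) cv * (γ - 1) * (e3 - u x s * e2 + P * e1)
    have := mul_pos hpp hpos
    exact (mul_eq_zero.1 e4).resolve_left this.ne'
  have hcont : ContinuousOn (fun s => S x s) (Icc 0 t₁) := fun s hs =>
    (hS.deriv_t hs).continuousWithinAt
  refine constant_of_has_deriv_right_zero hcont (fun s hs => ?_) t ⟨ht.1, htt.le⟩
  have := hS.deriv_t (x := x) (Ico_subset_Icc_self hs)
  rw [hSt s hs] at this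
  exact this.mono_of_mem_nhdsWithin (Icc_mem_nhdsGE_of_mem hs)

end

/-- The factor `κ` in `η = κ τ ^ (-(γ - 1) / 2)`. -/
noncomputable def etaScale (K γ : ℝ) : ℝ := 2 * Real.sqrt (K * γ) / (γ - 1)

/-- The factor `k` in `c = k m η ^ ν`. -/
noncomputable def speedScale (K γ : ℝ) : ℝ :=
  Real.sqrt (K * γ) * etaScale K γ ^ (-speedExp γ)

section

variable {K cv γ : ℝ}

theorem etaScale_pos (hK : 0 < K) (hγ : 1 < γ) : 0 < etaScale K γ := by
  have : 0 < γ - 1 := by linarith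
  have : 0 < γ := by linarith
  unfold etaScale
  positivity

theorem speedScale_pos (hK : 0 < K) (hγ : 1 < γ) : 0 < speedScale K γ := by
  have := etaScale_pos hK hγ
  have : 0 < γ := by linarith
  unfold speedScale
  positivity

theorem etaVar_pos (hK : 0 < K) (hγ : 1 < γ) {τ : ℝ} (hτ : 0 < τ) : 0 < etaVar K γ τ :=
  mul_pos (etaScale_pos hK hγ) (Real.rpow_pos_of_pos hτ _)

/-- The exponents multiply to `-(γ + 1) / 2`, so `k m η ^ ν` is the usual Lagrangian sound speed `m
√(K γ) τ ^ (-(γ + 1) / 2)`. -/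
theorem speedScale_mul_rpow (hK : 0 < K) (hγ : 1 < γ) {τ : ℝ} (hτ : 0 < τ) :
    speedScale K γ * etaVar K γ τ ^ speedExp γ =
      Real.sqrt (K * γ) * (τ ^ (-((γ - 1) / 2)) / τ) := by
  have hκ := etaScale_pos hK hγ
  have h1 : etaVar K γ τ = etaScale K γ * τ ^ (-((γ - 1) / 2)) := rfl
  have h2 : -((γ - 1) / 2) * speedExp γ = -((γ - 1) / 2) - 1 := by
    have : γ - 1 ≠ 0 := by linarith
    rw [speedExp]
    field_simp
    ring
  rw [h1, Real.mul_rpow hκ.le (Real.rpow_nonneg hτ.le _), ← Real.rpow_mul hτ.le, h2,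
    Real.rpow_sub_one hτ.ne', speedScale, Real.rpow_neg hκ.le]
  have := (Real.rpow_pos_of_pos hκ (speedExp γ)).ne'
  field_simp

theorem mVar_sq (cv S : ℝ) : Real.exp (S / cv) = mVar cv S ^ 2 := by
  rw [mVar, ← Real.exp_nat_mul]
  congr 1
  rcases eq_or_ne cv 0 with rfl | h
  · simp
  · push_cast
    field_simp

theorem etaVar_rpow (hK : 0 < K) (hγ : 1 < γ) {τ : ℝ} (hτ : 0 < τ) (ε : ℝ) :
    etaVar K γ τ ^ (2 * ε / (γ - 1)) = etaScale K γ ^ (2 * ε / (γ - 1)) * (1 / τ) ^ ε := by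
  have hκ := etaScale_pos hK hγ
  have h1 : etaVar K γ τ = etaScale K γ * τ ^ (-((γ - 1) / 2)) := rfl
  have h2 : -((γ - 1) / 2) * (2 * ε / (γ - 1)) = -ε := by
    have : γ - 1 ≠ 0 := by linarith
    field_simp
  rw [h1, Real.mul_rpow hκ.le (Real.rpow_nonneg hτ.le _), ← Real.rpow_mul hτ.le, h2, one_div,
    Real.inv_rpow hτ.le, Real.rpow_neg hτ.le]

theorem etaVar_le (hK : 0 < K) (hγ : 1 < γ) {τ C : ℝ} (hτ : 0 < τ) (hC : |1 / τ| ≤ C) :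
    etaVar K γ τ ≤ etaScale K γ * C ^ ((γ - 1) / 2) := by
  have h1 : τ ^ (-((γ - 1) / 2)) = (1 / τ) ^ ((γ - 1) / 2) := by
    rw [one_div, Real.inv_rpow hτ.le, Real.rpow_neg hτ.le]
  have h2 : 0 ≤ (γ - 1) / 2 := by linarith
  have h3 : 1 / τ ≤ C := (le_abs_self _).trans hC
  have := etaScale_pos hK hγ
  change etaScale K γ * τ ^ (-((γ - 1) / 2)) ≤ _
  rw [h1]
  gcongr

/-- The derivative of `m` along the entropy profile. -/
noncomputable def mDeriv (cv : ℝ) (S₀ : ℝ → ℝ) (x : ℝ) : ℝ :=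
  mVar cv (S₀ x) * (deriv S₀ x / (2 * cv))

theorem hasDerivAt_mVar {S₀ : ℝ → ℝ} {x : ℝ} (h : DifferentiableAt ℝ S₀ x) :
    HasDerivAt (fun y => mVar cv (S₀ y)) (mDeriv cv S₀ x) x :=
  (h.hasDerivAt.div_const (2 * cv)).exp

variable {T : EReal} {u τ S : ℝ → ℝ → ℝ}

/-- The `x`- or `t`-derivative of `η` in terms of that of `τ`. -/
noncomputable def etaDeriv (K γ : ℝ) (τ τ' : ℝ → ℝ → ℝ) (x t : ℝ) : ℝ :=
  etaScale K γ * (-((γ - 1) / 2) * τ x t ^ (-((γ - 1) / 2) - 1) * τ' x t)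

theorem etaDeriv_eq (hγ : 1 < γ) {τ τ' : ℝ → ℝ → ℝ} {x t : ℝ} (hτ : 0 < τ x t) :
    etaDeriv K γ τ τ' x t =
      -Real.sqrt (K * γ) * (τ x t ^ (-((γ - 1) / 2)) / τ x t) * τ' x t := by
  have : γ - 1 ≠ 0 := by linarith
  rw [etaDeriv, Real.rpow_sub_one hτ.ne', etaScale]
  field_simp

/-- Constancy of the entropy in time allows `m` to be read off from the initial profile; the chain
rule for `η(τ)` and `p(τ, S)` does the rest. -/
theorem isFlow_of_solution (hK : 0 < K) (hcv : 0 < cv) (hγ : 1 < γ)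
    (h : IsC1Solution K cv γ T u τ S) (hT : 0 < T) {t₁ : ℝ} (ht₁ : t₁ ∈ times T) :
    IsFlow γ (speedScale K γ) (fun x => mVar cv (S x 0)) (mDeriv cv fun x => S x 0) t₁
      u (partialX u) (partialT T u) (fun x t => etaVar K γ (τ x t))
      (etaDeriv K γ τ (partialX τ)) (etaDeriv K γ τ (partialT T τ)) := by
  have hτ := hasPartials_of_contDiffOn hT h.contDiff_τ ht₁
  have hu := hasPartials_of_contDiffOn hT h.contDiff_u ht₁
  have hsub := Icc_subset_times ht₁
  refine ⟨hu, (hτ.rpow _ fun x t ht => h.τ_pos x t (hsub ht)).const_mul (etaScale K γ),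
    fun x t ht => etaVar_pos hK hγ (h.τ_pos x t (hsub ht)), fun x t ht => ?_, fun x t ht => ?_⟩
  · have hpos := h.τ_pos x t (hsub ht)
    rw [etaDeriv_eq hγ hpos, speedScale_mul_rpow hK hγ hpos, sub_eq_zero.1 (h.mass x t (hsub ht))]
    ring
  · have hpos := h.τ_pos x t (hsub ht)
    have hmom := h.momentum x t (hsub ht)
    rw [(hasPartials_pressure h hT ht₁).partialX_eq ht] at hmom
    have hS : partialX S x t = deriv (fun y => S y 0) x := by
      unfold partialX
      congr 1
      funext y
      exact entropy_const hK hcv hγ h hT (hsub ht) y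
    have hr : Real.sqrt (K * γ) ^ 2 = K * γ :=
      Real.sq_sqrt (mul_nonneg hK.le (by linarith))
    -- Writes `τ ^ (-γ)` as `y ^ 2 / τ` with `y = τ ^ (-(γ - 1) / 2)`, so that a single real power
    -- remains and the identity becomes rational.
    have hτγ : τ x t ^ (-γ) = τ x t ^ (-((γ - 1) / 2)) * τ x t ^ (-((γ - 1) / 2)) / τ x t := by
      rw [← Real.rpow_add hpos, ← Real.rpow_sub_one hpos.ne']
      congr 1
      ring
    have hη : etaVar K γ (τ x t) =
        2 * Real.sqrt (K * γ) / (γ - 1) * τ x t ^ (-((γ - 1) / 2)) := rfl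
    rw [hS, pressure, entropy_const hK hcv hγ h hT (hsub ht) x, mVar_sq, hτγ] at hmom
    rw [soundSpeed, mul_right_comm, speedScale_mul_rpow hK hγ hpos, etaDeriv_eq hγ hpos, hη, mDeriv,
      eq_neg_of_add_eq_zero_left hmom]
    generalize Real.sqrt (K * γ) = r at *
    generalize τ x t ^ (-((γ - 1) / 2)) = y at *
    have hγ1 : γ - 1 ≠ 0 := by linarith
    have hγ0 : γ ≠ 0 := by linarith
    linear_combination (norm := (field_simp; ring)) (mVar cv (S x 0) ^ 2 * y ^ 2 / (τ x t * γ) *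
      (deriv (fun y => S y 0) x / cv - γ * (partialX τ x t / τ x t))) * hr

end

section

variable {K cv γ : ℝ} {T : EReal} {u τ S : ℝ → ℝ → ℝ} {u₀ τ₀ S₀ : ℝ → ℝ}

theorem entropy_contDiff (h : IsC1Solution K cv γ T u τ S) (hT : 0 < T) :
    (∀ x, HasDerivAt (fun y => S y 0) (deriv (fun y => S y 0) x) x) ∧
      Continuous (deriv fun y => S y 0) := by
  have hS := hasPartials_of_contDiffOn hT h.contDiff_S (zero_mem_times hT)
  have h0 : (0 : ℝ) ∈ Icc (0 : ℝ) 0 := ⟨le_rfl, le_rfl⟩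
  refine ⟨fun x => (hS.deriv_x h0).differentiableAt.hasDerivAt, ?_⟩
  exact hS.cont_x.comp_continuous (f := fun x : ℝ => (x, (0 : ℝ))) (by fun_prop)
    fun x => mem_slab.2 h0

/-- The entropy profile of admissible data defines a medium of finite variation. -/
theorem exists_medium (hK : 0 < K) (hcv : 0 < cv) (hγ : 1 < γ)
    (h₀ : AdmissibleData K cv γ u₀ τ₀ S₀) (hS : ∀ x, HasDerivAt S₀ (deriv S₀ x) x)
    (hc : Continuous (deriv S₀)) :
    ∃ (lo hi D Vmax : ℝ) (V : ℝ → ℝ),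
      Medium γ (speedScale K γ) lo hi D (fun x => mVar cv (S₀ x)) (mDeriv cv S₀) ∧
      (∀ x, HasDerivAt V (|mDeriv cv S₀ x| / γ) x) ∧ (∀ x, 0 ≤ V x) ∧ ∀ x, V x ≤ Vmax := by
  obtain ⟨C, hC⟩ := h₀.S_bdd
  obtain ⟨C', hC'⟩ := h₀.S_deriv_bdd
  have hSc : Continuous S₀ := continuous_iff_continuousAt.2 fun x => (hS x).continuousAt
  have hle : ∀ x, mVar cv (S₀ x) ≤ Real.exp (C / (2 * cv)) := fun x => by
    have := (le_abs_self _).trans (hC x)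
    unfold mVar
    gcongr
  have hmc : Continuous (mDeriv cv S₀) := by
    unfold mDeriv mVar
    fun_prop
  have hmD : ∀ x, |mDeriv cv S₀ x| ≤ Real.exp (C / (2 * cv)) / (2 * cv) * |deriv S₀ x| := by
    intro x
    have hp : 0 < mVar cv (S₀ x) := Real.exp_pos _
    rw [mDeriv, abs_mul, abs_of_pos hp, abs_div, abs_of_pos (by positivity : 0 < 2 * cv),
      div_mul_eq_mul_div, mul_div_assoc]
    have := hle x
    gcongr
  obtain ⟨V, Vmax, h1, h2, h3⟩ := exists_bounded_primitive (g := fun x => |mDeriv cv S₀ x| / γ)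
    (C := Real.exp (C / (2 * cv)) / (2 * cv) / γ) hS hc h₀.S_variation
    (hmc.abs.div_const γ) (fun x => by positivity)
    (fun x => by rw [div_mul_eq_mul_div]; have := hmD x; gcongr) (by positivity)
  refine ⟨Real.exp (-C / (2 * cv)), Real.exp (C / (2 * cv)),
    Real.exp (C / (2 * cv)) / (2 * cv) * C', Vmax, V, ?_, h1, h2, h3⟩
  exact {
    one_lt := hγ
    k_pos := speedScale_pos hK hγ
    lo_pos := Real.exp_pos _
    lo_le := fun x => by
      have := neg_le_of_abs_le (hC x)
      unfold mVar
      gcongr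
    le_hi := hle
    hasDeriv := fun x => hasDerivAt_mVar (hS x).differentiableAt
    cont := hmc
    deriv_le := fun x => (hmD x).trans (by have := hC' x; gcongr) }

theorem gradVar_init (hK : 0 < K) (hcv : 0 < cv) (hγ : 1 < γ)
    (h : IsC1Solution K cv γ T u τ S) (hT : 0 < T) (hu : ∀ x, u x 0 = u₀ x)
    (hτ : ∀ x, τ x 0 = τ₀ x) (hS : ∀ x, S x 0 = S₀ x) (x : ℝ) :
    gradVar γ (sgn true) (fun x => mVar cv (S x 0)) (mDeriv cv fun x => S x 0) (partialX u)
        (fun x t => etaVar K γ (τ x t)) (etaDeriv K γ τ (partialX τ)) x 0 =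
      alphaVar K cv γ u₀ τ₀ S₀ x ∧
    gradVar γ (sgn false) (fun x => mVar cv (S x 0)) (mDeriv cv fun x => S x 0) (partialX u)
        (fun x t => etaVar K γ (τ x t)) (etaDeriv K γ τ (partialX τ)) x 0 =
      betaVar K cv γ u₀ τ₀ S₀ x := by
  have h0 : (0 : ℝ) ∈ Icc (0 : ℝ) 0 := ⟨le_rfl, le_rfl⟩
  have hf := isFlow_of_solution hK hcv hγ h hT (zero_mem_times hT)
  obtain rfl : (fun x => u x 0) = u₀ := funext hu
  obtain rfl : (fun x => τ x 0) = τ₀ := funext hτ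
  obtain rfl : (fun x => S x 0) = S₀ := funext hS
  have e1 := (hf.η_partials.deriv_x (x := x) h0).deriv
  have e2 := (hasDerivAt_mVar (cv := cv) ((entropy_contDiff h hT).1 x).differentiableAt).deriv
  rw [alphaVar, betaVar, e1, e2, gradVar, gradVar, sgn_true, sgn_false, partialX]
  constructor <;> ring

/-! ### Integration in time and the lower bound for the density -/

/-- Integration of the upper bound for the weighted rate of expansion. -/
theorem rpow_le_of_deriv_le {f f' : ℝ → ℝ} {t ε N : ℝ} (ht : 0 ≤ t) (hε : ε < 1)
    (hf : ∀ s ∈ Icc 0 t, HasDerivWithinAt f (f' s) (Icc 0 t) s) (hpos : ∀ s ∈ Icc 0 t, 0 < f s)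
    (hN : ∀ s ∈ Icc 0 t, (1 / f s) ^ ε * f' s ≤ N) :
    f t ^ (1 - ε) ≤ f 0 ^ (1 - ε) + (1 - ε) * N * t := by
  have hd : ∀ s ∈ Icc 0 t, HasDerivWithinAt (fun s => f s ^ (1 - ε))
      (f' s * (1 - ε) * f s ^ (1 - ε - 1)) (Icc 0 t) s := fun s hs =>
    (hf s hs).rpow_const (Or.inl (hpos s hs).ne')
  have hB : ∀ s, HasDerivAt (fun s => f 0 ^ (1 - ε) + (1 - ε) * N * s) ((1 - ε) * N) s := fun s => by
    simpa using ((hasDerivAt_id s).const_mul ((1 - ε) * N)).const_add (f 0 ^ (1 - ε))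
  refine image_le_of_deriv_right_le_deriv_boundary (f := fun s => f s ^ (1 - ε))
    (f' := fun s => f' s * (1 - ε) * f s ^ (1 - ε - 1)) (a := 0) (b := t)
    (B := fun s => f 0 ^ (1 - ε) + (1 - ε) * N * s) (B' := fun _ => (1 - ε) * N)
    (fun s hs => (hd s hs).continuousWithinAt)
    (fun s hs => (hd s (Ico_subset_Icc_self hs)).mono_of_mem_nhdsWithin
      (Icc_mem_nhdsGE_of_mem hs)) (by simp)
    (fun s _ => (hB s).continuousAt.continuousWithinAt)
    (fun s _ => (hB s).hasDerivWithinAt) (fun s hs => ?_) ⟨ht, le_rfl⟩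
  have hs' := Ico_subset_Icc_self hs
  have h1 := hN s hs'
  have h2 : f s ^ (1 - ε - 1) = (1 / f s) ^ ε := by
    rw [one_div, Real.inv_rpow (hpos s hs').le, ← Real.rpow_neg (hpos s hs').le]
    congr 1
    ring
  rw [h2]
  calc f' s * (1 - ε) * (1 / f s) ^ ε = (1 - ε) * ((1 / f s) ^ ε * f' s) := by ring
    _ ≤ (1 - ε) * N := mul_le_mul_of_nonneg_left h1 (by linarith)

theorem inv_lower_bound {τ a b ε : ℝ} (hτ : 0 < τ) (hε : ε < 1)
    (h : τ ^ (1 - ε) ≤ b / a) : (a / b) ^ (1 + ε / (1 - ε)) ≤ 1 / τ := by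
  have h1 : 0 < 1 - ε := by linarith
  have e : 1 + ε / (1 - ε) = (1 - ε)⁻¹ := by field_simp; ring
  have hp := Real.rpow_pos_of_pos hτ (1 - ε)
  have h2 : a / b ≤ (1 / τ) ^ (1 - ε) := by
    rw [one_div, Real.inv_rpow hτ.le, ← inv_div]
    exact inv_anti₀ hp h
  have hab : 0 < a / b := by
    rw [← inv_div]
    exact inv_pos.2 (hp.trans_le h)
  calc (a / b) ^ (1 + ε / (1 - ε)) ≤ ((1 / τ) ^ (1 - ε)) ^ (1 + ε / (1 - ε)) := by
        rw [e]; gcongr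
    _ = 1 / τ := by
        rw [e, Real.rpow_rpow_inv (by positivity) h1.ne']

/-- Uniform upper bound for the weighted rate of expansion. -/
theorem exists_expansion_bound (hK : 0 < K) (hcv : 0 < cv) (hγ : 1 < γ)
    (h₀ : AdmissibleData K cv γ u₀ τ₀ S₀) {ε : ℝ} (hε : 0 < ε) (hε' : ε < 1 / 4)
    (hS : ∀ x, HasDerivAt S₀ (deriv S₀ x) x) (hc : Continuous (deriv S₀)) :
    ∃ N : ℝ, 0 < N ∧ ∀ (T : EReal), 0 < T → ∀ u τ S : ℝ → ℝ → ℝ,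
      IsC1Solution K cv γ T u τ S →
      (∀ x, u x 0 = u₀ x) → (∀ x, τ x 0 = τ₀ x) → (∀ x, S x 0 = S₀ x) →
      ∀ x, ∀ t ∈ times T, (1 / τ x t) ^ ε * partialX u x t < N := by
  obtain ⟨lo, hi, D, Vmax, V, hm, hV, hV0, hVmax⟩ := exists_medium hK hcv hγ h₀ hS hc
  obtain ⟨Cu, hCu⟩ := h₀.u_bdd
  obtain ⟨Cρ, hCρ⟩ := h₀.ρ_bdd
  obtain ⟨Cα, hCα⟩ := h₀.α_bdd
  obtain ⟨Cβ, hCβ⟩ := h₀.β_bdd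
  obtain ⟨E, hE⟩ : ∃ E, E = etaScale K γ * Cρ ^ ((γ - 1) / 2) := ⟨_, rfl⟩
  have hη₀ : ∀ x, etaVar K γ (τ₀ x) ≤ E := fun x => by
    rw [hE]; exact etaVar_le hK hγ (h₀.τ_pos x) (hCρ x)
  obtain ⟨H, hH, hbound⟩ := exists_uniform_bound (M := max 1 (max Cu E)) (u₀ := u₀)
    (η₀ := fun x => etaVar K γ (τ₀ x)) hm hV hV0 hVmax
    (le_max_left _ _) (fun x => (hCu x).trans ((le_max_left _ _).trans (le_max_right _ _)))
    (fun x => (hη₀ x).trans ((le_max_right _ _).trans (le_max_right _ _)))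
  have hγ1 : 0 < γ - 1 := by linarith
  have hq : 0 < 2 * ε / (γ - 1) := by positivity
  -- Equivalent to `4 ε < γ + 1`.
  have hqν : 2 * ε / (γ - 1) < speedExp γ / 2 := by
    rw [speedExp, div_div, mul_comm (γ - 1) 2, ← div_div, div_lt_div_iff_of_pos_right hγ1]
    linarith
  obtain ⟨N₁, hN₁⟩ := exists_gradient_bound γ (speedScale K γ) lo hi D H (2 * ε / (γ - 1))
    (E ^ (2 * ε / (γ - 1)) * max Cα Cβ) hγ hm.D_nonneg hH hq hqν
  have hκ := Real.rpow_pos_of_pos (etaScale_pos hK hγ) (2 * ε / (γ - 1))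
  refine ⟨max (N₁ / etaScale K γ ^ (2 * ε / (γ - 1))) 0 + 1, by positivity,
    fun T hT u τ S h hu hτ hS x t ht => ?_⟩
  obtain ⟨t₁, ht₁, htt⟩ := exists_gt_mem_times ht
  have hf := isFlow_of_solution hK hcv hγ h hT ht₁
  have hinit := gradVar_init hK hcv hγ h hT hu hτ hS
  have hSeq : (fun x => S x 0) = S₀ := funext hS
  have hmeq : (fun x => mVar cv (S x 0)) = fun x => mVar cv (S₀ x) := by simp only [hS]
  rw [hmeq, hSeq] at hf hinit
  have hfin := hN₁ hm hf (hbound hf hu fun x => by rw [hτ]) (fun y b => ?_) t ht.1 htt x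
  · have h1 := hfin true
    have h2 := hfin false
    rw [etaVar_rpow hK hγ (h.τ_pos x t ht), gradVar, sgn_true] at h1
    rw [etaVar_rpow hK hγ (h.τ_pos x t ht), gradVar, sgn_false] at h2
    -- Adding the bounds for the two signs cancels the `η_x` and `m'` terms and leaves `2 u_x`.
    have h3 : (1 / τ x t) ^ ε * partialX u x t ≤ N₁ / etaScale K γ ^ (2 * ε / (γ - 1)) := by
      rw [le_div_iff₀ hκ]
      linarith
    linarith [le_max_left (N₁ / etaScale K γ ^ (2 * ε / (γ - 1))) 0]
  · have hp := etaVar_pos hK hγ (h₀.τ_pos y)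
    have hle : gradVar γ (sgn b) (fun x => mVar cv (S₀ x)) (mDeriv cv S₀) (partialX u)
        (fun x t => etaVar K γ (τ x t)) (etaDeriv K γ τ (partialX τ)) y 0 ≤ max Cα Cβ := by
      cases b
      · rw [(hinit y).2]
        exact ((le_abs_self _).trans (hCβ y)).trans (le_max_right _ _)
      · rw [(hinit y).1]
        exact ((le_abs_self _).trans (hCα y)).trans (le_max_left _ _)
    have hmax : 0 ≤ max Cα Cβ := ((abs_nonneg _).trans (hCα 0)).trans (le_max_left _ _)
    have hτy := hη₀ y
    rw [hτ]
    exact (mul_le_mul_of_nonneg_left hle (Real.rpow_nonneg hp.le _)).trans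
      (mul_le_mul_of_nonneg_right (Real.rpow_le_rpow hp.le hτy hq.le) hmax)

end

end GasDynamics

theorem theorem2 (K cv γ : ℝ) (hK : 0 < K) (hcv : 0 < cv) (hγ : 1 < γ)
    (u₀ τ₀ S₀ : ℝ → ℝ) (h₀ : FullEuler.AdmissibleData K cv γ u₀ τ₀ S₀)
    (ε : ℝ) (hε : 0 < ε) (hε' : ε < 1 / 4) :
    ∃ N₀ N₁ N₂ : ℝ, 0 < N₁ ∧ 0 < N₂ ∧
      ∀ (T : EReal), 0 < T → ∀ u τ S : ℝ → ℝ → ℝ,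
        FullEuler.IsC1Solution K cv γ T u τ S →
        (∀ x, u x 0 = u₀ x) → (∀ x, τ x 0 = τ₀ x) → (∀ x, S x 0 = S₀ x) →
        ∀ x, ∀ t ∈ FullEuler.times T,
          (1 / τ x t) ^ ε * FullEuler.partialT T τ x t
              = (1 / τ x t) ^ ε * FullEuler.partialX u x t ∧
          (1 / τ x t) ^ ε * FullEuler.partialX u x t < N₀ ∧
          (N₁ / (N₂ + t)) ^ (1 + ε / (1 - ε)) ≤ 1 / τ x t := by
  -- Smoothness of `S₀` is inherited from a solution that starts from it; if there is none, the
  -- claim is vacuous.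
  by_cases hex : ∃ (T : EReal) (u τ S : ℝ → ℝ → ℝ), 0 < T ∧
      FullEuler.IsC1Solution K cv γ T u τ S ∧ ∀ x, S x 0 = S₀ x
  swap
  · exact ⟨1, 1, 1, one_pos, one_pos, fun T hT u τ S h _ _ hS =>
      absurd ⟨T, u, τ, S, hT, h, hS⟩ hex⟩
  obtain ⟨hS, hc⟩ : (∀ x, HasDerivAt S₀ (deriv S₀ x) x) ∧ Continuous (deriv S₀) := by
    obtain ⟨T, u, τ, S, hT, h, hS⟩ := hex
    have := GasDynamics.entropy_contDiff h hT
    rwa [show (fun x => S x 0) = S₀ from funext hS] at this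
  obtain ⟨N, hN, hbound⟩ := GasDynamics.exists_expansion_bound hK hcv hγ h₀ hε hε' hS hc
  obtain ⟨C, hC⟩ := h₀.τ_bdd
  have hC0 : 0 < C := (h₀.τ_pos 0).trans_le ((le_abs_self _).trans (hC 0))
  have hε1 : 0 < 1 - ε := by linarith
  have hεN : 0 < (1 - ε) * N := mul_pos hε1 hN
  -- `N₁` and `N₂` are chosen so that `(N₂ + t) / N₁ = C ^ (1 - ε) + (1 - ε) N t`, the integrated
  -- bound for `τ ^ (1 - ε)`.
  refine ⟨N, 1 / ((1 - ε) * N), C ^ (1 - ε) / ((1 - ε) * N), by positivity, by positivity,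
    fun T hT u τ S h hu hτ hS x t ht => ?_⟩
  have hsub := GasDynamics.Icc_subset_times ht
  have hτ' := GasDynamics.hasPartials_of_contDiffOn hT h.contDiff_τ ht
  have hmass : ∀ s ∈ FullEuler.times T, FullEuler.partialT T τ x s = FullEuler.partialX u x s :=
    fun s hs => sub_eq_zero.1 (h.mass x s hs)
  refine ⟨by rw [hmass t ht], hbound T hT u τ S h hu hτ hS x t ht, ?_⟩
  refine GasDynamics.inv_lower_bound (h.τ_pos x t ht) (by linarith) ?_
  have key := GasDynamics.rpow_le_of_deriv_le (f := fun s => τ x s) (ε := ε) (N := N) ht.1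
    (by linarith) (fun s hs => hτ'.deriv_t hs) (fun s hs => h.τ_pos x s (hsub hs))
    (fun s hs => by
      rw [hmass s (hsub hs)]
      exact (hbound T hT u τ S h hu hτ hS x s (hsub hs)).le)
  have h1 : τ x 0 ^ (1 - ε) ≤ C ^ (1 - ε) := by
    rw [hτ]
    have := (le_abs_self _).trans (hC x)
    have := (h₀.τ_pos x).le
    gcongr
  have h2 : (C ^ (1 - ε) / ((1 - ε) * N) + t) / (1 / ((1 - ε) * N)) =
      C ^ (1 - ε) + (1 - ε) * N * t := by
    field_simp
  rw [h2]
  exact key.trans (by linarith)
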